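/- Let $N\ge 2$ be an integer and let $\Omega_N$ be the hierarchical group of order $N$, that is, the set of sequences $\mathbf x=(x_1,x_2,\dots)$ with $x_i\in\mathbb Z_N$ and $x_i=0$ for all but finitely many $i$, with the ultrametric $d(\mathbf x,\mathbf y)=\max\{i: x_i\ne y_i\}$ for $\mathbf x\neq\mathbf y$ and $d(\mathbf x,\mathbf x)=0$. Let $0<\delta<1$, and let $c_1,c_2,\dots$ be positive real numbers with $\inf_{k\ge1}c_k>0$ and $\sum_{k\ge1} c_kN^{-\delta k}<\infty$. Join any two points $\mathbf x,\mathbf y\in\Omega_N$ with $d(\mathbf x,\mathbf y)=k\ge1$ by an edge with probability $\min\left(c_k/N^{(1+\delta)k},\,1\right)$, all edges being independent. Then, for almost every realization of this random graph, the simple random walk on every percolation cluster (every infinite connected component) is transient: started at any vertex of the cluster and moving at each step to a uniformly chosen neighbour, it has positive probability of never returning to its starting vertex. -/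

import Mathlib

open MeasureTheory ProbabilityTheory

namespace HierPerc

noncomputable section

/-! ### The hierarchical group -/

/-- The hierarchical group of order `N`: sequences in `ℤ/N` that are eventually zero, with
componentwise addition. The entry at index `i : ℕ` is the coordinate usually written `x_{i+1}`. -/
abbrev HierGroup (N : ℕ) : Type := ℕ →₀ ZMod N

/-- The group is countable and discrete: every subset is measurable. -/
instance instMeasurableSpaceHierGroup (N : ℕ) : MeasurableSpace (HierGroup N) := ⊤

instance instDiscreteHierGroup (N : ℕ) : DiscreteMeasurableSpace (HierGroup N) :=
  ⟨fun _ => MeasurableSpace.measurableSet_top⟩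

/-- Every subset of a subtype of a discrete measurable space is measurable. -/
instance instDiscreteSubtype {V : Type*} [MeasurableSpace V] [DiscreteMeasurableSpace V]
    (p : V → Prop) : DiscreteMeasurableSpace {v // p v} :=
  ⟨fun s => by
    have h := (MeasurableSet.of_discrete (s := (Subtype.val '' s : Set V))).preimage
      (measurable_subtype_coe (p := p))
    rwa [Set.preimage_image_eq s Subtype.val_injective] at h⟩

/-- The hierarchical distance: the largest (one-based) index of a coordinate in which `x` and `y`
differ, and `0` when `x = y`. -/
def hdist {N : ℕ} (x y : HierGroup N) : ℕ := (x - y).support.sup fun i => i + 1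

theorem hdist_comm {N : ℕ} (x y : HierGroup N) : hdist x y = hdist y x := by
  unfold hdist
  rw [← neg_sub y x, Finsupp.support_neg]

/-! ### Long-range percolation on the hierarchical group -/

/-- The connection probability `min (c_k / N^{(1+δ)k}, 1)` of two points at distance `k`. (The
clamp to `[0, 1]` acts as `min · 1`, because the numbers `c_k` are positive.) -/
def connProb (N : ℕ) (δ : ℝ) (c : ℕ → ℝ) (k : ℕ) : unitInterval :=
  Set.projIcc (0 : ℝ) 1 zero_le_one (c k / (N : ℝ) ^ ((1 + δ) * (k : ℝ)))

/-- The connection probability of an unordered pair of points. -/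
def edgeProb (N : ℕ) (δ : ℝ) (c : ℕ → ℝ) (e : Sym2 (HierGroup N)) : unitInterval :=
  connProb N δ c (Sym2.lift ⟨hdist, hdist_comm⟩ e)

/-- The law of the percolation configuration: every unordered pair is declared open (`true`)
with its connection probability, independently of all other pairs. -/
def percLaw (N : ℕ) (δ : ℝ) (c : ℕ → ℝ) : Measure (Sym2 (HierGroup N) → Bool) :=
  Measure.infinitePi fun e => bernoulliMeasure true false (edgeProb N δ c e)

/-- The random graph: two distinct points are joined by an edge iff their pair is open. (The
states of the degenerate pairs `s(x, x)` play no role.) -/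
def percGraph {N : ℕ} (ω : Sym2 (HierGroup N) → Bool) : SimpleGraph (HierGroup N) where
  Adj x y := x ≠ y ∧ ω s(x, y) = true
  symm := ⟨fun x y h => ⟨h.1.symm, by rw [Sym2.eq_swap]; exact h.2⟩⟩
  loopless := ⟨fun _ h => h.1 rfl⟩

/-! ### Simple random walk -/

open Classical in
/-- One step of the simple random walk on `G`: a uniformly chosen neighbour. Where no such
choice exists, because there are no neighbours or infinitely many, the walk stays put; so a
vertex of infinite degree is absorbing, and a transient graph is locally finite. -/
def srwStep {V : Type*} (G : SimpleGraph V) (x : V) : PMF V :=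
  if h : (G.neighborSet x).Finite ∧ (G.neighborSet x).Nonempty then
    PMF.uniformOfFinset h.1.toFinset (h.1.toFinset_nonempty.2 h.2)
  else PMF.pure x

/-- The transition kernel of the simple random walk. -/
def srwKernel {V : Type*} [MeasurableSpace V] [DiscreteMeasurableSpace V] (G : SimpleGraph V) :
    Kernel V V where
  toFun x := (srwStep G x).toMeasure
  measurable' := Measurable.of_discrete

instance instMarkovSrwKernel {V : Type*} [MeasurableSpace V] [DiscreteMeasurableSpace V]
    (G : SimpleGraph V) : IsMarkovKernel (srwKernel G) :=
  ⟨fun x => PMF.toMeasure.isProbabilityMeasure (srwStep G x)⟩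

/-- The transition from a history up to time `n` to time `n + 1`, depending on the history only
through the position at time `n`. -/
def srwHistoryKernel {V : Type*} [MeasurableSpace V] [DiscreteMeasurableSpace V]
    (G : SimpleGraph V) (n : ℕ) : Kernel (Finset.Iic n → V) V :=
  (srwKernel G).comap (fun h => h ⟨n, Finset.mem_Iic.2 le_rfl⟩) (measurable_pi_apply _)

instance instMarkovSrwHistoryKernel {V : Type*} [MeasurableSpace V] [DiscreteMeasurableSpace V]
    (G : SimpleGraph V) (n : ℕ) : IsMarkovKernel (srwHistoryKernel G n) := by
  unfold srwHistoryKernel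
  infer_instance

/-- The law on path space of the simple random walk on `G` started at `x`. -/
def srwLaw {V : Type*} [MeasurableSpace V] [DiscreteMeasurableSpace V]
    (G : SimpleGraph V) (x : V) : Measure (ℕ → V) :=
  Kernel.trajMeasure (X := fun _ => V) (Measure.dirac x) (srwHistoryKernel G)

/-- The simple random walk on `G` is transient: from every starting point there is a positive
probability of never returning to it. -/
def SRWTransient {V : Type*} [MeasurableSpace V] [DiscreteMeasurableSpace V]
    (G : SimpleGraph V) : Prop :=
  ∀ x : V, 0 < srwLaw G x {X | ∀ n : ℕ, 1 ≤ n → X n ≠ x}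

end

end HierPerc

namespace HierPerc

/-! The walk escapes from a vertex with positive probability once the effective resistance to
infinity is finite. Test the Dirichlet inequality on the probability of hitting `x` within `n`
steps: its energy is at most `2 * deg x` times the probability of no return during the first `n + 1`
steps, so these probabilities stay bounded below (`srwLaw_pos_of_finiteResistance`). It remains to
show that the event `Bad`, on which the cluster of `x₀` is infinite but its resistance to infinity
is infinite too, is null.

Suppose that `Bad` has positive outer probability. Its measurable hull is approximated up to `ε` by
an event `G` that depends on the edges in some ball, and every measurable part of `G` that misses
`Bad` has probability below `ε`. A vertex is marked if the configuration seen from it lies in `G`.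
The contradiction is a part of `G` with finite resistance and probability at least `q`, where `q`
depends only on `N` and the outer probability of `Bad`; so `ε ≤ q` can be required beforehand.
Neither ergodicity nor uniqueness of the infinite cluster enters.

Marked clusters grow for the following reasons. A marked `n`-cluster that is small compared with the
inverse of the remaining weight `tailWt` would be isolated, hence finite, with probability bounded
below; so it is usually large (`le_law_markedSize_tail`). The function `u n h = E (1 - exp (-h Z))`,
with `Z` the marked size at level `n`, satisfies the discrete Burgers inequality `u (n + 1) h ≥ u n
h + u n h * (u n (h + w n) - u n h)` of a mean-field coalescent (`magnetization_succ_ge`). Its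
truncated area grows in proportion to `w n` but is bounded, so at some level `m` clusters reach the
order of `1 / w m` (`exists_explosion`). Counting cuts between two sibling balls then gives a marked
cluster of positive density (`le_law_markedSize_dense`).

Dense clusters start a renormalization along scales `l i` that grow by a factor slightly above `1`.
Two cores with about `N ^ l i` points have `N ^ (2 * l i)` pairs, and since `δ < 1` this exceeds `N
^ ((1 + δ) * l (i + 2))` by a power, so unlinked cores are very rare and a core survives at all
scales with positive probability (`le_law_core_nonempty`). The many parallel links between
consecutive scales make the series of resistances converge (`finiteResistance_of_core_nonempty`). -/

/-! ### Escape probabilities and Dirichlet energy. -/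

/-- The effective resistance from `x` to infinity is finite: point evaluation at `x` is bounded by
the Dirichlet energy, uniformly over finitely supported functions. -/
def FiniteResistance {V : Type*} (G : SimpleGraph V) (x : V) : Prop :=
  ∃ D : ℝ, ∀ f : V → ℝ, f.support.Finite → ∃ B : Finset V,
    open Classical in
    f x ^ 2 ≤ D * ∑ a ∈ B, ∑ b ∈ B, if G.Adj a b then (f a - f b) ^ 2 else 0

open Classical in
/-- The neighbours of a vertex as a finite set (empty when there are infinitely many). -/
noncomputable def nbhd {V : Type*} (G : SimpleGraph V) (y : V) : Finset V :=
  if h : (G.neighborSet y).Finite then h.toFinset else ∅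

theorem mem_nbhd {V : Type*} {G : SimpleGraph V} (hG : ∀ y, (G.neighborSet y).Finite) {y z : V} :
    z ∈ nbhd G y ↔ G.Adj y z := by
  simp [nbhd, hG y]

/-- The average of a function over the neighbours of a vertex. -/
noncomputable def nbAvg {V : Type*} (G : SimpleGraph V) (f : V → ℝ) (y : V) : ℝ :=
  (∑ z ∈ nbhd G y, f z) / (nbhd G y).card

open Classical in
/-- The probability that the walk visits `x` within `n` steps, as a function of the start. -/
noncomputable def hitProb {V : Type*} (G : SimpleGraph V) (x : V) : ℕ → V → ℝ
  | 0, y => if y = x then 1 else 0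
  | n + 1, y => if y = x then 1 else nbAvg G (hitProb G x n) y

theorem nbAvg_mono {V : Type*} (G : SimpleGraph V) {f g : V → ℝ} (h : ∀ z, f z ≤ g z) (y : V) :
    nbAvg G f y ≤ nbAvg G g y := by
  unfold nbAvg
  gcongr
  exact h _

theorem nbAvg_nonneg {V : Type*} (G : SimpleGraph V) {f : V → ℝ} (h : ∀ z, 0 ≤ f z) (y : V) :
    0 ≤ nbAvg G f y :=
  div_nonneg (Finset.sum_nonneg fun _ _ => h _) (Nat.cast_nonneg _)

theorem nbAvg_le_one {V : Type*} (G : SimpleGraph V) {f : V → ℝ} (h : ∀ z, f z ≤ 1) (y : V) :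
    nbAvg G f y ≤ 1 := by
  unfold nbAvg
  apply div_le_one_of_le₀ _ (Nat.cast_nonneg _)
  calc ∑ z ∈ nbhd G y, f z ≤ ∑ _z ∈ nbhd G y, (1 : ℝ) := Finset.sum_le_sum fun _ _ => h _
    _ = _ := by simp

theorem hitProb_self {V : Type*} (G : SimpleGraph V) (x : V) (n : ℕ) : hitProb G x n x = 1 := by
  cases n <;> simp [hitProb]

theorem hitProb_nonneg {V : Type*} (G : SimpleGraph V) (x : V) (n : ℕ) :
    ∀ y, 0 ≤ hitProb G x n y := by
  induction n with
  | zero => intro y; simp only [hitProb]; split_ifs <;> norm_num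
  | succ n ih =>
    intro y; simp only [hitProb]; split_ifs
    · norm_num
    · exact nbAvg_nonneg G ih y

theorem hitProb_le_one {V : Type*} (G : SimpleGraph V) (x : V) (n : ℕ) :
    ∀ y, hitProb G x n y ≤ 1 := by
  induction n with
  | zero => intro y; simp only [hitProb]; split_ifs <;> norm_num
  | succ n ih =>
    intro y; simp only [hitProb]; split_ifs
    · norm_num
    · exact nbAvg_le_one G ih y

/-- Off `x` the next iterate is the neighbour average, so this monotonicity says that `hitProb G x
n` is subharmonic off `x`. The energy bound rests on that. -/
theorem hitProb_le_succ {V : Type*} (G : SimpleGraph V) (x : V) (n : ℕ) :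
    ∀ y, hitProb G x n y ≤ hitProb G x (n + 1) y := by
  induction n with
  | zero =>
    intro y
    by_cases h : y = x
    · subst h; simp [hitProb_self]
    · have : hitProb G x 0 y = 0 := by simp [hitProb, h]
      rw [this]; exact hitProb_nonneg _ _ _ _
  | succ n ih =>
    intro y
    by_cases h : y = x
    · subst h; simp [hitProb_self]
    · rw [hitProb, hitProb]; simp only [h, if_false]
      exact nbAvg_mono G ih y

theorem hitProb_support_finite {V : Type*} {G : SimpleGraph V}
    (hG : ∀ y, (G.neighborSet y).Finite) (x : V) (n : ℕ) : (hitProb G x n).support.Finite := by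
  induction n with
  | zero =>
    refine (Set.finite_singleton x).subset fun y hy => ?_
    by_contra h
    exact hy (by simp only [Set.mem_singleton_iff] at h; simp [hitProb, h])
  | succ n ih =>
    refine ((Set.finite_singleton x).union (ih.biUnion fun z _ => hG z)).subset fun y hy => ?_
    by_cases h : y = x
    · exact Or.inl h
    · right
      by_contra hc
      simp only [Set.mem_iUnion, not_exists] at hc
      apply hy
      rw [hitProb]; simp only [h, if_false, nbAvg]
      rw [Finset.sum_eq_zero, zero_div]
      intro z hz
      by_contra hz0
      exact hc z hz0 ((mem_nbhd hG).1 hz).symm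

-- Summation by parts turns the energy into twice the sum of `deg a * f a * (f a - nbAvg G f a)`;
-- the factor `2` is there because ordered pairs count each edge twice. By subharmonicity every term
-- except that of `x` is nonpositive, and `f x = 1`.
open Classical in
theorem energy_hitProb_le {V : Type*} {G : SimpleGraph V}
    (hG : ∀ y, (G.neighborSet y).Finite) (x : V) (n : ℕ) (B : Finset V) :
    ∑ a ∈ B, ∑ b ∈ B, (if G.Adj a b then (hitProb G x n a - hitProb G x n b) ^ 2 else 0)
      ≤ 2 * (nbhd G x).card * (1 - nbAvg G (hitProb G x n) x) := by
  set f := hitProb G x n with hf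
  set S := (hitProb_support_finite hG x n).toFinset with hS
  -- The support together with all its neighbours, so that no edge at a point of the support is lost
  -- in the summation by parts.
  set B' := B ∪ S ∪ S.biUnion (nbhd G) with hB'
  have h1 : ∑ a ∈ B, ∑ b ∈ B, (if G.Adj a b then (f a - f b) ^ 2 else 0)
      ≤ ∑ a ∈ B', ∑ b ∈ B', (if G.Adj a b then (f a - f b) ^ 2 else 0) := by
    have hsub : B ⊆ B' := fun a ha => by simp [hB', ha]
    refine (Finset.sum_le_sum fun a _ => Finset.sum_le_sum_of_subset_of_nonneg hsub
      fun b _ _ => ?_).trans (Finset.sum_le_sum_of_subset_of_nonneg hsub fun a _ _ => ?_)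
    · split_ifs <;> positivity
    · exact Finset.sum_nonneg fun b _ => by split_ifs <;> positivity
  refine h1.trans ?_
  have h2 : ∑ a ∈ B', ∑ b ∈ B', (if G.Adj a b then (f a - f b) ^ 2 else 0)
      = 2 * ∑ a ∈ B', ∑ b ∈ B', (if G.Adj a b then f a * (f a - f b) else 0) := by
    have hsw : ∑ a ∈ B', ∑ b ∈ B', (if G.Adj a b then f a * (f a - f b) else 0)
        = ∑ a ∈ B', ∑ b ∈ B', (if G.Adj a b then f b * (f b - f a) else 0) := by
      rw [Finset.sum_comm]
      simp only [G.adj_comm]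
    rw [two_mul]
    nth_rewrite 2 [hsw]
    rw [← Finset.sum_add_distrib]
    refine Finset.sum_congr rfl fun a _ => ?_
    rw [← Finset.sum_add_distrib]
    refine Finset.sum_congr rfl fun b _ => ?_
    split_ifs <;> ring
  have h3 : ∀ a ∈ B', ∑ b ∈ B', (if G.Adj a b then f a * (f a - f b) else 0)
      = f a * ((nbhd G a).card * (f a - nbAvg G f a)) := by
    intro a _
    by_cases ha : f a = 0
    · simp [ha]
    · have haS : a ∈ S := by simpa [hS] using ha
      rw [← Finset.sum_filter]
      have : Finset.filter (fun b => G.Adj a b) B' = nbhd G a := by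
        ext b
        simp only [Finset.mem_filter, mem_nbhd hG]
        refine ⟨fun h => h.2, fun h => ⟨?_, h⟩⟩
        simp only [hB', Finset.mem_union, Finset.mem_biUnion]
        exact Or.inr ⟨a, haS, (mem_nbhd hG).2 h⟩
      rw [this, ← Finset.mul_sum, Finset.sum_sub_distrib]
      congr 1
      unfold nbAvg
      rcases (nbhd G a).eq_empty_or_nonempty with h | h
      · simp [h]
      · have : ((nbhd G a).card : ℝ) ≠ 0 := by exact_mod_cast h.card_pos.ne'
        simp; field_simp
  rw [h2, Finset.sum_congr rfl h3]
  have hx : x ∈ B' := by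
    have : x ∈ S := by simp [hS, hitProb_self]
    simp [hB', this]
  rw [← Finset.add_sum_erase _ _ hx]
  have h4 : ∑ a ∈ B'.erase x, f a * ((nbhd G a).card * (f a - nbAvg G f a)) ≤ 0 := by
    refine Finset.sum_nonpos fun a ha => ?_
    have hax := (Finset.mem_erase.1 ha).1
    refine mul_nonpos_of_nonneg_of_nonpos (hitProb_nonneg _ _ _ _)
      (mul_nonpos_of_nonneg_of_nonpos (Nat.cast_nonneg _) ?_)
    have := hitProb_le_succ G x n a
    rw [hitProb] at this
    simp only [hax, if_false] at this
    linarith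
  have h5 : f x = 1 := hitProb_self G x n
  rw [h5]
  linarith

section walk

variable {V : Type*} [MeasurableSpace V] [DiscreteMeasurableSpace V]

open Classical in
theorem lintegral_srwKernel {G : SimpleGraph V} (hG : ∀ y, (G.neighborSet y).Finite) {y : V}
    (hy : (nbhd G y).Nonempty) {f : V → ℝ} (hf : ∀ z, 0 ≤ f z) :
    ∫⁻ z, ENNReal.ofReal (f z) ∂(srwKernel G y) = ENNReal.ofReal (nbAvg G f y) := by
  have hne : (G.neighborSet y).Nonempty := by
    obtain ⟨z, hz⟩ := hy
    exact ⟨z, (mem_nbhd hG).1 hz⟩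
  have hstep : srwStep G y = PMF.uniformOfFinset (nbhd G y) hy := by
    unfold srwStep
    rw [dif_pos ⟨hG y, hne⟩]
    congr 1
    simp [nbhd, hG y]
  change ∫⁻ z, ENNReal.ofReal (f z) ∂(srwStep G y).toMeasure = _
  have hm : (srwStep G y).toMeasure
      = ∑ z ∈ nbhd G y, ((nbhd G y).card : ENNReal)⁻¹ • Measure.dirac z := by
    ext s hs
    rw [PMF.toMeasure_apply _ hs, hstep]
    simp only [Measure.coe_finsetSum, Finset.sum_apply, Measure.smul_apply, smul_eq_mul]
    rw [tsum_eq_sum (s := nbhd G y)]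
    · refine Finset.sum_congr rfl fun z hz => ?_
      by_cases hzs : z ∈ s <;> simp [Measure.dirac_apply' _ hs, hzs, PMF.uniformOfFinset_apply, hz]
    · intro z hz
      by_cases hzs : z ∈ s <;> simp [hzs, PMF.uniformOfFinset_apply, hz]
  rw [hm, lintegral_finsetSum_measure]
  simp only [lintegral_smul_measure, smul_eq_mul]
  have : ∀ z, ∫⁻ w, ENNReal.ofReal (f w) ∂(Measure.dirac z) = ENNReal.ofReal (f z) := fun z =>
    lintegral_dirac' _ (Measurable.of_discrete)
  simp only [this]
  rw [← Finset.mul_sum, nbAvg, ENNReal.ofReal_div_of_pos (by exact_mod_cast hy.card_pos),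
    ENNReal.ofReal_sum_of_nonneg fun z _ => hf z, ENNReal.ofReal_natCast, ENNReal.div_eq_inv_mul]

instance instProbSrwLaw (G : SimpleGraph V) (x : V) : IsProbabilityMeasure (srwLaw G x) := by
  unfold srwLaw
  infer_instance

theorem srwLaw_map_zero (G : SimpleGraph V) (x : V) : (srwLaw G x).map (fun X => X 0) =
    Measure.dirac x := by
  have h : (fun X : ℕ → V => X 0) = (fun y : Finset.Iic 0 → V => y ⟨0, Finset.mem_Iic.2 le_rfl⟩) ∘
      Preorder.frestrictLe 0 := rfl
  rw [h, ← Measure.map_map (by fun_prop) (by fun_prop), srwLaw, Kernel.trajMeasure,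
    Measure.map_comp _ _ (by fun_prop), Kernel.traj_map_frestrictLe, Kernel.partialTraj_self]
  simp only [Measure.id_comp]
  rw [Measure.map_map (by fun_prop) (by fun_prop)]
  exact Measure.map_id

/-- The Markov property, tested on an event of the past times a function of the next position. -/
theorem lintegral_srwLaw_succ (G : SimpleGraph V) (x : V) (n : ℕ) (A : Set (Finset.Iic n → V))
    (hA : MeasurableSet A) (f : V → ENNReal) :
    ∫⁻ X, A.indicator 1 (Preorder.frestrictLe n X) * f (X (n + 1)) ∂(srwLaw G x)
      = ∫⁻ X, A.indicator 1 (Preorder.frestrictLe n X) * ∫⁻ z, f z ∂(srwKernel G (X n))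
        ∂(srwLaw G x) := by
  have key := Kernel.map_frestrictLe_trajMeasure_compProd_eq_map_trajMeasure (X := fun _ => V)
    (μ₀ := Measure.dirac x) (κ := srwHistoryKernel G) (a := n)
  set g : (Finset.Iic n → V) × V → ENNReal := fun p => A.indicator 1 p.1 * f p.2 with hg
  have hgm : Measurable g := by
    refine Measurable.mul ?_ ?_
    · exact (measurable_one.indicator hA).comp measurable_fst
    · exact (Measurable.of_discrete (f := f)).comp measurable_snd
  have h1 : ∫⁻ X, A.indicator 1 (Preorder.frestrictLe n X) * f (X (n + 1)) ∂(srwLaw G x)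
      = ∫⁻ p, g p ∂((srwLaw G x).map (fun X => (Preorder.frestrictLe n X, X (n + 1)))) := by
    rw [lintegral_map hgm (by fun_prop)]
  rw [h1, srwLaw, ← key, Measure.lintegral_compProd hgm, lintegral_map _ (by fun_prop)]
  · refine lintegral_congr fun X => ?_
    simp only [hg]
    rw [lintegral_const_mul _ (Measurable.of_discrete)]
    rfl
  · exact hgm.lintegral_kernel_prod_right'

/-- Vertices without neighbours need care: the walk stays put there, while `nbAvg` is `0` by the
convention for division by zero. Both sides are then `1`, because such a vertex is not `x`. -/
theorem lintegral_srwKernel_one_sub_hitProb {G : SimpleGraph V}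
    (hG : ∀ y, (G.neighborSet y).Finite) {x : V} (hx : (nbhd G x).Nonempty) (n : ℕ) (y : V) :
    ∫⁻ z, ENNReal.ofReal (1 - hitProb G x n z) ∂(srwKernel G y)
      = ENNReal.ofReal (1 - nbAvg G (hitProb G x n) y) := by
  rcases (nbhd G y).eq_empty_or_nonempty with h | h
  · have hyx : y ≠ x := by rintro rfl; simp [h] at hx
    have hstep : srwStep G y = PMF.pure y := by
      unfold srwStep
      rw [dif_neg]
      rintro ⟨-, z, hz⟩
      have : z ∈ nbhd G y := (mem_nbhd hG).2 hz
      simp [h] at this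
    change ∫⁻ z, _ ∂(srwStep G y).toMeasure = _
    rw [hstep, PMF.toMeasure_pure, lintegral_dirac' _ Measurable.of_discrete]
    have h0 : nbAvg G (hitProb G x n) y = 0 := by simp [nbAvg, h]
    have h1 : hitProb G x n y = 0 := by
      cases n <;> simp [hitProb, hyx, nbAvg, h]
    rw [h0, h1]
  · rw [lintegral_srwKernel hG h fun z => by linarith [hitProb_le_one G x n z]]
    congr 1
    have : ((nbhd G y).card : ℝ) ≠ 0 := by exact_mod_cast h.card_pos.ne'
    simp only [nbAvg, Finset.sum_sub_distrib, Finset.sum_const, nsmul_eq_mul, mul_one, sub_div]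
    rw [div_self this]

-- The integrand is the event of no return up to time `j` times the conditional probability of
-- avoiding `x` during the next `n + 1` steps. In the induction on `n`, for all `j`, the Markov
-- property moves one step from the second factor to the first.
open Classical in
theorem lintegral_srwLaw_avoid {G : SimpleGraph V}
    (hG : ∀ y, (G.neighborSet y).Finite) {x : V} (hx : (nbhd G x).Nonempty) (n : ℕ) :
    ∀ j, ∫⁻ X, {Y : Finset.Iic j → V | ∀ i, 1 ≤ i.1 → Y i ≠ x}.indicator 1
        (Preorder.frestrictLe j X) *
        ∫⁻ z, ENNReal.ofReal (1 - hitProb G x n z) ∂(srwKernel G (X j)) ∂(srwLaw G x)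
      = srwLaw G x {X | ∀ i, 1 ≤ i → i ≤ j + n + 1 → X i ≠ x} := by
  have hmeas : ∀ j, MeasurableSet {Y : Finset.Iic j → V | ∀ i, 1 ≤ i.1 → Y i ≠ x} := by
    intro j
    simp only [Set.ofPred_forall]
    refine MeasurableSet.iInter fun i => MeasurableSet.iInter fun _ => ?_
    exact (MeasurableSet.of_discrete (s := ({x}ᶜ : Set V))).preimage (measurable_pi_apply i)
  induction n with
  | zero =>
    intro j
    rw [← lintegral_srwLaw_succ G x j _ (hmeas j), ← lintegral_indicator_one]
    · refine lintegral_congr fun X => ?_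
      simp only [hitProb, Set.indicator_apply, Set.mem_ofPred_eq, Pi.one_apply]
      have hiff : (∀ i, 1 ≤ i → i ≤ j + 0 + 1 → X i ≠ x) ↔
          (∀ i : Finset.Iic j, 1 ≤ i.1 → Preorder.frestrictLe (π := fun _ => V) j X i ≠ x) ∧
            X (j + 1) ≠ x := by
        constructor
        · intro h
          exact ⟨fun i hi => h _ hi (by have := Finset.mem_Iic.1 i.2; omega),
            h _ (by omega) (by omega)⟩
        · rintro ⟨h1, h2⟩ i hi hij
          rcases Nat.lt_or_ge j i with h | h
          · obtain rfl : i = j + 1 := by omega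
            exact h2
          · exact h1 ⟨i, Finset.mem_Iic.2 h⟩ hi
      simp only [hiff]
      by_cases h1 : (∀ i : Finset.Iic j, 1 ≤ i.1 →
        Preorder.frestrictLe (π := fun _ => V) j X i ≠ x) <;>
      by_cases h2 : X (j + 1) = x <;> simp [h2]
    · simp only [Set.ofPred_forall]
      refine MeasurableSet.iInter fun i => MeasurableSet.iInter fun _ =>
        MeasurableSet.iInter fun _ => ?_
      exact (MeasurableSet.of_discrete (s := ({x}ᶜ : Set V))).preimage (measurable_pi_apply i)
  | succ n ih =>
    intro j
    rw [← lintegral_srwLaw_succ G x j _ (hmeas j), show j + (n + 1) + 1 = (j + 1) + n + 1 by omega,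
      ← ih (j + 1)]
    refine lintegral_congr fun X => ?_
    rw [lintegral_srwKernel_one_sub_hitProb hG hx]
    simp only [hitProb, Set.indicator_apply, Set.mem_ofPred_eq, Pi.one_apply]
    have hiff : (∀ i : Finset.Iic (j + 1), 1 ≤ i.1 →
        Preorder.frestrictLe (π := fun _ => V) (j + 1) X i ≠ x) ↔
        (∀ i : Finset.Iic j, 1 ≤ i.1 → Preorder.frestrictLe (π := fun _ => V) j X i ≠ x) ∧
          X (j + 1) ≠ x := by
      constructor
      · intro h
        exact ⟨fun i hi => h ⟨i.1, Finset.mem_Iic.2 (by have := Finset.mem_Iic.1 i.2; omega)⟩ hi,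
          h ⟨j + 1, Finset.mem_Iic.2 le_rfl⟩ (by simp)⟩
      · rintro ⟨h1, h2⟩ ⟨i, hij⟩ hi
        rcases Nat.lt_or_ge j i with h | h
        · have := Finset.mem_Iic.1 hij
          obtain rfl : i = j + 1 := by omega
          exact h2
        · exact h1 ⟨i, Finset.mem_Iic.2 h⟩ hi
    simp only [hiff]
    by_cases h1 : (∀ i : Finset.Iic j, 1 ≤ i.1 →
      Preorder.frestrictLe (π := fun _ => V) j X i ≠ x) <;>
    by_cases h2 : X (j + 1) = x <;> simp [h2]

/-- A vertex of a locally finite graph with finite resistance to infinity has positive escape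
probability. -/
theorem srwLaw_pos_of_finiteResistance {G : SimpleGraph V}
    (hG : ∀ y, (G.neighborSet y).Finite) {x : V} (hx : FiniteResistance G x) :
    0 < srwLaw G x {X | ∀ n : ℕ, 1 ≤ n → X n ≠ x} := by
  obtain ⟨D, hD⟩ := hx
  -- The test function `hitProb G x n` has value `1` at `x`; `max D 1` makes the constant positive.
  have hb : ∀ n, 1 ≤ max D 1 * (2 * (nbhd G x).card * (1 - nbAvg G (hitProb G x n) x)) := by
    intro n
    obtain ⟨B, hB⟩ := hD (hitProb G x n) (hitProb_support_finite hG x n)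
    rw [hitProb_self, one_pow] at hB
    have hE := energy_hitProb_le hG x n B
    refine hB.trans ?_
    refine mul_le_mul (le_max_left _ _) hE ?_ (by positivity)
    exact Finset.sum_nonneg fun _ _ => Finset.sum_nonneg fun _ _ => by split_ifs <;> positivity
  have hne : (nbhd G x).Nonempty := by
    rw [Finset.nonempty_iff_ne_empty]
    intro h
    have := hb 0
    simp [h] at this
    linarith
  set ε : ℝ := (max D 1 * (2 * (nbhd G x).card))⁻¹ with hε
  have hpos : 0 < max D 1 * (2 * ((nbhd G x).card : ℝ)) := by
    have : (0 : ℝ) < (nbhd G x).card := by exact_mod_cast hne.card_pos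
    positivity
  have hlow : ∀ n, ENNReal.ofReal ε ≤
      srwLaw G x {X | ∀ i, 1 ≤ i → i ≤ n → X i ≠ x} := by
    intro n
    have h1 := lintegral_srwLaw_avoid hG hne n 0
    have h2 : ENNReal.ofReal (1 - nbAvg G (hitProb G x n) x) =
        srwLaw G x {X | ∀ i, 1 ≤ i → i ≤ 0 + n + 1 → X i ≠ x} := by
      rw [← h1]
      have h3 : ∀ X : ℕ → V, {Y : Finset.Iic 0 → V | ∀ i, 1 ≤ i.1 → Y i ≠ x}.indicator
          (1 : (Finset.Iic 0 → V) → ENNReal) (Preorder.frestrictLe 0 X) = 1 := by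
        intro X
        rw [Set.indicator_of_mem]
        · rfl
        · rintro ⟨i, hi⟩ h1
          have := Finset.mem_Iic.1 hi
          simp at h1
          omega
      simp only [h3, one_mul, lintegral_srwKernel_one_sub_hitProb hG hne]
      have h4 : ∫⁻ X, ENNReal.ofReal (1 - nbAvg G (hitProb G x n) (X 0)) ∂(srwLaw G x)
          = ∫⁻ y, ENNReal.ofReal (1 - nbAvg G (hitProb G x n) y)
            ∂((srwLaw G x).map (fun X => X 0)) := by
        rw [lintegral_map Measurable.of_discrete (by fun_prop)]
      rw [h4, srwLaw_map_zero, lintegral_dirac' _ Measurable.of_discrete]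
    calc ENNReal.ofReal ε ≤ ENNReal.ofReal (1 - nbAvg G (hitProb G x n) x) := by
          apply ENNReal.ofReal_le_ofReal
          rw [hε, inv_le_iff_one_le_mul₀ hpos]
          linarith [hb n]
      _ = _ := h2
      _ ≤ _ := measure_mono (Set.ofPred_subset_ofPred.2 fun X hX i hi hin => hX i hi (by omega))
  have hInter : {X : ℕ → V | ∀ n : ℕ, 1 ≤ n → X n ≠ x} =
      ⋂ n : ℕ, {X | ∀ i, 1 ≤ i → i ≤ n → X i ≠ x} := by
    ext X
    simp only [Set.mem_ofPred_eq, Set.mem_iInter]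
    exact ⟨fun h n i hi _ => h i hi, fun h n hn => h n n hn le_rfl⟩
  have hmeas : ∀ n : ℕ, MeasurableSet {X : ℕ → V | ∀ i, 1 ≤ i → i ≤ n → X i ≠ x} := by
    intro n
    simp only [Set.ofPred_forall]
    refine MeasurableSet.iInter fun i => MeasurableSet.iInter fun _ =>
      MeasurableSet.iInter fun _ => ?_
    exact (MeasurableSet.of_discrete (s := ({x}ᶜ : Set V))).preimage (measurable_pi_apply i)
  have hanti : Antitone fun n : ℕ => {X : ℕ → V | ∀ i, 1 ≤ i → i ≤ n → X i ≠ x} :=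
    fun m n hmn => Set.ofPred_subset_ofPred.2 fun X hX i hi him => hX i hi (him.trans hmn)
  have hlim := tendsto_measure_iInter_atTop (μ := srwLaw G x)
    (fun n => (hmeas n).nullMeasurableSet) hanti ⟨0, measure_ne_top _ _⟩
  rw [hInter]
  refine lt_of_lt_of_le ?_ (ge_of_tendsto' hlim hlow)
  rw [ENNReal.ofReal_pos]
  positivity

end walk

/-- Finite resistance to infinity passes to the connected component. -/
theorem FiniteResistance.toSimpleGraph {V : Type*} {G : SimpleGraph V} {C : G.ConnectedComponent}
    {x : C.supp} (h : FiniteResistance G x) : FiniteResistance C.toSimpleGraph x := by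
  classical
  obtain ⟨D, hD⟩ := h
  refine ⟨D, fun f hf => ?_⟩
  -- Extension by zero leaves the energy unchanged, since no edge joins the component to its
  -- complement.
  set F : V → ℝ := fun v => if hv : v ∈ C.supp then f ⟨v, hv⟩ else 0 with hF
  have hFs : F.support.Finite := by
    refine (hf.image Subtype.val).subset fun v hv => ?_
    by_cases hvC : v ∈ C.supp
    · exact ⟨⟨v, hvC⟩, by simpa only [Function.mem_support, hF, dif_pos hvC] using hv, rfl⟩
    · exact absurd (dif_neg hvC) hv
  obtain ⟨B, hB⟩ := hD F hFs
  refine ⟨B.subtype (fun v => v ∈ C.supp), ?_⟩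
  have hFv : ∀ a : C.supp, F a = f a := fun a => dif_pos a.2
  have hx : F x = f x := hFv x
  rw [hx] at hB
  refine hB.trans_eq ?_
  congr 1
  have key : ∀ a ∈ B, ∑ b ∈ B, (if G.Adj a b then (F a - F b) ^ 2 else 0)
      = ∑ b ∈ B.filter (fun v => v ∈ C.supp), if a ∈ C.supp then
        (if G.Adj a b then (F a - F b) ^ 2 else 0) else 0 := by
    intro a _
    rw [Finset.sum_filter]
    refine Finset.sum_congr rfl fun b _ => ?_
    by_cases hab : G.Adj a b
    · have : a ∈ C.supp ↔ b ∈ C.supp := by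
        simp only [SimpleGraph.ConnectedComponent.mem_supp_iff]
        rw [SimpleGraph.ConnectedComponent.sound hab.reachable]
      by_cases ha : a ∈ C.supp
      · simp [this.1 ha, ha]
      · have hb : b ∉ C.supp := fun hb => ha (this.2 hb)
        have h1 : F a = 0 := dif_neg ha
        have h2 : F b = 0 := dif_neg hb
        simp [h1, h2]
    · simp [hab]
  rw [Finset.sum_congr rfl key]
  have key2 : ∑ a ∈ B, ∑ b ∈ B.filter (fun v => v ∈ C.supp), (if a ∈ C.supp then
        (if G.Adj a b then (F a - F b) ^ 2 else 0) else 0)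
      = ∑ a ∈ B.filter (fun v => v ∈ C.supp), ∑ b ∈ B.filter (fun v => v ∈ C.supp),
        (if G.Adj a b then (F a - F b) ^ 2 else 0) := by
    rw [Finset.sum_filter (s := B)]
    refine Finset.sum_congr rfl fun a _ => ?_
    by_cases ha : a ∈ C.supp <;> simp [ha]
  rw [key2, ← Finset.subtype_map, Finset.sum_map]
  refine Finset.sum_congr rfl fun a _ => ?_
  rw [Finset.sum_map]
  refine Finset.sum_congr rfl fun b _ => ?_
  simp only [Function.Embedding.coe_subtype, hFv a, hFv b]
  rfl

/-! ### Resampling coordinates of a product measure. -/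

section product

variable {ι : Type*} {X : ι → Type*} [∀ i, MeasurableSpace (X i)] (μ : ∀ i, Measure (X i))
  [∀ i, IsProbabilityMeasure (μ i)]

open Classical in
/-- Resampling the coordinates outside `s` does not change a product measure. -/
theorem infinitePi_map_piecewise (s : Set ι) :
    ((Measure.infinitePi μ).prod (Measure.infinitePi μ)).map
      (fun q => s.piecewise q.1 q.2) = Measure.infinitePi μ := by
  have hmeas : Measurable (fun q : (∀ i, X i) × (∀ i, X i) => s.piecewise q.1 q.2) := by
    refine measurable_pi_lambda _ fun i => ?_
    by_cases hi : i ∈ s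
    · simp only [Set.piecewise, hi, if_true]; fun_prop
    · simp only [Set.piecewise, hi, if_false]; fun_prop
  -- It suffices to test finite-dimensional boxes. Such a box splits into its coordinates inside and
  -- outside `s`, which come from the two independent copies.
  refine Measure.eq_infinitePi (μ := μ) fun F t ht => ?_
  rw [Measure.map_apply hmeas (MeasurableSet.pi F.countable_toSet fun i _ => ht i)]
  have hpre : (fun q : (∀ i, X i) × (∀ i, X i) => s.piecewise q.1 q.2) ⁻¹' (Set.pi F t)
      = (Set.pi (F.filter (· ∈ s) : Finset ι) t) ×ˢ (Set.pi (F.filter (· ∉ s) : Finset ι) t) := by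
    ext q
    simp only [Set.mem_preimage, Set.mem_pi, Finset.mem_coe, Set.mem_prod, Finset.mem_filter]
    constructor
    · intro h
      exact ⟨fun i hi => by simpa [Set.piecewise, hi.2] using h i hi.1,
        fun i hi => by simpa [Set.piecewise, hi.2] using h i hi.1⟩
    · rintro ⟨h1, h2⟩ i hi
      by_cases his : i ∈ s
      · simpa [Set.piecewise, his] using h1 i ⟨hi, his⟩
      · simpa [Set.piecewise, his] using h2 i ⟨hi, his⟩
  rw [hpre, Measure.prod_prod, Measure.infinitePi_pi _ fun i _ => ht i,
    Measure.infinitePi_pi _ fun i _ => ht i, Finset.prod_filter_mul_prod_filter_not]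

open Classical in
theorem measurable_piecewise_prod (s : Set ι) :
    Measurable (fun q : (∀ i, X i) × (∀ i, X i) => s.piecewise q.1 q.2) := by
  refine measurable_pi_lambda _ fun i => ?_
  by_cases hi : i ∈ s
  · simp only [Set.piecewise, hi, if_true]; fun_prop
  · simp only [Set.piecewise, hi, if_false]; fun_prop

-- Conditioning on the coordinates in `s`, written as Fubini: `a` carries the revealed coordinates
-- and `b` is a fresh copy of the others.
open Classical in
theorem infinitePi_apply_eq_lintegral (s : Set ι) {A : Set (∀ i, X i)} (hA : MeasurableSet A) :
    Measure.infinitePi μ A = ∫⁻ a, Measure.infinitePi μ {b | s.piecewise a b ∈ A}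
      ∂(Measure.infinitePi μ) := by
  conv_lhs => rw [← infinitePi_map_piecewise μ s]
  rw [Measure.map_apply (measurable_piecewise_prod s) hA,
    Measure.prod_apply (hA.preimage (measurable_piecewise_prod s))]
  rfl

open Classical in
/-- A lower bound for the probability of an event given the coordinates in `s`. -/
theorem mul_infinitePi_le_inter (s : Set ι) {A E : Set (∀ i, X i)} (hA : MeasurableSet A)
    (hE : MeasurableSet E) (hEs : ∀ a b, a ∈ E → s.piecewise a b ∈ E) {c : ENNReal}
    (hc : ∀ a ∈ E, c ≤ Measure.infinitePi μ {b | s.piecewise a b ∈ A}) :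
    c * Measure.infinitePi μ E ≤ Measure.infinitePi μ (E ∩ A) := by
  rw [infinitePi_apply_eq_lintegral μ s (hE.inter hA), ← setLIntegral_const]
  rw [← lintegral_indicator hE]
  refine lintegral_mono fun a => ?_
  by_cases ha : a ∈ E
  · rw [Set.indicator_of_mem ha]
    refine (hc a ha).trans (measure_mono fun b hb => ⟨hEs a b ha, hb⟩)
  · rw [Set.indicator_of_notMem ha]; exact zero_le

open Classical in
/-- An upper bound for the probability of an event given the coordinates in `s`. -/
theorem infinitePi_le_of_piecewise (s : Set ι) {A : Set (∀ i, X i)} (hA : MeasurableSet A)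
    {c : ENNReal} (hc : ∀ a, Measure.infinitePi μ {b | s.piecewise a b ∈ A} ≤ c) :
    Measure.infinitePi μ A ≤ c := by
  rw [infinitePi_apply_eq_lintegral μ s hA]
  calc _ ≤ ∫⁻ _, c ∂(Measure.infinitePi μ) := lintegral_mono fun a => hc a
    _ = c := by simp

open Classical in
/-- Functions of disjoint sets of coordinates are uncorrelated. -/
theorem integral_mul_of_dependsOn {s t : Set ι} (hst : Disjoint s t) {f g : (∀ i, X i) → ℝ}
    (hf : DependsOn f s) (hg : DependsOn g t) (hfm : Measurable f) (hgm : Measurable g) :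
    ∫ ω, f ω * g ω ∂(Measure.infinitePi μ)
      = (∫ ω, f ω ∂(Measure.infinitePi μ)) * ∫ ω, g ω ∂(Measure.infinitePi μ) := by
  conv_lhs => rw [← infinitePi_map_piecewise μ s]
  have hfg : Measurable fun ω => f ω * g ω := hfm.mul hgm
  rw [integral_map (measurable_piecewise_prod s).aemeasurable hfg.aestronglyMeasurable,
    ← integral_prod_mul]
  refine integral_congr_ae (Filter.Eventually.of_forall fun q => ?_)
  have h1 : f (s.piecewise q.1 q.2) = f q.1 := hf fun i hi => by simp [hi]
  have h2 : g (s.piecewise q.1 q.2) = g q.2 := hg fun i hi => by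
    simp [Set.disjoint_right.1 hst hi]
  simp only [h1, h2]

theorem measurable_of_dependsOn_finite [∀ i, Finite (X i)] [∀ i, MeasurableSingletonClass (X i)]
    {β : Type*} [MeasurableSpace β] {f : (∀ i, X i) → β} {s : Set ι} (hs : s.Finite)
    (hf : DependsOn f s) : Measurable f := by
  rcases isEmpty_or_nonempty β with hβ | hβ
  · have : IsEmpty (∀ i, X i) := ⟨fun x => hβ.elim (f x)⟩
    exact measurable_of_empty f
  · obtain ⟨g, rfl⟩ := dependsOn_iff_exists_comp.1 hf
    have := hs.to_subtype
    have hg : Measurable g := measurable_of_finite g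
    exact hg.comp (measurable_pi_lambda _ fun i => measurable_pi_apply _)

theorem measurableSet_of_dependsOn_finite [∀ i, Finite (X i)]
    [∀ i, MeasurableSingletonClass (X i)] {P : (∀ i, X i) → Prop} {s : Set ι} (hs : s.Finite)
    (hf : DependsOn P s) : MeasurableSet {ω | P ω} :=
  (measurable_of_dependsOn_finite hs hf) (MeasurableSet.of_discrete (s := {p : Prop | p}))

/-- Measurable sets are approximated by sets depending on finitely many coordinates. -/
theorem exists_dependsOn_approx {A : Set (∀ i, X i)} (hA : MeasurableSet A) {ε : ℝ} (hε : 0 < ε) :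
    ∃ (F : Finset ι) (G : Set (∀ i, X i)), MeasurableSet G ∧ DependsOn (fun ω => ω ∈ G) F ∧
      (Measure.infinitePi μ) (symmDiff A G) < ENNReal.ofReal ε := by
  have hd := Measure.MeasureDense.of_generateFrom_isSetAlgebra_finite
    (μ := Measure.infinitePi μ) (𝒜 := measurableCylinders X) isSetAlgebra_measurableCylinders
    generateFrom_measurableCylinders.symm
  obtain ⟨G, hG, hlt⟩ := hd.approx A hA (measure_ne_top _ _) ε hε
  obtain ⟨F, S, hS, rfl⟩ := (mem_measurableCylinders G).1 hG
  refine ⟨F, _, hd.measurable _ hG, fun x y h => ?_, hlt⟩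
  have : F.restrict x = F.restrict y := by
    ext i
    exact h i i.2
  simp only [mem_cylinder, this]

end product

/-! ### Ultrametric geometry of the hierarchical group. -/

section geometry

variable {N : ℕ}

theorem hdist_le_iff {x y : HierGroup N} {n : ℕ} : hdist x y ≤ n ↔ ∀ i, n ≤ i → x i = y i := by
  unfold hdist
  rw [Finset.sup_le_iff]
  constructor
  · intro h i hi
    by_contra hne
    have := h i (by simpa [sub_eq_zero] using hne)
    omega
  · intro h i hi
    by_contra hlt
    have := h i (by omega)
    simp [this] at hi

@[simp] theorem hdist_self (x : HierGroup N) : hdist x x = 0 := by simp [hdist]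

theorem hdist_le_trans {x y z : HierGroup N} {n : ℕ} (h1 : hdist x y ≤ n) (h2 : hdist y z ≤ n) :
    hdist x z ≤ n :=
  hdist_le_iff.2 fun i hi => (hdist_le_iff.1 h1 i hi).trans (hdist_le_iff.1 h2 i hi)

theorem hdist_le_comm {x y : HierGroup N} {n : ℕ} (h : hdist x y ≤ n) : hdist y x ≤ n := by
  rwa [hdist_comm]

theorem hdist_add_right (x y t : HierGroup N) : hdist (x + t) (y + t) = hdist x y := by
  simp [hdist]

/-- The point whose first `n` coordinates are `g` and whose other coordinates are those of `x`. -/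
noncomputable def withInitial (n : ℕ) (x : HierGroup N) (g : Fin n → ZMod N) : HierGroup N :=
  Finsupp.onFinset (Finset.range n ∪ x.support)
    (fun i => if h : i < n then g ⟨i, h⟩ else x i) (by
      intro i hi
      by_cases h : i < n
      · simp [h]
      · simp only [h, dite_false] at hi
        simp [hi])

theorem withInitial_apply (n : ℕ) (x : HierGroup N) (g : Fin n → ZMod N) (i : ℕ) :
    withInitial n x g i = if h : i < n then g ⟨i, h⟩ else x i := rfl

theorem withInitial_injective (n : ℕ) (x : HierGroup N) :
    Function.Injective (withInitial n x) := by
  intro g g' h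
  funext i
  have := DFunLike.congr_fun h i.1
  simpa [withInitial_apply] using this

/-- The ball of radius `n` around `x`. -/
noncomputable def ball [NeZero N] (n : ℕ) (x : HierGroup N) : Finset (HierGroup N) :=
  Finset.univ.map ⟨withInitial n x, withInitial_injective n x⟩

theorem mem_ball [NeZero N] {n : ℕ} {x y : HierGroup N} : y ∈ ball n x ↔ hdist x y ≤ n := by
  rw [hdist_le_iff]
  simp only [ball, Finset.mem_map, Finset.mem_univ, true_and, Function.Embedding.coeFn_mk]
  constructor
  · rintro ⟨g, rfl⟩ i hi
    simp [withInitial_apply, hi]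
  · intro h
    refine ⟨fun i => y i, ?_⟩
    ext1 i
    by_cases hi : i < n
    · simp [withInitial_apply, hi]
    · simp [withInitial_apply, hi, h i (by omega)]

theorem card_ball [NeZero N] (n : ℕ) (x : HierGroup N) : (ball n x).card = N ^ n := by
  simp [ball, ZMod.card]

theorem self_mem_ball [NeZero N] (n : ℕ) (x : HierGroup N) : x ∈ ball n x := by simp [mem_ball]

theorem ball_eq_of_mem [NeZero N] {n : ℕ} {x y : HierGroup N} (h : y ∈ ball n x) :
    ball n y = ball n x := by
  rw [mem_ball] at h
  ext z
  rw [mem_ball, mem_ball]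
  exact ⟨fun hz => hdist_le_trans h hz, fun hz => hdist_le_trans (hdist_le_comm h) hz⟩

theorem ball_subset_ball [NeZero N] {m n : ℕ} (h : m ≤ n) (x : HierGroup N) :
    ball m x ⊆ ball n x := fun _ hy => mem_ball.2 ((mem_ball.1 hy).trans h)

theorem exists_hdist_eq_succ (hN : 2 ≤ N) (n : ℕ) (x : HierGroup N) : ∃ y, hdist x y = n + 1 := by
  have : Fact (1 < N) := ⟨hN⟩
  refine ⟨x + Finsupp.single n 1, ?_⟩
  simp only [hdist, sub_add_cancel_left, Finsupp.support_neg]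
  rw [Finsupp.support_single _ one_ne_zero, Finset.sup_singleton]

/-- Ultrametric triangles are isosceles: moving an endpoint by at most `n` does not affect a
distance above `n`. Hence all pairs between two disjoint balls have the same connection probability.
-/
theorem hdist_eq_of_le_of_lt {x y z : HierGroup N} {n : ℕ} (h : hdist x y ≤ n)
    (hz : n < hdist x z) : hdist y z = hdist x z := by
  have h1 : n < hdist y z := by
    by_contra hc
    have := hdist_le_trans h (not_lt.1 hc)
    omega
  refine le_antisymm ?_ ?_
  · exact hdist_le_trans ((hdist_le_comm h).trans hz.le) le_rfl
  · exact hdist_le_trans (h.trans h1.le) le_rfl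

/-- The level of an unordered pair: the distance of its two points. -/
noncomputable def lev (e : Sym2 (HierGroup N)) : ℕ := Sym2.lift ⟨hdist, hdist_comm⟩ e

@[simp] theorem lev_mk (x y : HierGroup N) : lev s(x, y) = hdist x y := rfl

/-- The pairs with both points in `S`. -/
def pairsIn (S : Set (HierGroup N)) : Set (Sym2 (HierGroup N)) := {e | ∀ v ∈ e, v ∈ S}

theorem mem_pairsIn {S : Set (HierGroup N)} {x y : HierGroup N} :
    s(x, y) ∈ pairsIn S ↔ x ∈ S ∧ y ∈ S := by
  simp [pairsIn]

theorem pairsIn_mono {S T : Set (HierGroup N)} (h : S ⊆ T) : pairsIn S ⊆ pairsIn T :=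
  fun _ he v hv => h (he v hv)

theorem pairsIn_finite {S : Set (HierGroup N)} (h : S.Finite) : (pairsIn S).Finite := by
  refine ((h.prod h).image (fun q : _ × _ => s(q.1, q.2))).subset fun e he => ?_
  induction e with
  | _ x y =>
    have := mem_pairsIn.1 he
    exact ⟨(x, y), this, rfl⟩

theorem pairsIn_disjoint {S T : Set (HierGroup N)} (h : Disjoint S T) :
    Disjoint (pairsIn S) (pairsIn T) := by
  rw [Set.disjoint_left]
  intro e he he'
  induction e with
  | _ x y => exact Set.disjoint_left.1 h (mem_pairsIn.1 he).1 (mem_pairsIn.1 he').1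

end geometry

/-! ### The law of the configuration and its translation invariance. -/

section law

variable {N : ℕ}

/-- A percolation configuration. -/
abbrev Cfg (N : ℕ) : Type := Sym2 (HierGroup N) → Bool

/-- The percolation law with connection probability `p k` at distance `k`. -/
noncomputable def law (N : ℕ) (p : ℕ → unitInterval) : Measure (Cfg N) :=
  Measure.infinitePi fun e => bernoulliMeasure true false (p (lev e))

theorem percLaw_eq_law (N : ℕ) (δ : ℝ) (c : ℕ → ℝ) : percLaw N δ c = law N (connProb N δ c) := rfl

variable (p : ℕ → unitInterval)

instance : IsProbabilityMeasure (law N p) := by unfold law; infer_instance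

theorem law_all_closed (F : Finset (Sym2 (HierGroup N))) :
    (law N p).real {ω | ∀ e ∈ F, ω e = false} = ∏ e ∈ F, (1 - (p (lev e) : ℝ)) := by
  have h : {ω : Cfg N | ∀ e ∈ F, ω e = false} = Set.pi F (fun _ => {false}) := by
    ext ω; simp [Set.mem_pi]
  rw [h, measureReal_def, law, Measure.infinitePi_pi _ fun i _ => MeasurableSet.of_discrete,
    ENNReal.toReal_prod]
  refine Finset.prod_congr rfl fun e _ => ?_
  rw [← measureReal_def]
  classical
  rw [bernoulliMeasure_real_apply _ MeasurableSet.of_discrete]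
  simp

/-- Translation of configurations. -/
noncomputable def shift (t : HierGroup N) (ω : Cfg N) : Cfg N := fun e => ω (e.map (· + t))

@[simp] theorem shift_mk (t : HierGroup N) (ω : Cfg N) (x y : HierGroup N) :
    shift t ω s(x, y) = ω s(x + t, y + t) := rfl

theorem measurePreserving_shift (t : HierGroup N) :
    MeasurePreserving (shift t) (law N p) (law N p) := by
  refine ⟨measurable_pi_lambda _ fun e => measurable_pi_apply _, ?_⟩
  have hinj : Function.Injective (Sym2.map (· + t) : Sym2 (HierGroup N) → _) :=
    Sym2.map.injective (add_left_injective t)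
  have := Measure.map_infinitePi_infinitePi_of_inj
    (P := fun e : Sym2 (HierGroup N) => bernoulliMeasure true false (p (lev e))) hinj
  rw [law]
  refine this.trans ?_
  congr 1
  funext e
  congr 2
  induction e with
  | _ x y => simp [hdist_add_right]

end law

/-! ### Clusters built from edges of bounded length. -/

section cluster

variable {N : ℕ}

/-- The open edges between points at distance at most `n`. -/
def graphUpTo (n : ℕ) (ω : Cfg N) : SimpleGraph (HierGroup N) where
  Adj x y := (percGraph ω).Adj x y ∧ hdist x y ≤ n
  symm := ⟨fun _ _ h => ⟨h.1.symm, hdist_le_comm h.2⟩⟩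
  loopless := ⟨fun _ h => h.1.ne rfl⟩

theorem graphUpTo_adj {n : ℕ} {ω : Cfg N} {x y : HierGroup N} :
    (graphUpTo n ω).Adj x y ↔ x ≠ y ∧ ω s(x, y) = true ∧ hdist x y ≤ n := by
  simp [graphUpTo, percGraph, and_assoc]

theorem graphUpTo_mono {m n : ℕ} (h : m ≤ n) (ω : Cfg N) : graphUpTo m ω ≤ graphUpTo n ω :=
  fun _ _ hxy => ⟨hxy.1, hxy.2.trans h⟩

theorem hdist_le_of_reachable {n : ℕ} {ω : Cfg N} {x y : HierGroup N}
    (h : (graphUpTo n ω).Reachable x y) : hdist x y ≤ n := by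
  rw [SimpleGraph.reachable_iff_reflTransGen] at h
  induction h with
  | refl => simp
  | tail _ hyz ih => exact hdist_le_trans ih hyz.2

theorem reachable_shift {n : ℕ} {x y t : HierGroup N} {ω : Cfg N} :
    (graphUpTo n (shift t ω)).Reachable x y ↔ (graphUpTo n ω).Reachable (x + t) (y + t) := by
  let φ : graphUpTo n (shift t ω) ≃g graphUpTo n ω :=
    { toEquiv := Equiv.addRight t
      map_rel_iff' := by
        intro a b
        simp [graphUpTo_adj, hdist_add_right] }
  exact (φ.reachable_iff (u := x) (v := y)).symm

variable [NeZero N]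

/-- The cluster of `x` using only edges of length at most `n`. -/
noncomputable def cluster (n : ℕ) (x : HierGroup N) (ω : Cfg N) : Finset (HierGroup N) :=
  @Finset.filter _ (fun y => (graphUpTo n ω).Reachable x y) (Classical.decPred _) (ball n x)

theorem mem_cluster {n : ℕ} {x y : HierGroup N} {ω : Cfg N} :
    y ∈ cluster n x ω ↔ (graphUpTo n ω).Reachable x y := by
  simp only [cluster, Finset.mem_filter, mem_ball, and_iff_right_iff_imp]
  exact hdist_le_of_reachable

theorem cluster_subset_ball (n : ℕ) (x : HierGroup N) (ω : Cfg N) : cluster n x ω ⊆ ball n x :=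
  @Finset.filter_subset _ _ (Classical.decPred _) _

theorem self_mem_cluster (n : ℕ) (x : HierGroup N) (ω : Cfg N) : x ∈ cluster n x ω :=
  mem_cluster.2 (SimpleGraph.Reachable.refl x)

theorem card_cluster_le (n : ℕ) (x : HierGroup N) (ω : Cfg N) : (cluster n x ω).card ≤ N ^ n :=
  (Finset.card_le_card (cluster_subset_ball n x ω)).trans (card_ball n x).le

theorem cluster_mono {m n : ℕ} (h : m ≤ n) (x : HierGroup N) (ω : Cfg N) :
    cluster m x ω ⊆ cluster n x ω := fun _ hy =>
  mem_cluster.2 ((mem_cluster.1 hy).mono (graphUpTo_mono h ω))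

theorem cluster_eq_of_mem {n : ℕ} {x y : HierGroup N} {ω : Cfg N} (h : y ∈ cluster n x ω) :
    cluster n y ω = cluster n x ω := by
  have h := mem_cluster.1 h
  ext z
  rw [mem_cluster, mem_cluster]
  exact ⟨fun hz => h.trans hz, fun hz => h.symm.trans hz⟩

/-- By the ultrametric inequality a path with steps of length at most `n` never leaves the ball of
radius `n`. Clusters at level `n` are therefore local. -/
theorem reachable_of_agree {n : ℕ} {x : HierGroup N} {ω ω' : Cfg N}
    (h : ∀ e ∈ pairsIn (ball n x : Set (HierGroup N)), ω e = ω' e) {y : HierGroup N}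
    (hy : (graphUpTo n ω).Reachable x y) : (graphUpTo n ω').Reachable x y := by
  rw [SimpleGraph.reachable_iff_reflTransGen] at hy
  induction hy with
  | refl => exact SimpleGraph.Reachable.refl x
  | @tail y z hxy hyz ih =>
    refine ih.trans (SimpleGraph.Adj.reachable ?_)
    rw [graphUpTo_adj] at hyz ⊢
    have hy : hdist x y ≤ n := hdist_le_of_reachable
      ((SimpleGraph.reachable_iff_reflTransGen _ _).2 hxy)
    refine ⟨hyz.1, ?_, hyz.2.2⟩
    rw [← h _ (mem_pairsIn.2 ⟨?_, ?_⟩)]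
    · exact hyz.2.1
    · exact mem_ball.2 hy
    · exact mem_ball.2 (hdist_le_trans hy hyz.2.2)

theorem dependsOn_cluster (n : ℕ) (x : HierGroup N) :
    DependsOn (cluster n x) (pairsIn (ball n x : Set (HierGroup N))) := by
  intro ω ω' h
  ext y
  rw [mem_cluster, mem_cluster]
  exact ⟨reachable_of_agree h, reachable_of_agree fun e he => (h e he).symm⟩

theorem card_cluster_shift (n : ℕ) (x t : HierGroup N) (ω : Cfg N) :
    (cluster n x (shift t ω)).card = (cluster n (x + t) ω).card := by
  rw [← Finset.card_map (Equiv.addRight t).toEmbedding]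
  congr 1
  ext z
  simp only [Finset.mem_map_equiv, mem_cluster, reachable_shift]
  simp

/-- No open edge leaves the ball of radius `n` from the cluster of `x` inside the ball. -/
def NoExit (n : ℕ) (x : HierGroup N) (ω : Cfg N) : Prop :=
  ∀ y ∈ cluster n x ω, ∀ z ∉ ball n x, ω s(y, z) = false

/-- An open edge from the `n`-cluster to a point of the ball has length at most `n` and so stays in
the cluster. Without exits the whole component is the finite `n`-cluster. -/
theorem NoExit.supp_finite {n : ℕ} {x : HierGroup N} {ω : Cfg N} (h : NoExit n x ω) :
    ((percGraph ω).connectedComponentMk x).supp.Finite := by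
  refine (cluster n x ω).finite_toSet.subset fun y hy => ?_
  rw [SimpleGraph.ConnectedComponent.mem_supp_iff, SimpleGraph.ConnectedComponent.eq] at hy
  replace hy := hy.symm
  rw [SimpleGraph.reachable_iff_reflTransGen] at hy
  rw [Finset.mem_coe]
  induction hy with
  | refl => exact self_mem_cluster n x ω
  | @tail y z _ hyz ih =>
    have hz : z ∈ ball n x := by
      by_contra hz
      have h1 := h y ih z hz
      have h2 := hyz.2
      simp [h1] at h2
    refine mem_cluster.2 ((mem_cluster.1 ih).trans (SimpleGraph.Adj.reachable ⟨hyz, ?_⟩))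
    exact hdist_le_trans (hdist_le_comm (mem_ball.1 (cluster_subset_ball _ _ _ ih))) (mem_ball.1 hz)

theorem measurableSet_noExit (n : ℕ) (x : HierGroup N) : MeasurableSet {ω | NoExit n x ω} := by
  have : Countable (HierGroup N) := inferInstance
  unfold NoExit
  rw [Set.ofPred_forall]
  refine MeasurableSet.iInter fun y => ?_
  have h : {ω : Cfg N | ∀ _ : y ∈ cluster n x ω, ∀ z ∉ ball n x, ω s(y, z) = false}
      = {ω | y ∈ cluster n x ω}ᶜ ∪ ⋂ z, ⋂ (_ : z ∉ ball n x), {ω : Cfg N | ω s(y, z) = false} := by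
    ext ω
    by_cases hy : y ∈ cluster n x ω <;> simp [hy]
  rw [h]
  refine MeasurableSet.union (MeasurableSet.compl ?_) (MeasurableSet.iInter fun z =>
    MeasurableSet.iInter fun _ => ?_)
  · exact measurableSet_of_dependsOn_finite (pairsIn_finite (ball n x).finite_toSet)
      fun ω ω' h => by rw [dependsOn_cluster n x h]
  · exact (MeasurableSet.of_discrete (s := ({false} : Set Bool))).preimage
      (measurable_pi_apply s(y, z))

end cluster

/-! ### Isolation of small clusters. -/

section tail

variable {N : ℕ} (p : ℕ → unitInterval)

/-- The expected number of open edges from a point to a fixed ball of radius `n` at distance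
`n + 1`. -/
noncomputable def wt (N : ℕ) (p : ℕ → unitInterval) (n : ℕ) : ℝ := (N : ℝ) ^ n * p (n + 1)

/-- The sum of the weights from `n` on. -/
noncomputable def tailWt (N : ℕ) (p : ℕ → unitInterval) (n : ℕ) : ℝ := ∑' j, wt N p (n + j)

theorem wt_nonneg (n : ℕ) : 0 ≤ wt N p n := mul_nonneg (by positivity) (p _).2.1

variable {p}

theorem sum_wt_le_tailWt (hp : Summable (wt N p)) (n m : ℕ) :
    ∑ j ∈ Finset.Ico n m, wt N p j ≤ tailWt N p n := by
  rw [Finset.sum_Ico_eq_sum_range]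
  exact Summable.sum_le_tsum _ (fun _ _ => wt_nonneg p _)
    ((summable_nat_add_iff n).2 hp |>.congr fun j => by rw [add_comm])

variable [NeZero N]

/-- At distance exactly `m + 1` there are at most `N ^ (m + 1)` points, while `wt` counts only `N ^
m`; hence the factor `N`. -/
theorem sum_connection_le (x : HierGroup N) {n m : ℕ} (hnm : n ≤ m) :
    ∑ y ∈ ball m x \ ball n x, (p (hdist x y) : ℝ) ≤ N * ∑ j ∈ Finset.Ico n m, wt N p j := by
  induction m, hnm using Nat.le_induction with
  | base => simp
  | succ m hnm ih =>
    rw [Finset.sum_Ico_succ_top hnm, mul_add]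
    have hsplit : ball (m + 1) x \ ball n x
        = (ball m x \ ball n x) ∪ (ball (m + 1) x \ ball m x) := by
      ext y
      simp only [Finset.mem_union, Finset.mem_sdiff, mem_ball]
      omega
    rw [hsplit, Finset.sum_union]
    · refine add_le_add ih ?_
      calc ∑ y ∈ ball (m + 1) x \ ball m x, (p (hdist x y) : ℝ)
          = ∑ y ∈ ball (m + 1) x \ ball m x, (p (m + 1) : ℝ) := by
            refine Finset.sum_congr rfl fun y hy => ?_
            simp only [Finset.mem_sdiff, mem_ball] at hy
            rw [show hdist x y = m + 1 by omega]
        _ ≤ ∑ y ∈ ball (m + 1) x, (p (m + 1) : ℝ) :=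
            Finset.sum_le_sum_of_subset_of_nonneg Finset.sdiff_subset fun _ _ _ => (p _).2.1
        _ = N * wt N p m := by
            rw [Finset.sum_const, card_ball, wt, nsmul_eq_mul]; push_cast; ring
    · rw [Finset.disjoint_left]
      intro y hy hy'
      simp only [Finset.mem_sdiff, mem_ball] at hy hy'
      omega

theorem one_sub_ge_exp {q : ℝ} (h0 : 0 ≤ q) (h1 : q ≤ 1 / 2) : Real.exp (-(2 * q)) ≤ 1 - q := by
  have h := Real.one_sub_inv_le_log_of_pos (show 0 < 1 - q by linarith)
  rw [← Real.le_log_iff_exp_le (by linarith)]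
  refine le_trans ?_ h
  have : (1 - q)⁻¹ ≤ 1 + 2 * q := by
    rw [inv_le_iff_one_le_mul₀ (by linarith)]
    nlinarith
  linarith

/-- A finite set has no open edges out of a surrounding ball with probability at least the
exponential of its expected number of such edges. -/
theorem exp_le_law_closed (hp : Summable (wt N p)) {n : ℕ} (hhalf : ∀ k, n < k → (p k : ℝ) ≤ 1 / 2)
    (x : HierGroup N) {S : Finset (HierGroup N)} (hS : S ⊆ ball n x) :
    Real.exp (-(2 * N * S.card * tailWt N p n)) ≤
      (law N p).real {ω | ∀ y ∈ S, ∀ z ∉ ball n x, ω s(y, z) = false} := by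
  classical
  -- Finite families that exhaust the exit edges. The bound holds for each and passes to the limit
  -- along the decreasing events.
  set F : ℕ → Finset (Sym2 (HierGroup N)) := fun m =>
    (S ×ˢ (ball m x \ ball n x)).image fun q => s(q.1, q.2) with hF
  have hFmono : Monotone F := fun a b hab => Finset.image_subset_image
    (Finset.product_subset_product_right
      (Finset.sdiff_subset_sdiff (ball_subset_ball hab x) le_rfl))
  have hset : {ω : Cfg N | ∀ y ∈ S, ∀ z ∉ ball n x, ω s(y, z) = false}
      = ⋂ m, {ω | ∀ e ∈ F m, ω e = false} := by
    ext ω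
    simp only [Set.mem_ofPred_eq, Set.mem_iInter, hF, Finset.mem_image, Finset.mem_product,
      Finset.mem_sdiff, Prod.exists]
    constructor
    · rintro h m _ ⟨y, z, ⟨hy, _, hz⟩, rfl⟩
      exact h y hy z hz
    · intro h y hy z hz
      exact h (hdist x z) _ ⟨y, z, ⟨hy, mem_ball.2 le_rfl, hz⟩, rfl⟩
  have hanti : Antitone fun m => {ω : Cfg N | ∀ e ∈ F m, ω e = false} :=
    fun a b hab => Set.ofPred_subset_ofPred.2 fun ω h e he => h e (hFmono hab he)
  have hlim := tendsto_measure_iInter_atTop (μ := law N p)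
    (s := fun m => {ω : Cfg N | ∀ e ∈ F m, ω e = false})
    (fun m => (measurableSet_of_dependsOn_finite (F m).finite_toSet fun ω ω' h => by
      refine propext (forall_congr' fun e => forall_congr' fun he => ?_)
      rw [h e he]).nullMeasurableSet) hanti ⟨0, measure_ne_top _ _⟩
  rw [← hset] at hlim
  have hlim' := (ENNReal.tendsto_toReal (measure_ne_top _ _)).comp hlim
  refine ge_of_tendsto hlim' ?_
  filter_upwards [Filter.eventually_ge_atTop n] with m hm
  change _ ≤ (law N p).real {ω | ∀ e ∈ F m, ω e = false}
  rw [law_all_closed]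
  have hlev : ∀ e ∈ F m, n < lev e := by
    intro e he
    simp only [hF, Finset.mem_image, Finset.mem_product, Finset.mem_sdiff, Prod.exists] at he
    obtain ⟨y, z, ⟨hy, _, hz⟩, rfl⟩ := he
    rw [lev_mk]
    by_contra hc
    exact hz (mem_ball.2 (hdist_le_trans (mem_ball.1 (hS hy)) (not_lt.1 hc)))
  have hsum : ∑ e ∈ F m, (p (lev e) : ℝ) ≤ N * S.card * tailWt N p n := by
    calc ∑ e ∈ F m, (p (lev e) : ℝ)
        ≤ ∑ q ∈ S ×ˢ (ball m x \ ball n x), (p (lev s(q.1, q.2)) : ℝ) :=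
          Finset.sum_image_le_of_nonneg fun e _ => (p _).2.1
      _ = ∑ y ∈ S, ∑ z ∈ ball m x \ ball n x, (p (hdist y z) : ℝ) := by
          rw [Finset.sum_product]; rfl
      _ ≤ ∑ y ∈ S, N * tailWt N p n := by
          refine Finset.sum_le_sum fun y hy => ?_
          have h1 : ball n y = ball n x := ball_eq_of_mem (hS hy)
          have h2 : ball m y = ball m x := ball_eq_of_mem (ball_subset_ball hm x (hS hy))
          rw [← h1, ← h2]
          refine (sum_connection_le y hm).trans ?_
          gcongr
          exact sum_wt_le_tailWt hp n m
      _ = N * S.card * tailWt N p n := by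
          rw [Finset.sum_const, nsmul_eq_mul]; ring
  calc Real.exp (-(2 * N * S.card * tailWt N p n))
      ≤ Real.exp (∑ e ∈ F m, -(2 * (p (lev e) : ℝ))) := by
        rw [Real.exp_le_exp, Finset.sum_neg_distrib, ← Finset.mul_sum]
        linarith
    _ = ∏ e ∈ F m, Real.exp (-(2 * (p (lev e) : ℝ))) := Real.exp_sum _ _
    _ ≤ _ := Finset.prod_le_prod (fun _ _ => (Real.exp_pos _).le) fun e he =>
        one_sub_ge_exp (p _).2.1 (hhalf _ (hlev e he))

/-- A small cluster in a ball has no exit with probability bounded below. -/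
theorem mul_le_law_noExit (hp : Summable (wt N p)) {n : ℕ}
    (hhalf : ∀ k, n < k → (p k : ℝ) ≤ 1 / 2) (x : HierGroup N) {E : Set (Cfg N)}
    (hE : DependsOn (fun ω => ω ∈ E) (pairsIn (ball n x : Set (HierGroup N)))) {M : ℝ}
    (hM : ∀ ω ∈ E, (cluster n x ω).card * tailWt N p n ≤ M) :
    Real.exp (-(2 * N * M)) * (law N p).real E ≤ (law N p).real (E ∩ {ω | NoExit n x ω}) := by
  classical
  have hEm : MeasurableSet E :=
    measurableSet_of_dependsOn_finite (pairsIn_finite (ball n x).finite_toSet) hE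
  -- Revealing the edges inside the ball fixes the cluster; its exits are fresh edges, to which
  -- `exp_le_law_closed` applies.
  set s := pairsIn (ball n x : Set (HierGroup N)) with hs
  have hagree : ∀ a b : Cfg N, ∀ i ∈ s, s.piecewise a b i = a i := fun a b i hi => by simp [hi]
  have key := mul_infinitePi_le_inter
    (fun e : Sym2 (HierGroup N) => bernoulliMeasure true false (p (lev e))) s
    (measurableSet_noExit n x) hEm (fun a b ha => by
      have := hE (hagree a b)
      simpa [this] using ha)
    (c := ENNReal.ofReal (Real.exp (-(2 * N * M)))) (fun a ha => by
      have hcl : ∀ b : Cfg N, cluster n x (s.piecewise a b) = cluster n x a :=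
        fun b => dependsOn_cluster n x (hagree a b)
      have hset : {b : Cfg N | s.piecewise a b ∈ {ω | NoExit n x ω}}
          = {ω | ∀ y ∈ cluster n x a, ∀ z ∉ ball n x, ω s(y, z) = false} := by
        ext b
        simp only [Set.mem_ofPred_eq, NoExit, hcl]
        refine forall_congr' fun y => forall_congr' fun _ => forall_congr' fun z =>
          forall_congr' fun hz => ?_
        have : s(y, z) ∉ s := fun h => hz (mem_pairsIn.1 h).2
        simp [this]
      have h1 := exp_le_law_closed hp hhalf x (cluster_subset_ball n x a)
      rw [hset]
      change _ ≤ law N p _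
      rw [← ofReal_measureReal]
      refine ENNReal.ofReal_le_ofReal (le_trans ?_ h1)
      rw [Real.exp_le_exp]
      have hN : (0 : ℝ) ≤ N := Nat.cast_nonneg _
      nlinarith [hM a ha])
  have := ENNReal.toReal_mono (measure_ne_top _ _) key
  rw [ENNReal.toReal_mul, ENNReal.toReal_ofReal (Real.exp_pos _).le] at this
  exact this

end tail

/-! ### Comparing expectations by partial resampling. -/

section product

variable {ι : Type*} {X : ι → Type*} [∀ i, MeasurableSpace (X i)] (μ : ∀ i, Measure (X i))
  [∀ i, IsProbabilityMeasure (μ i)]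

open Classical in
/-- A lower bound for an expectation given the coordinates in `s`. -/
theorem integral_le_of_piecewise (s : Set ι) {F L : (∀ i, X i) → ℝ}
    (hF : Measurable F) (hFb : ∃ C, ∀ ω, |F ω| ≤ C)
    (hL : Integrable L (Measure.infinitePi μ))
    (h : ∀ a, L a ≤ ∫ b, F (s.piecewise a b) ∂(Measure.infinitePi μ)) :
    ∫ a, L a ∂(Measure.infinitePi μ) ≤ ∫ ω, F ω ∂(Measure.infinitePi μ) := by
  obtain ⟨C, hC⟩ := hFb
  have hm := measurable_piecewise_prod (X := X) s
  have hint : Integrable (fun q : (∀ i, X i) × (∀ i, X i) => F (s.piecewise q.1 q.2))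
      ((Measure.infinitePi μ).prod (Measure.infinitePi μ)) :=
    Integrable.of_bound (hF.comp hm).aestronglyMeasurable C
      (Filter.Eventually.of_forall fun q => hC _)
  have h1 : ∫ ω, F ω ∂(Measure.infinitePi μ) = ∫ a, ∫ b, F (s.piecewise a b)
      ∂(Measure.infinitePi μ) ∂(Measure.infinitePi μ) := by
    conv_lhs => rw [← infinitePi_map_piecewise μ s]
    rw [integral_map hm.aemeasurable hF.aestronglyMeasurable, integral_prod _ hint]
  rw [h1]
  exact integral_mono hL hint.integral_prod_left h

end product

/-! ### Marked clusters and the growth inequality. -/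

section marked

variable {N : ℕ}

theorem shift_shift (s t : HierGroup N) (ω : Cfg N) : shift s (shift t ω) = shift (s + t) ω := by
  funext e
  induction e with
  | _ x y => simp [add_assoc]

variable [NeZero N] (x₀ : HierGroup N) (G : Set (Cfg N))

open Classical in
/-- The size of the `n`-cluster of `x` if the configuration seen from `x` satisfies the mark `G`,
and zero otherwise. -/
noncomputable def markedSize (n : ℕ) (x : HierGroup N) (ω : Cfg N) : ℕ :=
  if shift (x - x₀) ω ∈ G then (cluster n x ω).card else 0

variable {x₀ G}

theorem markedSize_shift (n : ℕ) (x t : HierGroup N) (ω : Cfg N) :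
    markedSize x₀ G n x (shift t ω) = markedSize x₀ G n (x + t) ω := by
  unfold markedSize
  rw [shift_shift, card_cluster_shift, sub_add_eq_add_sub]

theorem markedSize_le_card (n : ℕ) (x : HierGroup N) (ω : Cfg N) :
    markedSize x₀ G n x ω ≤ (cluster n x ω).card := by
  unfold markedSize
  split_ifs <;> simp

theorem markedSize_le (n : ℕ) (x : HierGroup N) (ω : Cfg N) :
    markedSize x₀ G n x ω ≤ N ^ n :=
  (markedSize_le_card n x ω).trans (card_cluster_le n x ω)

/-- The mark does not depend on the level, so positivity at one level gives the full cluster size at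
all levels. -/
theorem markedSize_eq_card {n : ℕ} {x : HierGroup N} {ω : Cfg N}
    (h : 0 < markedSize x₀ G n x ω) (m : ℕ) : markedSize x₀ G m x ω = (cluster m x ω).card := by
  unfold markedSize at h ⊢
  split_ifs at h ⊢
  · rfl
  · simp at h

theorem dependsOn_markedSize {n₀ n : ℕ}
    (hG : DependsOn (fun ω => ω ∈ G) (pairsIn (ball n₀ x₀ : Set (HierGroup N)))) (hn : n₀ ≤ n)
    (x : HierGroup N) :
    DependsOn (markedSize x₀ G n x) (pairsIn (ball n x : Set (HierGroup N))) := by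
  intro ω ω' h
  unfold markedSize
  have h1 : (shift (x - x₀) ω ∈ G) = (shift (x - x₀) ω' ∈ G) := by
    refine hG fun e he => ?_
    induction e with
    | _ y z =>
      rw [shift_mk, shift_mk]
      have hyz := mem_pairsIn.1 he
      refine h _ (mem_pairsIn.2 ⟨?_, ?_⟩)
      · have := mem_ball.1 hyz.1
        rw [← hdist_add_right _ _ (x - x₀), add_sub_cancel] at this
        exact mem_ball.2 (this.trans hn)
      · have := mem_ball.1 hyz.2
        rw [← hdist_add_right _ _ (x - x₀), add_sub_cancel] at this
        exact mem_ball.2 (this.trans hn)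
  have h2 := iff_of_eq h1
  rw [dependsOn_cluster n x h]
  by_cases hω : shift (x - x₀) ω ∈ G
  · rw [if_pos hω, if_pos (h2.1 hω)]
  · rw [if_neg hω, if_neg fun hc => hω (h2.2 hc)]

theorem measurable_markedSize {n₀ n : ℕ}
    (hG : DependsOn (fun ω => ω ∈ G) (pairsIn (ball n₀ x₀ : Set (HierGroup N)))) (hn : n₀ ≤ n)
    (x : HierGroup N) : Measurable (markedSize x₀ G n x) :=
  measurable_of_dependsOn_finite (pairsIn_finite (ball n x).finite_toSet)
    (dependsOn_markedSize hG hn x)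

theorem ball_disjoint {n : ℕ} {x y : HierGroup N} (h : n < hdist x y) :
    Disjoint (ball n x : Set (HierGroup N)) (ball n y : Set (HierGroup N)) := by
  rw [Set.disjoint_left]
  intro z hz hz'
  have h1 := mem_ball.1 hz
  have h2 := mem_ball.1 hz'
  have := hdist_le_trans h1 (hdist_le_comm h2)
  omega

/-- An open edge from the cluster of `x` to another ball joins the clusters. -/
theorem markedSize_add_le {n k : ℕ} {x y v z : HierGroup N} {ω : Cfg N} (hxy : n < hdist x y)
    (hk : hdist x y ≤ k)
    (hpos : 0 < markedSize x₀ G n x ω) (hv : v ∈ cluster n x ω) (hz : z ∈ ball n y)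
    (hopen : ω s(v, z) = true) :
    markedSize x₀ G n x ω + markedSize x₀ G n z ω ≤ markedSize x₀ G k x ω := by
  rw [markedSize_eq_card hpos n, markedSize_eq_card hpos k]
  refine (Nat.add_le_add_left (markedSize_le_card n z ω) _).trans ?_
  have hvx := mem_ball.1 (cluster_subset_ball n x ω hv)
  have hdisj : Disjoint (ball n x : Set (HierGroup N)) (ball n z : Set (HierGroup N)) := by
    rw [ball_eq_of_mem hz]; exact ball_disjoint hxy
  rw [← Finset.card_union_of_disjoint]
  · refine Finset.card_le_card (Finset.union_subset (cluster_mono (by omega) x ω) fun u hu => ?_)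
    have hnk : n ≤ k := by omega
    rw [mem_cluster] at hv hu ⊢
    refine ((hv.mono (graphUpTo_mono hnk ω)).trans (SimpleGraph.Adj.reachable ?_)).trans
      (hu.mono (graphUpTo_mono hnk ω))
    rw [graphUpTo_adj]
    refine ⟨?_, hopen, ?_⟩
    · rintro rfl
      exact Set.disjoint_left.1 hdisj (mem_ball.2 hvx) (self_mem_ball n v)
    · exact hdist_le_trans (hdist_le_comm (hvx.trans hnk))
        (hdist_le_trans hk ((mem_ball.1 hz).trans hnk))
  · rw [Finset.disjoint_left]
    intro u hu hu'
    exact Set.disjoint_left.1 hdisj (cluster_subset_ball _ _ _ hu) (cluster_subset_ball _ _ _ hu')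

variable (x₀ G) (p : ℕ → unitInterval)

/-- The probability that the marked cluster meets a Poisson field of intensity `h`. -/
noncomputable def magnetization (n : ℕ) (h : ℝ) : ℝ :=
  ∫ ω, (1 - Real.exp (-(h * markedSize x₀ G n x₀ ω))) ∂(law N p)

variable {x₀ G} {n₀ : ℕ}
  (hG : DependsOn (fun ω => ω ∈ G) (pairsIn (ball n₀ x₀ : Set (HierGroup N))))

-- Translation invariance: the marked cluster of `x` is that of `x₀` in the shifted configuration.
include hG in
theorem integral_markedSize_eq {n : ℕ} (hn : n₀ ≤ n) (x : HierGroup N) (f : ℕ → ℝ) :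
    ∫ ω, f (markedSize x₀ G n x ω) ∂(law N p) = ∫ ω, f (markedSize x₀ G n x₀ ω) ∂(law N p) := by
  have h := measurePreserving_shift p (x - x₀)
  conv_rhs => rw [← h.map_eq]
  rw [integral_map h.measurable.aemeasurable]
  · simp only [markedSize_shift, add_sub_cancel]
  · exact ((Measurable.of_discrete (f := f)).comp
      (measurable_markedSize hG hn x₀)).aestronglyMeasurable

include hG in
theorem integrable_markedSize {n : ℕ} (hn : n₀ ≤ n) (x : HierGroup N) (f : ℕ → ℝ) :
    Integrable (fun ω => f (markedSize x₀ G n x ω)) (law N p) := by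
  refine Integrable.of_bound ((Measurable.of_discrete (f := f)).comp
      (measurable_markedSize hG hn x)).aestronglyMeasurable
      (∑ i ∈ Finset.range (N ^ n + 1), |f i|) (Filter.Eventually.of_forall fun ω => ?_)
  exact Finset.single_le_sum (f := fun i => |f i|) (fun i _ => abs_nonneg _)
    (Finset.mem_range.2 (Nat.lt_succ_of_le (markedSize_le n x ω)))

/-- Some edge from the `n`-cluster of `x` to the `n`-ball of `y` is open. -/
def Hits (n : ℕ) (x y : HierGroup N) (ω : Cfg N) : Prop :=
  ∃ v ∈ cluster n x ω, ∃ z ∈ ball n y, ω s(v, z) = true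

theorem measurableSet_hits (n : ℕ) (x y : HierGroup N) : MeasurableSet {ω | Hits n x y ω} := by
  refine measurableSet_of_dependsOn_finite
    (pairsIn_finite ((ball n x).finite_toSet.union (ball n y).finite_toSet)) fun ω ω' h => ?_
  have h1 : cluster n x ω = cluster n x ω' :=
    dependsOn_cluster n x fun e he => h e (pairsIn_mono Set.subset_union_left he)
  unfold Hits
  rw [h1]
  refine propext (exists_congr fun v => and_congr_right fun hv => exists_congr fun z =>
    and_congr_right fun hz => ?_)
  rw [h _ (mem_pairsIn.2 ⟨Or.inl (cluster_subset_ball _ _ _ hv), Or.inr hz⟩)]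

theorem law_closed_between {n : ℕ} {x y : HierGroup N} (hxy : n < hdist x y)
    {S T : Finset (HierGroup N)} (hS : S ⊆ ball n x) (hT : T ⊆ ball n y) :
    (law N p).real {ω | ∀ v ∈ S, ∀ z ∈ T, ω s(v, z) = false}
      = (1 - (p (hdist x y) : ℝ)) ^ (S.card * T.card) := by
  classical
  have hd := ball_disjoint hxy
  have hset : {ω : Cfg N | ∀ v ∈ S, ∀ z ∈ T, ω s(v, z) = false}
      = {ω | ∀ e ∈ (S ×ˢ T).image (fun q => s(q.1, q.2)), ω e = false} := by
    ext ω
    simp only [Set.mem_ofPred_eq, Finset.mem_image, Finset.mem_product, Prod.exists]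
    constructor
    · rintro h _ ⟨v, z, ⟨hv, hz⟩, rfl⟩
      exact h v hv z hz
    · intro h v hv z hz
      exact h _ ⟨v, z, ⟨hv, hz⟩, rfl⟩
  rw [hset, law_all_closed, Finset.prod_image]
  · rw [Finset.prod_congr rfl (g := fun _ => (1 - (p (hdist x y) : ℝ))), Finset.prod_const,
      Finset.card_product]
    intro q hq
    rw [Finset.mem_product] at hq
    have h1 := mem_ball.1 (hS hq.1)
    have h2 := mem_ball.1 (hT hq.2)
    rw [lev_mk, hdist_eq_of_le_of_lt (z := q.2) h1, hdist_comm x q.2, hdist_eq_of_le_of_lt h2,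
      hdist_comm]
    · rwa [hdist_comm]
    · rw [hdist_comm, hdist_eq_of_le_of_lt h2] <;> rwa [hdist_comm]
  · rintro ⟨a, b⟩ hab ⟨c, d⟩ hcd h
    simp only [Finset.coe_product, Set.mem_prod, Finset.mem_coe] at hab hcd
    simp only [Sym2.eq_iff] at h
    rcases h with ⟨rfl, rfl⟩ | ⟨rfl, rfl⟩
    · rfl
    · exact absurd (hT hcd.2) (Set.disjoint_left.1 hd (hS hab.1))

theorem one_sub_pow_le_exp {q : ℝ} (h1 : q ≤ 1) (k : ℕ) : (1 - q) ^ k ≤ Real.exp (-(q * k)) := by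
  calc (1 - q) ^ k ≤ (Real.exp (-q)) ^ k := by
        refine pow_le_pow_left₀ (by linarith) ?_ k
        have := Real.add_one_le_exp (-q)
        linarith
    _ = _ := by rw [← Real.exp_nat_mul]; ring_nf

-- The left side is the expectation of `exp (-h Z) * (1 - exp (-w Z))`. Given the edges in the ball
-- of `x₀`, a marked cluster of size `Z` has `Z * N ^ n` fresh pairs to the ball of `y`, so it
-- misses that ball with probability at most `exp (-w Z)`, where `w = N ^ n * p (n + 1)`.
include hG in
theorem magnetization_sub_le_hits {n : ℕ} (hn : n₀ ≤ n) {y : HierGroup N}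
    (hy : hdist x₀ y = n + 1) (h : ℝ) :
    magnetization x₀ G p n (h + wt N p n) - magnetization x₀ G p n h ≤
      ∫ ω, {ω | Hits n x₀ y ω ∧ 0 < markedSize x₀ G n x₀ ω}.indicator
        (fun ω => Real.exp (-(h * markedSize x₀ G n x₀ ω))) ω ∂(law N p) := by
  classical
  set Z := markedSize x₀ G n x₀ with hZ
  have hZm : Measurable Z := measurable_markedSize hG hn x₀
  have hint := integrable_markedSize p hG hn x₀
  have hEm : MeasurableSet {ω | Hits n x₀ y ω ∧ 0 < Z ω} :=
    (measurableSet_hits n x₀ y).inter (hZm (MeasurableSet.of_discrete (s := {k : ℕ | 0 < k})))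
  have hxy : n < hdist x₀ y := by omega
  unfold magnetization
  rw [← integral_sub (hint fun k => 1 - Real.exp (-((h + wt N p n) * k)))
    (hint fun k => 1 - Real.exp (-(h * k)))]
  rw [← hZ]
  set s := pairsIn (ball n x₀ : Set (HierGroup N)) with hs
  refine integral_le_of_piecewise
    (fun e : Sym2 (HierGroup N) => bernoulliMeasure true false (p (lev e))) s
    (L := fun ω => (1 - Real.exp (-((h + wt N p n) * Z ω))) - (1 - Real.exp (-(h * Z ω))))
    ?_ ?_ ?_ ?_
  · exact Measurable.indicator ((Measurable.of_discrete (f := fun k : ℕ =>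
      Real.exp (-(h * k)))).comp hZm) hEm
  · refine ⟨∑ i ∈ Finset.range (N ^ n + 1), |Real.exp (-(h * i))|, fun ω => ?_⟩
    refine le_trans ?_ (Finset.single_le_sum (f := fun i : ℕ => |Real.exp (-(h * i))|)
      (fun i _ => abs_nonneg _) (Finset.mem_range.2 (Nat.lt_succ_of_le
        (markedSize_le (x₀ := x₀) (G := G) n x₀ ω))))
    rw [Set.indicator_apply]
    split_ifs
    · rfl
    · rw [abs_zero]; exact abs_nonneg _
  · exact (hint fun k => 1 - Real.exp (-((h + wt N p n) * k))).sub
      (hint fun k => 1 - Real.exp (-(h * k)))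
  · intro a
    have hagree : ∀ b : Cfg N, ∀ i ∈ s, s.piecewise a b i = a i := fun b i hi => by simp [hi]
    have hZe : ∀ b : Cfg N, Z (s.piecewise a b) = Z a :=
      fun b => dependsOn_markedSize hG hn x₀ (hagree b)
    have hcl : ∀ b : Cfg N, cluster n x₀ (s.piecewise a b) = cluster n x₀ a :=
      fun b => dependsOn_cluster n x₀ (hagree b)
    have hhit : ∀ b : Cfg N, Hits n x₀ y (s.piecewise a b) ↔
        ∃ v ∈ cluster n x₀ a, ∃ z ∈ ball n y, b s(v, z) = true := by
      intro b
      unfold Hits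
      rw [hcl]
      refine exists_congr fun v => and_congr_right fun _ => exists_congr fun z =>
        and_congr_right fun hz => ?_
      have : s(v, z) ∉ s := fun hm =>
        Set.disjoint_left.1 (ball_disjoint hxy) (mem_pairsIn.1 hm).2 hz
      simp [this]
    rcases Nat.eq_zero_or_pos (Z a) with h0 | hpos
    · rw [h0]
      simp only [Nat.cast_zero, mul_zero, neg_zero, Real.exp_zero, sub_self]
      exact integral_nonneg fun b => Set.indicator_nonneg (fun _ _ => (Real.exp_pos _).le) _
    · have hcard : Z a = (cluster n x₀ a).card := markedSize_eq_card hpos n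
      set H : Set (Cfg N) := {b | ∃ v ∈ cluster n x₀ a, ∃ z ∈ ball n y, b s(v, z) = true} with hH
      have hHc : Hᶜ = {b | ∀ v ∈ cluster n x₀ a, ∀ z ∈ ball n y, b s(v, z) = false} := by
        ext b
        simp [hH]
      have hHm : MeasurableSet Hᶜ := by
        rw [hHc]
        refine measurableSet_of_dependsOn_finite
          (pairsIn_finite ((ball n x₀).finite_toSet.union (ball n y).finite_toSet))
          fun ω ω' h => ?_
        refine propext (forall_congr' fun v => forall_congr' fun hv => forall_congr' fun z =>
          forall_congr' fun hz => ?_)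
        rw [h _ (mem_pairsIn.2 ⟨Or.inl (cluster_subset_ball _ _ _ hv), Or.inr hz⟩)]
      have hprob : (law N p).real Hᶜ ≤ Real.exp (-(wt N p n * Z a)) := by
        rw [hHc, law_closed_between p hxy (cluster_subset_ball _ _ _) le_rfl, card_ball, hy]
        refine (one_sub_pow_le_exp (p _).2.2 _).trans_eq ?_
        rw [wt, hcard]
        push_cast
        ring_nf
      have hval : ∫ b, {ω | Hits n x₀ y ω ∧ 0 < Z ω}.indicator
          (fun ω => Real.exp (-(h * Z ω))) (s.piecewise a b) ∂(law N p)
          = Real.exp (-(h * Z a)) * (law N p).real H := by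
        have : ∀ b, {ω | Hits n x₀ y ω ∧ 0 < Z ω}.indicator
          (fun ω => Real.exp (-(h * Z ω))) (s.piecewise a b)
            = H.indicator (fun _ => Real.exp (-(h * Z a))) b := by
          intro b
          simp only [Set.indicator_apply, Set.mem_ofPred_eq, hhit b, hZe, hpos, and_true, hH]
        simp only [this]
        rw [integral_indicator_const _ hHm.of_compl, smul_eq_mul, mul_comm]
      refine le_of_le_of_eq ?_ hval.symm
      have h2 : (law N p).real H = 1 - (law N p).real Hᶜ := by
        have := probReal_compl_eq_one_sub (μ := law N p) hHm
        rwa [compl_compl] at this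
      rw [h2]
      have h3 : Real.exp (-((h + wt N p n) * Z a))
          = Real.exp (-(h * Z a)) * Real.exp (-(wt N p n * Z a)) := by
        rw [← Real.exp_add]; ring_nf
      have := Real.exp_pos (-(h * Z a))
      nlinarith

include hG in
/-- Growth of the magnetization over one level. -/
theorem magnetization_succ_ge (hN : 2 ≤ N) {n : ℕ} (hn : n₀ ≤ n) {h : ℝ} (hh : 0 ≤ h) :
    magnetization x₀ G p n h + magnetization x₀ G p n h *
      (magnetization x₀ G p n (h + wt N p n) - magnetization x₀ G p n h)
      ≤ magnetization x₀ G p (n + 1) h := by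
  classical
  obtain ⟨y, hy⟩ := exists_hdist_eq_succ hN n x₀
  have hxy : n < hdist x₀ y := by omega
  set Z := markedSize x₀ G n x₀ with hZ
  have hZm : Measurable Z := measurable_markedSize hG hn x₀
  set u := magnetization x₀ G p n h with hu
  have hu0 : 0 ≤ u := integral_nonneg fun ω => by
    simp only [Pi.zero_apply, sub_nonneg, Real.exp_le_one_iff, neg_nonpos]
    positivity
  set E := {ω | Hits n x₀ y ω ∧ 0 < Z ω} with hE
  have hEm : MeasurableSet E :=
    (measurableSet_hits n x₀ y).inter (hZm (MeasurableSet.of_discrete (s := {k : ℕ | 0 < k})))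
  have hint := integrable_markedSize p hG hn
  have hEint : Integrable (E.indicator fun ω => Real.exp (-(h * Z ω))) (law N p) :=
    (hint x₀ fun k => Real.exp (-(h * k))).indicator hEm
  have hstep := magnetization_sub_le_hits p hG hn hy h
  rw [← hu, ← hZ] at hstep
  refine le_trans (add_le_add_right (mul_le_mul_of_nonneg_left hstep hu0) u) ?_
  rw [← integral_const_mul, hu]
  nth_rewrite 1 [magnetization]
  rw [← integral_add (hint x₀ fun k => 1 - Real.exp (-(h * k))) (hEint.const_mul _)]
  rw [magnetization]
  -- All edges are revealed except those inside the ball of `y`. The cluster of `x₀` and an open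
  -- edge from it to some `z` in that ball are then known, while the marked `n`-cluster of `z` is
  -- still fresh and its size has the law of that of `x₀`.
  obtain ⟨s, hs⟩ : ∃ s, s = (pairsIn (ball n y : Set (HierGroup N)))ᶜ := ⟨_, rfl⟩
  refine integral_le_of_piecewise
    (fun e : Sym2 (HierGroup N) => bernoulliMeasure true false (p (lev e))) s
    (F := fun ω => 1 - Real.exp (-(h * markedSize x₀ G (n + 1) x₀ ω))) ?_ ?_ ?_ ?_
  · exact (Measurable.of_discrete (f := fun k : ℕ => 1 - Real.exp (-(h * k)))).comp
      (measurable_markedSize hG (by omega) x₀)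
  · refine ⟨1, fun ω => ?_⟩
    rw [abs_le]
    have h1 : Real.exp (-(h * markedSize x₀ G (n + 1) x₀ ω)) ≤ 1 := by
      rw [Real.exp_le_one_iff, neg_nonpos]; positivity
    have h2 := Real.exp_pos (-(h * markedSize x₀ G (n + 1) x₀ ω))
    constructor <;> linarith
  · exact (hint x₀ fun k => 1 - Real.exp (-(h * k))).add (hEint.const_mul _)
  · intro a
    have hagree : ∀ b : Cfg N, ∀ i ∈ s, s.piecewise a b i = a i := fun b i hi => by simp [hi]
    have hsub : pairsIn (ball n x₀ : Set (HierGroup N)) ⊆ s := by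
      rw [hs, Set.subset_compl_iff_disjoint_right]
      exact pairsIn_disjoint (ball_disjoint hxy)
    have hZe : ∀ b : Cfg N, Z (s.piecewise a b) = Z a :=
      fun b => dependsOn_markedSize hG hn x₀ fun i hi => hagree b i (hsub hi)
    have hcl : ∀ b : Cfg N, cluster n x₀ (s.piecewise a b) = cluster n x₀ a :=
      fun b => dependsOn_cluster n x₀ fun i hi => hagree b i (hsub hi)
    have hmono : ∀ b : Cfg N,
        Z (s.piecewise a b) ≤ markedSize x₀ G (n + 1) x₀ (s.piecewise a b) := by
      intro b
      rw [hZ]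
      rcases Nat.eq_zero_or_pos (markedSize x₀ G n x₀ (s.piecewise a b)) with h0 | hpos
      · rw [h0]; exact Nat.zero_le _
      · rw [markedSize_eq_card hpos n, markedSize_eq_card hpos (n + 1)]
        exact Finset.card_le_card (cluster_mono (by omega) _ _)
    have hFint : Integrable (fun b => 1 - Real.exp (-(h * markedSize x₀ G (n + 1) x₀
        (s.piecewise a b)))) (law N p) := by
      refine Integrable.of_bound (C := 1) ?_ (Filter.Eventually.of_forall fun b => ?_)
      · have hm : Measurable fun b : Cfg N => s.piecewise a b :=
          (measurable_piecewise_prod s).comp (measurable_prodMk_left (x := a))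
        exact ((Measurable.of_discrete (f := fun k : ℕ => 1 - Real.exp (-(h * k)))).comp
          ((measurable_markedSize hG (by omega) x₀).comp hm)).aestronglyMeasurable
      · have h1 : Real.exp (-(h * markedSize x₀ G (n + 1) x₀ (s.piecewise a b))) ≤ 1 := by
          rw [Real.exp_le_one_iff, neg_nonpos]; positivity
        have h2 := Real.exp_pos (-(h * markedSize x₀ G (n + 1) x₀ (s.piecewise a b)))
        rw [Real.norm_eq_abs, abs_le]
        constructor <;> linarith
    by_cases haE : a ∈ E
    · rw [Set.indicator_of_mem haE]
      obtain ⟨⟨v, hv, z, hz, hopen⟩, hpos⟩ := haE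
      have hdisj : v ∉ (ball n y : Set (HierGroup N)) :=
        Set.disjoint_left.1 (ball_disjoint hxy) (cluster_subset_ball _ _ _ hv)
      have hmem : s(v, z) ∈ s := hs ▸ fun hm => hdisj (mem_pairsIn.1 hm).1
      have hzb : ∀ b : Cfg N, markedSize x₀ G n z (s.piecewise a b) = markedSize x₀ G n z b := by
        intro b
        refine dependsOn_markedSize hG hn z fun i hi => ?_
        rw [ball_eq_of_mem hz] at hi
        have : i ∉ s := by rw [hs]; exact fun hc => hc hi
        simp [this]
      have hlow : ∀ b : Cfg N, Z a + markedSize x₀ G n z b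
          ≤ markedSize x₀ G (n + 1) x₀ (s.piecewise a b) := by
        intro b
        have := markedSize_add_le (x₀ := x₀) (G := G) (ω := s.piecewise a b) (k := n + 1) hxy hy.le
          (by rw [← hZ, hZe]; exact hpos) (by rw [hcl]; exact hv) hz
          (by rw [hagree b _ hmem]; exact hopen)
        rwa [← hZ, hZe, hzb] at this
      -- With `Z'` the fresh size at `z`, this is the expansion of `1 - exp (-h (Z + Z'))`; the last
      -- factor has expectation `u`.
      calc _ = ∫ b, ((1 - Real.exp (-(h * Z a))) + Real.exp (-(h * Z a)) *
              (1 - Real.exp (-(h * markedSize x₀ G n z b)))) ∂(law N p) := by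
            rw [integral_add (integrable_const _)
              ((hint z fun k => 1 - Real.exp (-(h * k))).const_mul _), integral_const_mul,
              integral_markedSize_eq p hG hn z fun k => 1 - Real.exp (-(h * k))]
            simp
            ring
        _ ≤ _ := by
            refine integral_mono ((integrable_const _).add
              ((hint z fun k => 1 - Real.exp (-(h * k))).const_mul _)) hFint fun b => ?_
            simp only
            have h1 : Real.exp (-(h * markedSize x₀ G (n + 1) x₀ (s.piecewise a b)))
                ≤ Real.exp (-(h * Z a)) * Real.exp (-(h * markedSize x₀ G n z b)) := by
              rw [← Real.exp_add, Real.exp_le_exp]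
              have : ((Z a + markedSize x₀ G n z b : ℕ) : ℝ)
                ≤ markedSize x₀ G (n + 1) x₀ (s.piecewise a b) := by exact_mod_cast hlow b
              push_cast at this
              nlinarith
            linarith
    · rw [Set.indicator_of_notMem haE, mul_zero, add_zero]
      calc 1 - Real.exp (-(h * Z a)) = ∫ b, (1 - Real.exp (-(h * Z a))) ∂(law N p) := by simp
        _ ≤ _ := by
            refine integral_mono (integrable_const _) hFint fun b => ?_
            have : ((Z a : ℕ) : ℝ) ≤ markedSize x₀ G (n + 1) x₀ (s.piecewise a b) := by
              have := hmono b
              rw [hZe] at this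
              exact_mod_cast this
            simp only [sub_le_sub_iff_left, Real.exp_le_exp, neg_le_neg_iff]
            exact mul_le_mul_of_nonneg_left this hh

end marked

/-! ### Growth of the truncated area under the Burgers-type inequality. -/

/-- One step in the growth of the truncated area below `u`. -/
theorem truncated_area_step {u v : ℝ → ℝ} (hu : Continuous u) (hv : Continuous v)
    (hmono : Monotone u) (h0 : u 0 = 0) (hdouble : ∀ h, 0 ≤ h → u (2 * h) ≤ 2 * u h)
    {w ρ K b : ℝ} (hstep : ∀ h, 0 ≤ h → u h + u h * (u (h + w) - u h) ≤ v h)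
    (hw : 0 ≤ w) (hρ : 0 < ρ) (hρ1 : ρ ≤ 1) (hK : 1 ≤ K) (hb : 0 < b) (hub : 3 * ρ ≤ u b)
    (hsmall : u (w / K) < ρ) :
    (∫ h in (0 : ℝ)..b, min (u h) (3 * ρ)) + ρ ^ 2 / K * w
      ≤ ∫ h in (0 : ℝ)..b, min (v h) (3 * ρ) := by
  have hpos : ∀ h, 0 ≤ h → 0 ≤ u h := fun h hh => h0 ▸ hmono hh
  -- To the right of the point where `u` reaches `ρ`, the gain `v - u` is at least `ρ` times the
  -- increment of `u`.
  obtain ⟨α, ⟨hα0, hαb⟩, hα⟩ : ρ ∈ u '' Set.Icc 0 b :=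
    intermediate_value_Icc hb.le hu.continuousOn ⟨by rw [h0]; exact hρ.le, by linarith⟩
  have hwα : w / K < α := by
    by_contra hc
    have := hmono (not_lt.1 hc)
    linarith
  -- Cutting the shift at `α` keeps `u ≤ 2 * ρ` on `[α, α + w']`, by `hdouble`. It is still at least
  -- `w / K`, because `u (w / K) < ρ`.
  set w' := min w α with hw'
  have hw'0 : 0 ≤ w' := le_min hw hα0
  have hw'w : w / K ≤ w' := by
    refine le_min ?_ hwα.le
    exact div_le_self hw hK
  set t : ℝ → ℝ := fun h => min (u h) (3 * ρ) with ht
  have htc : Continuous t := hu.min continuous_const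
  have htm : Monotone t := fun a b hab => min_le_min (hmono hab) le_rfl
  have hti : ∀ a c, IntervalIntegrable t volume a c := fun a c => htc.intervalIntegrable a c
  have htc' : Continuous fun h => t (h + w') := htc.comp (continuous_id.add continuous_const)
  have hvc : Continuous fun h => min (v h) (3 * ρ) := hv.min continuous_const
  have hvu : ∀ h, 0 ≤ h → u h ≤ v h := fun h hh => by
    refine le_trans ?_ (hstep h hh)
    have := mul_nonneg (hpos h hh) (sub_nonneg.2 (hmono (show h ≤ h + w by linarith)))
    linarith
  have h1 : ∫ h in (0 : ℝ)..α, t h ≤ ∫ h in (0 : ℝ)..α, min (v h) (3 * ρ) :=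
    intervalIntegral.integral_mono_on hα0 (hti _ _) (hvc.intervalIntegrable _ _)
      fun h hh => min_le_min (hvu h hh.1) le_rfl
  have h2 : ∫ h in α..b, (t h + ρ * (t (h + w') - t h)) ≤ ∫ h in α..b, min (v h) (3 * ρ) := by
    refine intervalIntegral.integral_mono_on hαb
      ((htc.add (continuous_const.mul (htc'.sub htc))).intervalIntegrable _ _)
      (hvc.intervalIntegrable _ _) fun h hh => ?_
    have hh0 : 0 ≤ h := hα0.trans hh.1
    have huρ : ρ ≤ u h := hα ▸ hmono hh.1
    rcases le_or_gt (3 * ρ) (u h) with hc | hc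
    · have e1 : t h = 3 * ρ := min_eq_right hc
      have e2 : t (h + w') = 3 * ρ := min_eq_right (hc.trans (hmono (by linarith)))
      rw [e1, e2]
      exact le_min (by have := hvu h hh0; linarith) (by linarith)
    · have e1 : t h = u h := min_eq_left hc.le
      have e3 : t (h + w') ≤ 3 * ρ := min_le_right _ _
      have e4 : t (h + w') ≤ u (h + w) :=
        (min_le_left _ _).trans (hmono (by have := min_le_left w α; linarith))
      have e5 : u h ≤ t (h + w') := e1 ▸ htm (by linarith)
      rw [e1]
      -- As `ρ ≤ 1`, the left side is a convex combination of two numbers below the cap `3 * ρ`.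
      refine le_min ((le_trans ?_ (hstep h hh0))) (by nlinarith)
      nlinarith
  -- The shifted integral gains `3 * ρ * w'` beyond `b`, where `t` is at its cap, and loses at most
  -- `2 * ρ * w'` next to `α`.
  have h3 : ∫ h in α..b, (t (h + w') - t h) ≥ ρ * w' := by
    rw [intervalIntegral.integral_sub (htc'.intervalIntegrable _ _) (hti _ _),
      intervalIntegral.integral_comp_add_right (fun h => t h) w']
    have e1 : ∫ h in (α + w')..(b + w'), t h = (∫ h in α..b, t h) + (∫ h in b..(b + w'), t h)
        - ∫ h in α..(α + w'), t h := by
      rw [intervalIntegral.integral_add_adjacent_intervals (hti _ _) (hti _ _),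
        intervalIntegral.integral_interval_sub_left (hti _ _) (hti _ _)]
    have e2 : ∫ h in b..(b + w'), t h = 3 * ρ * w' := by
      rw [intervalIntegral.integral_congr (g := fun _ => 3 * ρ)]
      · simp; ring
      · intro h hh
        rw [Set.uIcc_of_le (by linarith)] at hh
        exact min_eq_right (hub.trans (hmono hh.1))
    have e3 : ∫ h in α..(α + w'), t h ≤ ∫ h in α..(α + w'), 2 * ρ := by
      refine intervalIntegral.integral_mono_on (by linarith) (hti _ _) (by simp) fun h hh => ?_
      have : u h ≤ 2 * ρ := by
        refine (hmono (show h ≤ 2 * α from ?_)).trans ((hdouble α hα0).trans (by rw [hα]))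
        have := min_le_right w α
        linarith [hh.2]
      exact (min_le_left _ _).trans this
    rw [intervalIntegral.integral_const, smul_eq_mul] at e3
    rw [e1, e2]
    nlinarith
  have hc2 : Continuous fun h => ρ * (t (h + w') - t h) := continuous_const.mul (htc'.sub htc)
  rw [intervalIntegral.integral_add (hti _ _) (hc2.intervalIntegrable _ _),
    intervalIntegral.integral_const_mul] at h2
  have e4 : (∫ h in (0 : ℝ)..b, t h) = (∫ h in (0 : ℝ)..α, t h) + ∫ h in α..b, t h :=
    (intervalIntegral.integral_add_adjacent_intervals (hti _ _) (hti _ _)).symm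
  have e5 : (∫ h in (0 : ℝ)..b, min (v h) (3 * ρ)) = (∫ h in (0 : ℝ)..α, min (v h) (3 * ρ))
      + ∫ h in α..b, min (v h) (3 * ρ) :=
    (intervalIntegral.integral_add_adjacent_intervals (hvc.intervalIntegrable _ _)
      (hvc.intervalIntegrable _ _)).symm
  rw [e4, e5]
  have e6 : ρ ^ 2 / K * w ≤ ρ * (ρ * w') := by
    calc ρ ^ 2 / K * w = ρ ^ 2 * (w / K) := by ring
      _ ≤ ρ ^ 2 * w' := by gcongr
      _ = _ := by ring
  have e7 : ρ * (ρ * w') ≤ ρ * ∫ h in α..b, (t (h + w') - t h) := by gcongr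
  linarith

/-- A family of functions obeying the growth inequality of a mean-field coalescent, with enough
total coalescence time, must reach height `ρ` at an argument of the order of the current weight. -/
theorem exists_explosion {u : ℕ → ℝ → ℝ} {w : ℕ → ℝ} {n M : ℕ} {ρ K b : ℝ}
    (hcont : ∀ m, n ≤ m → Continuous (u m)) (hmono : ∀ m, n ≤ m → Monotone (u m))
    (h0 : ∀ m, n ≤ m → u m 0 = 0)
    (hdouble : ∀ m, n ≤ m → ∀ h, 0 ≤ h → u m (2 * h) ≤ 2 * u m h)
    (hstep : ∀ m, n ≤ m → ∀ h, 0 ≤ h → u m h + u m h * (u m (h + w m) - u m h) ≤ u (m + 1) h)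
    (hw : ∀ m, 0 ≤ w m) (hρ : 0 < ρ) (hρ1 : ρ ≤ 1) (hK : 1 ≤ K) (hb : 0 < b)
    (hn : 3 * ρ ≤ u n b) (hsum : 3 * b * K / ρ < ∑ m ∈ Finset.Ico n M, w m) :
    ∃ m, n ≤ m ∧ ρ ≤ u m (w m / K) := by
  by_contra hcon
  push Not at hcon
  have hup : ∀ m, n ≤ m → 3 * ρ ≤ u m b := by
    intro m hm
    induction m, hm using Nat.le_induction with
    | base => exact hn
    | succ m hm ih =>
      refine ih.trans (le_trans ?_ (hstep m hm b hb.le))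
      have h1 : 0 ≤ u m b := by linarith
      have h2 := hmono m hm (show b ≤ b + w m by linarith [hw m])
      nlinarith [mul_nonneg h1 (sub_nonneg.2 h2)]
  -- While the conclusion fails, the truncated area gains `ρ ^ 2 / K * w m` at each level, yet it
  -- never exceeds `3 * ρ * b`. The total weight in `hsum` is too large for that.
  set V : ℕ → ℝ := fun m => ∫ h in (0 : ℝ)..b, min (u m h) (3 * ρ) with hV
  have hstepV : ∀ m, n ≤ m → V m + ρ ^ 2 / K * w m ≤ V (m + 1) := fun m hm =>
    truncated_area_step (hcont m hm) (hcont (m + 1) (by omega)) (hmono m hm) (h0 m hm)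
      (hdouble m hm) (hstep m hm) (hw m) hρ hρ1 hK hb (hup m hm) (hcon m hm)
  have hVn : 0 ≤ V n := intervalIntegral.integral_nonneg hb.le fun h hh =>
    le_min (h0 n le_rfl ▸ hmono n le_rfl hh.1) (by linarith)
  have hVle : ∀ m, n ≤ m → V m ≤ 3 * ρ * b := by
    intro m hm
    calc V m ≤ ∫ h in (0 : ℝ)..b, 3 * ρ :=
          intervalIntegral.integral_mono_on hb.le
            (((hcont m hm).min continuous_const).intervalIntegrable _ _) (by simp)
            fun h _ => min_le_right _ _
      _ = 3 * ρ * b := by simp; ring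
  have hind : ∀ m, n ≤ m → ρ ^ 2 / K * ∑ j ∈ Finset.Ico n m, w j ≤ V m := by
    intro m hm
    induction m, hm using Nat.le_induction with
    | base => simpa using hVn
    | succ m hm ih =>
      rw [Finset.sum_Ico_succ_top hm, mul_add]
      linarith [hstepV m hm]
  have hnM : n ≤ M := by
    by_contra hc
    rw [Finset.Ico_eq_empty_of_le (by omega), Finset.sum_empty] at hsum
    have : 0 < 3 * b * K / ρ := by positivity
    linarith
  have h1 := (hind M hnM).trans (hVle M hnM)
  have h2 : ρ ^ 2 / K * (3 * b * K / ρ) < ρ ^ 2 / K * ∑ j ∈ Finset.Ico n M, w j :=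
    mul_lt_mul_of_pos_left hsum (by positivity)
  have h3 : ρ ^ 2 / K * (3 * b * K / ρ) = 3 * ρ * b := by
    field_simp
  linarith

/-! ### Magnetization and the size of marked clusters. -/

section magnetization

variable {N : ℕ} [NeZero N] {x₀ : HierGroup N} {G : Set (Cfg N)} (p : ℕ → unitInterval) {n₀ : ℕ}
  (hG : DependsOn (fun ω => ω ∈ G) (pairsIn (ball n₀ x₀ : Set (HierGroup N))))

include hG in
theorem integral_markedSize_eq_sum {n : ℕ} (hn : n₀ ≤ n) (f : ℕ → ℝ) :
    ∫ ω, f (markedSize x₀ G n x₀ ω) ∂(law N p) = ∑ k ∈ Finset.range (N ^ n + 1),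
      (law N p).real {ω | markedSize x₀ G n x₀ ω = k} * f k := by
  have hm := measurable_markedSize hG hn x₀
  have hset : ∀ k, MeasurableSet {ω | markedSize x₀ G n x₀ ω = k} := fun k =>
    hm (MeasurableSet.of_discrete (s := {k}))
  have h1 : ∀ ω, f (markedSize x₀ G n x₀ ω) = ∑ k ∈ Finset.range (N ^ n + 1),
      {ω | markedSize x₀ G n x₀ ω = k}.indicator (fun _ => f k) ω := by
    intro ω
    rw [Finset.sum_eq_single (markedSize x₀ G n x₀ ω)]
    · simp
    · intro k _ hk
      exact Set.indicator_of_notMem (fun h => hk h.symm) _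
    · intro h
      exact absurd (Finset.mem_range.2 (Nat.lt_succ_of_le (markedSize_le n x₀ ω))) h
  simp only [h1]
  rw [integral_finsetSum _ fun k _ => (integrable_const (f k)).indicator (hset k)]
  refine Finset.sum_congr rfl fun k _ => ?_
  rw [integral_indicator_const _ (hset k), smul_eq_mul]

include hG in
theorem continuous_magnetization {n : ℕ} (hn : n₀ ≤ n) : Continuous (magnetization x₀ G p n) := by
  have : magnetization x₀ G p n = fun h => ∑ k ∈ Finset.range (N ^ n + 1),
      (law N p).real {ω | markedSize x₀ G n x₀ ω = k} * (1 - Real.exp (-(h * k))) := by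
    funext h
    exact integral_markedSize_eq_sum p hG hn fun k => 1 - Real.exp (-(h * k))
  rw [this]
  fun_prop

include hG in
theorem monotone_magnetization {n : ℕ} (hn : n₀ ≤ n) : Monotone (magnetization x₀ G p n) := by
  intro h h' hh
  refine integral_mono (integrable_markedSize p hG hn x₀ fun k => 1 - Real.exp (-(h * k)))
    (integrable_markedSize p hG hn x₀ fun k => 1 - Real.exp (-(h' * k))) fun ω => ?_
  simp only [sub_le_sub_iff_left, Real.exp_le_exp, neg_le_neg_iff]
  gcongr

theorem magnetization_zero (n : ℕ) : magnetization x₀ G p n 0 = 0 := by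
  simp [magnetization]

-- This is `1 - t ^ 2 ≤ 2 * (1 - t)` for `t = exp (-h Z)`. It limits how fast the magnetization
-- rises just above height `ρ`.
include hG in
theorem magnetization_two_mul_le {n : ℕ} (hn : n₀ ≤ n) (h : ℝ) :
    magnetization x₀ G p n (2 * h) ≤ 2 * magnetization x₀ G p n h := by
  unfold magnetization
  rw [← integral_const_mul]
  refine integral_mono (integrable_markedSize p hG hn x₀ fun k => 1 - Real.exp (-(2 * h * k)))
    ((integrable_markedSize p hG hn x₀ fun k => 1 - Real.exp (-(h * k))).const_mul 2) fun ω => ?_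
  simp only
  have : Real.exp (-(2 * h * markedSize x₀ G n x₀ ω))
      = Real.exp (-(h * markedSize x₀ G n x₀ ω)) ^ 2 := by
    rw [← Real.exp_nat_mul]; push_cast; ring_nf
  rw [this]
  nlinarith [sq_nonneg (1 - Real.exp (-(h * markedSize x₀ G n x₀ ω)))]

-- On the event the integrand is at least `1 - 1 / e`, hence at least `1 / 2`. This gives the
-- starting height of the growth argument.
include hG in
theorem law_markedSize_ge_le_magnetization {n : ℕ} (hn : n₀ ≤ n) {h s : ℝ} (hh : 0 ≤ h)
    (hs : 1 ≤ h * s) :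
    (law N p).real {ω | s ≤ markedSize x₀ G n x₀ ω} / 2 ≤ magnetization x₀ G p n h := by
  have hm := measurable_markedSize hG hn x₀
  have hset : MeasurableSet {ω | s ≤ markedSize x₀ G n x₀ ω} :=
    hm (MeasurableSet.of_discrete (s := {k : ℕ | s ≤ k}))
  have h1 : (law N p).real {ω | s ≤ markedSize x₀ G n x₀ ω} / 2
      = ∫ ω, {ω | s ≤ markedSize x₀ G n x₀ ω}.indicator (fun _ => (1 / 2 : ℝ)) ω ∂(law N p) := by
    rw [integral_indicator_const _ hset, smul_eq_mul]; ring
  rw [h1]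
  refine integral_mono ((integrable_const _).indicator hset)
    (integrable_markedSize p hG hn x₀ fun k => 1 - Real.exp (-(h * k))) fun ω => ?_
  by_cases hω : s ≤ markedSize x₀ G n x₀ ω
  · rw [Set.indicator_of_mem (by exact hω)]
    have h2 : Real.exp (-(h * markedSize x₀ G n x₀ ω)) ≤ Real.exp (-1) := by
      rw [Real.exp_le_exp]
      have := mul_le_mul_of_nonneg_left hω hh
      linarith
    have h3 : Real.exp (-1) ≤ 1 / 2 := by
      have := Real.exp_one_gt_d9
      rw [Real.exp_neg, inv_eq_one_div]
      exact one_div_le_one_div_of_le (by norm_num) (by linarith)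
    simp only
    linarith
  · rw [Set.indicator_of_notMem (by exact hω)]
    simp only [sub_nonneg, Real.exp_le_one_iff, neg_nonpos]
    positivity

-- Since `1 - exp (-t) ≤ min t 1`: the first bound is used off the event, the second on it. This
-- reads off the outcome of the growth argument.
include hG in
theorem magnetization_le_law_markedSize_ge {n : ℕ} (hn : n₀ ≤ n) {h s : ℝ} (hh : 0 ≤ h) :
    magnetization x₀ G p n h ≤ h * max s 0 + (law N p).real {ω | s ≤ markedSize x₀ G n x₀ ω} := by
  have hm := measurable_markedSize hG hn x₀
  have hset : MeasurableSet {ω | s ≤ markedSize x₀ G n x₀ ω} :=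
    hm (MeasurableSet.of_discrete (s := {k : ℕ | s ≤ k}))
  have h1 : h * max s 0 + (law N p).real {ω | s ≤ markedSize x₀ G n x₀ ω}
      = ∫ ω, (h * max s 0 + {ω | s ≤ markedSize x₀ G n x₀ ω}.indicator (fun _ => (1 : ℝ)) ω)
        ∂(law N p) := by
    rw [integral_add (integrable_const _) ((integrable_const _).indicator hset),
      integral_indicator_const _ hset, smul_eq_mul]
    simp
  rw [h1]
  refine integral_mono (integrable_markedSize p hG hn x₀ fun k => 1 - Real.exp (-(h * k)))
    ((integrable_const _).add ((integrable_const _).indicator hset)) fun ω => ?_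
  have hM : 0 ≤ h * max s 0 := mul_nonneg hh (le_max_right _ _)
  by_cases hω : s ≤ markedSize x₀ G n x₀ ω
  · rw [Set.indicator_of_mem (by exact hω)]
    have := Real.exp_pos (-(h * markedSize x₀ G n x₀ ω))
    linarith
  · rw [Set.indicator_of_notMem (by exact hω), add_zero]
    have h2 := Real.add_one_le_exp (-(h * markedSize x₀ G n x₀ ω))
    have h3 : (markedSize x₀ G n x₀ ω : ℝ) ≤ max s 0 := (not_le.1 hω).le.trans (le_max_left _ _)
    have := mul_le_mul_of_nonneg_left h3 hh
    linarith

include hG in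
/-- If marked clusters are much larger than the inverse tail weight, then at some later level they
are much larger than the inverse weight of that level. -/
theorem exists_level_markedSize_large (hN : 2 ≤ N) (hp : Summable (wt N p))
    (hpos : ∀ n, 0 < wt N p n) {ρ K : ℝ} (hρ : 0 < ρ) (hρ1 : ρ ≤ 1) (hK : 1 ≤ K) {n : ℕ}
    (hn : n₀ ≤ n)
    (hlarge : 6 * ρ ≤ (law N p).real
      {ω | 4 * K / (ρ * tailWt N p n) ≤ markedSize x₀ G n x₀ ω}) :
    ∃ m, n ≤ m ∧ ρ / 2 ≤ (law N p).real
      {ω | ρ * K / (2 * wt N p m) ≤ markedSize x₀ G m x₀ ω} := by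
  have hsum : Summable fun j => wt N p (n + j) :=
    ((summable_nat_add_iff n).2 hp).congr fun j => by rw [add_comm]
  have hτ : 0 < tailWt N p n := hsum.tsum_pos (fun _ => (hpos _).le) 0 (hpos _)
  -- The threshold in `hlarge` is `1 / b`, so the magnetization at `b` is at least `3 * ρ`. Also `3
  -- * b * K / ρ` is three quarters of the tail weight, which finitely many levels exceed.
  set b := ρ * tailWt N p n / (4 * K) with hb
  have hKpos : 0 < K := by linarith
  have hbpos : 0 < b := by positivity
  have hlim : Filter.Tendsto (fun M => ∑ m ∈ Finset.Ico n (n + M), wt N p m) Filter.atTop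
      (nhds (tailWt N p n)) := by
    have := hsum.hasSum.tendsto_sum_nat
    refine this.congr fun M => ?_
    rw [Finset.sum_Ico_eq_sum_range]
    simp
  have hlt : 3 * b * K / ρ < tailWt N p n := by
    have : 3 * b * K / ρ = 3 / 4 * tailWt N p n := by
      rw [hb]; field_simp
    rw [this]; linarith
  obtain ⟨M, hM⟩ := (hlim.eventually (lt_mem_nhds hlt)).exists
  have hstart : 3 * ρ ≤ magnetization x₀ G p n b := by
    have := law_markedSize_ge_le_magnetization p hG hn (h := b)
      (s := 4 * K / (ρ * tailWt N p n)) hbpos.le (by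
        rw [hb]; apply le_of_eq; field_simp)
    linarith
  obtain ⟨m, hm, hum⟩ := exists_explosion (u := magnetization x₀ G p) (w := wt N p)
    (fun m hm => continuous_magnetization p hG (hn.trans hm))
    (fun m hm => monotone_magnetization p hG (hn.trans hm))
    (fun m _ => magnetization_zero p m)
    (fun m hm h _ => magnetization_two_mul_le p hG (hn.trans hm) h)
    (fun m hm h hh => magnetization_succ_ge p hG hN (hn.trans hm) hh)
    (wt_nonneg p) hρ hρ1 hK hbpos hstart hM
  refine ⟨m, hm, ?_⟩
  have hw := hpos m
  -- Sizes below this threshold contribute at most `ρ / 2` to the height `ρ`.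
  have h1 := magnetization_le_law_markedSize_ge p hG (hn.trans hm) (h := wt N p m / K)
    (s := ρ * K / (2 * wt N p m)) (by positivity)
  rw [max_eq_left (by positivity)] at h1
  have h2 : wt N p m / K * (ρ * K / (2 * wt N p m)) = ρ / 2 := by field_simp
  linarith

end magnetization

/-! ### Cut counting: from large clusters to positive density. -/

open Classical in
/-- If no label has a third of the elements of `V`, the labels split into two classes that both
have at least a third of the elements. -/
theorem exists_label_split {α ι : Type*} (V : Finset α) (f : α → ι)
    (h : ∀ i, 3 * (V.filter fun v => f v = i).card < V.card) :
    ∃ I : Finset ι, V.card ≤ 3 * (V.filter fun v => f v ∈ I).card ∧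
      V.card ≤ 3 * (V.filter fun v => f v ∉ I).card := by
  have hex : ∃ k, ∃ I : Finset ι, I.card = k ∧ V.card ≤ 3 * (V.filter fun v => f v ∈ I).card := by
    refine ⟨_, V.image f, rfl, ?_⟩
    rw [Finset.filter_true_of_mem fun v hv => Finset.mem_image_of_mem f hv]
    omega
  -- A smallest class of labels with a third of `V`. Without one of its labels it has less than a
  -- third, so in total it has less than two thirds.
  obtain ⟨I, hI, hV⟩ := Nat.find_spec hex
  refine ⟨I, hV, ?_⟩
  have hadd := Finset.card_filter_add_card_filter_not (s := V) (fun v => f v ∈ I)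
  rcases I.eq_empty_or_nonempty with rfl | ⟨i, hi⟩
  · simp
    omega
  · have hmin : ¬ V.card ≤ 3 * (V.filter fun v => f v ∈ I.erase i).card := fun hc =>
      Nat.find_min hex (m := (I.erase i).card)
        (by rw [← hI]; exact Finset.card_erase_lt_of_mem hi) ⟨_, rfl, hc⟩
    have hle : (V.filter fun v => f v ∈ I).card
        ≤ (V.filter fun v => f v ∈ I.erase i).card + (V.filter fun v => f v = i).card := by
      refine (Finset.card_le_card ?_).trans (Finset.card_union_le _ _)
      intro v hv
      simp only [Finset.mem_filter, Finset.mem_union, Finset.mem_erase] at hv ⊢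
      by_cases hvi : f v = i
      · exact Or.inr ⟨hv.1, hvi⟩
      · exact Or.inl ⟨hv.1, hvi, hv.2⟩
    have := h i
    omega

section giant

variable {N : ℕ} [NeZero N]

/-- The subsets of `V` that are unions of traces of `m`-clusters on `V`. -/
noncomputable def clusterUnions (m : ℕ) (V : Finset (HierGroup N)) (ω : Cfg N) :
    Finset (Finset (HierGroup N)) :=
  @Finset.filter _ (fun A => ∀ u ∈ A, ∀ v ∈ V, v ∈ cluster m u ω → v ∈ A)
    (Classical.decPred _) V.powerset

theorem mem_clusterUnions {m : ℕ} {V A : Finset (HierGroup N)} {ω : Cfg N} :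
    A ∈ clusterUnions m V ω ↔ A ⊆ V ∧ ∀ u ∈ A, ∀ v ∈ V, v ∈ cluster m u ω → v ∈ A := by
  simp [clusterUnions]

/-- Such a set is determined by the clusters it meets. The available clusters are disjoint, with at
least `s` points each in a ball of `N ^ m` points, so there are at most `N ^ m / s` of them; finally
`2 ≤ e`. -/
theorem card_clusterUnions_le {m : ℕ} {x : HierGroup N} {V : Finset (HierGroup N)} {ω : Cfg N}
    (hV : V ⊆ ball m x) {s : ℝ} (hs : 0 < s) (hVs : ∀ v ∈ V, s ≤ (cluster m v ω).card) :
    ((clusterUnions m V ω).card : ℝ) ≤ Real.exp ((N : ℝ) ^ m / s) := by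
  classical
  set I := V.image fun v => cluster m v ω with hI
  have h1 : (clusterUnions m V ω).card ≤ 2 ^ I.card := by
    rw [← Finset.card_powerset]
    refine Finset.card_le_card_of_injOn (fun A => A.image fun v => cluster m v ω) ?_ ?_
    · intro A hA
      exact Finset.mem_powerset.2 (Finset.image_subset_image (mem_clusterUnions.1 hA).1)
    · have key : ∀ A B : Finset (HierGroup N), A ∈ clusterUnions m V ω →
          B ∈ clusterUnions m V ω →
          (A.image fun v => cluster m v ω) = (B.image fun v => cluster m v ω) → A ⊆ B := by
        intro A B hA hB hAB v hv
        have hm : cluster m v ω ∈ B.image fun v => cluster m v ω :=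
          hAB ▸ Finset.mem_image_of_mem _ hv
        obtain ⟨u, hu, huv⟩ := Finset.mem_image.1 hm
        refine (mem_clusterUnions.1 hB).2 u hu v ((mem_clusterUnions.1 hA).1 hv) ?_
        rw [huv]
        exact self_mem_cluster m v ω
      intro A hA B hB hAB
      exact Finset.Subset.antisymm (key A B hA hB hAB) (key B A hB hA hAB.symm)
  have h2 : (I.card : ℝ) * s ≤ (N : ℝ) ^ m := by
    calc (I.card : ℝ) * s = ∑ C ∈ I, s := by rw [Finset.sum_const, nsmul_eq_mul]
      _ ≤ ∑ C ∈ I, (C.card : ℝ) := by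
          refine Finset.sum_le_sum fun C hC => ?_
          obtain ⟨v, hv, rfl⟩ := Finset.mem_image.1 hC
          exact hVs v hv
      _ = ((I.biUnion id).card : ℝ) := by
          rw [Finset.card_biUnion, Nat.cast_sum]
          · rfl
          · intro C hC D hD hCD
            obtain ⟨v, hv, rfl⟩ := Finset.mem_image.1 hC
            obtain ⟨u, hu, rfl⟩ := Finset.mem_image.1 hD
            refine Finset.disjoint_left.2 fun z hz hz' => ?_
            exact hCD ((cluster_eq_of_mem hz).symm.trans (cluster_eq_of_mem hz'))
      _ ≤ ((ball m x).card : ℝ) := by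
          refine Nat.cast_le.2 (Finset.card_le_card (Finset.biUnion_subset.2 fun C hC => ?_))
          obtain ⟨v, hv, rfl⟩ := Finset.mem_image.1 hC
          rw [id, ← ball_eq_of_mem (hV hv)]
          exact cluster_subset_ball m v ω
      _ = (N : ℝ) ^ m := by rw [card_ball]; push_cast; rfl
  have h3 : (I.card : ℝ) ≤ (N : ℝ) ^ m / s := by rwa [le_div_iff₀ hs]
  calc ((clusterUnions m V ω).card : ℝ) ≤ (2 : ℝ) ^ I.card := by exact_mod_cast h1
    _ ≤ Real.exp 1 ^ I.card := by
        refine pow_le_pow_left₀ (by norm_num) ?_ _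
        have := Real.add_one_le_exp 1
        linarith
    _ = Real.exp I.card := by rw [← Real.exp_nat_mul, mul_one]
    _ ≤ _ := Real.exp_le_exp.2 h3

/-- Either a third of `V` lies in one cluster, or two large unions of traces of clusters have no
open edge between them. -/
theorem exists_large_or_cut {m n : ℕ} (hmn : m ≤ n) {V V' : Finset (HierGroup N)} {ω : Cfg N}
    (hne : ∀ v ∈ V, ∀ u ∈ V', v ≠ u ∧ hdist v u ≤ n) (hV : V.Nonempty) :
    (∃ v ∈ V, ∃ S ⊆ V, S ⊆ cluster n v ω ∧ V.card ≤ 3 * S.card) ∨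
      ∃ A ∈ clusterUnions m V ω, ∃ B ∈ clusterUnions m V' ω, V.card ≤ 3 * A.card ∧
        V'.card ≤ 2 * B.card ∧ ∀ v ∈ A, ∀ u ∈ B, ω s(v, u) = false := by
  classical
  set f : HierGroup N → (graphUpTo n ω).ConnectedComponent :=
    fun v => (graphUpTo n ω).connectedComponentMk v with hf
  have hfc : ∀ u v, v ∈ cluster n u ω → f v = f u := fun u v h =>
    SimpleGraph.ConnectedComponent.eq.2 (mem_cluster.1 h).symm
  have hedge : ∀ v ∈ V, ∀ u ∈ V', f v ≠ f u → ω s(v, u) = false := by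
    intro v hv u hu hfu
    by_contra hc
    refine hfu (SimpleGraph.ConnectedComponent.eq.2 (SimpleGraph.Adj.reachable ?_))
    rw [graphUpTo_adj]
    exact ⟨(hne v hv u hu).1, by simpa using hc, (hne v hv u hu).2⟩
  have hsat : ∀ (W : Finset (HierGroup N)) (P : (graphUpTo n ω).ConnectedComponent → Prop)
      [DecidablePred P], (W.filter fun v => P (f v)) ∈ clusterUnions m W ω := by
    intro W P _
    rw [mem_clusterUnions]
    refine ⟨Finset.filter_subset _ _, fun u hu v hv hvu => ?_⟩
    rw [Finset.mem_filter] at hu ⊢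
    rw [hfc u v (cluster_mono hmn u ω hvu)]
    exact ⟨hv, hu.2⟩
  -- Labels are the components of `graphUpTo n ω`. If none has a third of `V`, they split into two
  -- balanced classes; one of them has half of `V'`, and no open edge joins that part to the part of
  -- `V` in the other class.
  by_cases hbig : ∃ i, V.card ≤ 3 * (V.filter fun v => f v = i).card
  · left
    obtain ⟨i, hi⟩ := hbig
    have hpos : 0 < (V.filter fun v => f v = i).card := by
      have := hV.card_pos
      omega
    obtain ⟨v, hv⟩ := Finset.card_pos.1 hpos
    rw [Finset.mem_filter] at hv
    refine ⟨v, hv.1, _, Finset.filter_subset _ _, fun u hu => ?_, hi⟩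
    rw [Finset.mem_filter] at hu
    exact mem_cluster.2 (SimpleGraph.ConnectedComponent.eq.1 (hv.2.trans hu.2.symm))
  · right
    push Not at hbig
    obtain ⟨I, h1, h2⟩ := exists_label_split V f hbig
    have hadd := Finset.card_filter_add_card_filter_not (s := V') (fun v => f v ∈ I)
    rcases le_or_gt V'.card (2 * (V'.filter fun v => f v ∈ I).card) with h | h
    · refine ⟨_, hsat V fun i => i ∉ I, _, hsat V' fun i => i ∈ I, h2, h, fun v hv u hu => ?_⟩
      rw [Finset.mem_filter] at hv hu
      exact hedge v hv.1 u hu.1 fun he => hv.2 (he ▸ hu.2)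
    · refine ⟨_, hsat V fun i => i ∈ I, _, hsat V' fun i => i ∉ I, h1, by omega,
        fun v hv u hu => ?_⟩
      rw [Finset.mem_filter] at hv hu
      exact hedge v hv.1 u hu.1 fun he => hu.2 (he ▸ hv.2)

variable (p : ℕ → unitInterval)

open Classical in
/-- The probability of a cut between two families of large clusters in sibling balls is small. -/
theorem law_cut_le {m : ℕ} {x y : HierGroup N} (hxy : hdist x y = m + 1)
    {V V' : Finset (HierGroup N)} (hV : V ⊆ ball m x) (hV' : V' ⊆ ball m y) {a : Cfg N} {s : ℝ}
    (hs : 0 < s) (hVs : ∀ v ∈ V, s ≤ (cluster m v a).card)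
    (hVs' : ∀ v ∈ V', s ≤ (cluster m v a).card) :
    (law N p).real {b | ∃ A ∈ clusterUnions m V a, ∃ B ∈ clusterUnions m V' a,
      V.card ≤ 3 * A.card ∧ V'.card ≤ 2 * B.card ∧ ∀ v ∈ A, ∀ u ∈ B, b s(v, u) = false}
      ≤ Real.exp (2 * ((N : ℝ) ^ m / s) - p (m + 1) * (V.card * V'.card / 6)) := by
  -- Union bound over pairs of unions: there are at most `exp (2 * (N ^ m / s))` pairs, and each has
  -- at least `|V| * |V'| / 6` edges to close.
  set F := ((clusterUnions m V a) ×ˢ (clusterUnions m V' a)).filter fun q =>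
    V.card ≤ 3 * q.1.card ∧ V'.card ≤ 2 * q.2.card with hF
  have hsub : {b : Cfg N | ∃ A ∈ clusterUnions m V a, ∃ B ∈ clusterUnions m V' a,
      V.card ≤ 3 * A.card ∧ V'.card ≤ 2 * B.card ∧ ∀ v ∈ A, ∀ u ∈ B, b s(v, u) = false}
      ⊆ ⋃ q ∈ F, {b | ∀ v ∈ q.1, ∀ u ∈ q.2, b s(v, u) = false} := by
    rintro b ⟨A, hA, B, hB, h1, h2, h3⟩
    simp only [Set.mem_iUnion]
    exact ⟨(A, B), Finset.mem_filter.2 ⟨Finset.mem_product.2 ⟨hA, hB⟩, h1, h2⟩, h3⟩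
  refine (measureReal_mono hsub (measure_ne_top _ _)).trans
    ((measureReal_biUnion_finset_le F _).trans ?_)
  have hterm : ∀ q ∈ F, (law N p).real {b | ∀ v ∈ q.1, ∀ u ∈ q.2, b s(v, u) = false}
      ≤ Real.exp (-(p (m + 1) * (V.card * V'.card / 6))) := by
    intro q hq
    obtain ⟨hq1, h1, h2⟩ := Finset.mem_filter.1 hq
    obtain ⟨hA, hB⟩ := Finset.mem_product.1 hq1
    rw [law_closed_between p (show m < hdist x y by omega)
      ((mem_clusterUnions.1 hA).1.trans hV) ((mem_clusterUnions.1 hB).1.trans hV'), hxy]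
    refine (one_sub_pow_le_exp (p _).2.2 _).trans ?_
    rw [Real.exp_le_exp, neg_le_neg_iff]
    refine mul_le_mul_of_nonneg_left ?_ (p _).2.1
    have h1' : (V.card : ℝ) ≤ 3 * q.1.card := by exact_mod_cast h1
    have h2' : (V'.card : ℝ) ≤ 2 * q.2.card := by exact_mod_cast h2
    have := mul_le_mul h1' h2' (by positivity) (by positivity)
    push_cast
    linarith
  have hcard : (F.card : ℝ) ≤ Real.exp (2 * ((N : ℝ) ^ m / s)) := by
    calc (F.card : ℝ) ≤ ((clusterUnions m V a).card : ℝ) * (clusterUnions m V' a).card := by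
          rw [← Nat.cast_mul, ← Finset.card_product]
          exact Nat.cast_le.2 (Finset.card_filter_le _ _)
      _ ≤ Real.exp ((N : ℝ) ^ m / s) * Real.exp ((N : ℝ) ^ m / s) :=
          mul_le_mul (card_clusterUnions_le hV hs hVs) (card_clusterUnions_le hV' hs hVs')
            (by positivity) (Real.exp_pos _).le
      _ = _ := by rw [← Real.exp_add]; ring_nf
  calc _ ≤ ∑ q ∈ F, Real.exp (-(p (m + 1) * (V.card * V'.card / 6))) := Finset.sum_le_sum hterm
    _ = F.card * Real.exp (-(p (m + 1) * (V.card * V'.card / 6))) := by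
        rw [Finset.sum_const, nsmul_eq_mul]
    _ ≤ Real.exp (2 * ((N : ℝ) ^ m / s)) * Real.exp (-(p (m + 1) * (V.card * V'.card / 6))) := by
        gcongr
    _ = _ := by rw [← Real.exp_add]; ring_nf

variable {x₀ : HierGroup N} {G : Set (Cfg N)} {n₀ : ℕ}

open Classical in
/-- The vertices of a ball whose marked cluster has size at least `s`. -/
noncomputable def largeVerts (x₀ : HierGroup N) (G : Set (Cfg N)) (m : ℕ) (s : ℝ)
    (x : HierGroup N) (ω : Cfg N) : Finset (HierGroup N) :=
  (ball m x).filter fun v => s ≤ markedSize x₀ G m v ω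

theorem mem_largeVerts {m : ℕ} {s : ℝ} {x v : HierGroup N} {ω : Cfg N} :
    v ∈ largeVerts x₀ G m s x ω ↔ v ∈ ball m x ∧ s ≤ markedSize x₀ G m v ω := by
  simp [largeVerts]

theorem card_largeVerts_le (m : ℕ) (s : ℝ) (x : HierGroup N) (ω : Cfg N) :
    (largeVerts x₀ G m s x ω).card ≤ N ^ m := by
  rw [← card_ball m x]
  exact Finset.card_filter_le _ _

variable (hG : DependsOn (fun ω => ω ∈ G) (pairsIn (ball n₀ x₀ : Set (HierGroup N))))

include hG in
theorem dependsOn_largeVerts {m : ℕ} (hm : n₀ ≤ m) (s : ℝ) (x : HierGroup N) :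
    DependsOn (largeVerts x₀ G m s x) (pairsIn (ball m x : Set (HierGroup N))) := by
  intro ω ω' h
  ext v
  rw [mem_largeVerts, mem_largeVerts]
  refine and_congr_right fun hv => ?_
  rw [dependsOn_markedSize hG hm v fun e he => h e (by rwa [ball_eq_of_mem hv] at he)]

include hG in
theorem law_markedSize_eq {m : ℕ} (hm : n₀ ≤ m) (s : ℝ) (x : HierGroup N) :
    (law N p).real {ω | s ≤ markedSize x₀ G m x ω}
      = (law N p).real {ω | s ≤ markedSize x₀ G m x₀ ω} := by
  classical
  have h := integral_markedSize_eq p hG hm x fun k => if s ≤ k then (1 : ℝ) else 0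
  have hset : ∀ z, MeasurableSet {ω | s ≤ markedSize x₀ G m z ω} := fun z =>
    measurable_markedSize hG hm z (MeasurableSet.of_discrete (s := {k : ℕ | s ≤ k}))
  have h1 : ∀ z, ∫ ω, (if s ≤ markedSize x₀ G m z ω then (1 : ℝ) else 0) ∂(law N p)
      = (law N p).real {ω | s ≤ markedSize x₀ G m z ω} := by
    intro z
    rw [← integral_indicator_one (hset z)]
    refine integral_congr_ae (Filter.Eventually.of_forall fun ω => ?_)
    simp [Set.indicator_apply]
  rwa [h1, h1] at h

include hG in
theorem integral_card_largeVerts {k : ℕ} (hm : n₀ ≤ k) (s : ℝ) (B : Finset (HierGroup N)) :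
    ∫ ω, (∑ v ∈ B, {ω | s ≤ markedSize x₀ G k v ω}.indicator (fun _ => (1 : ℝ)) ω) ∂(law N p)
      = B.card * (law N p).real {ω | s ≤ markedSize x₀ G k x₀ ω} := by
  have hset : ∀ z, MeasurableSet {ω | s ≤ markedSize x₀ G k z ω} := fun z =>
    measurable_markedSize hG hm z (MeasurableSet.of_discrete (s := {k : ℕ | s ≤ k}))
  rw [integral_finsetSum _ fun v _ => (integrable_const _).indicator (hset v)]
  simp only [integral_indicator_const _ (hset _), smul_eq_mul, mul_one,
    law_markedSize_eq p hG hm s _]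
  rw [Finset.sum_const, nsmul_eq_mul]

-- First moment: the expected number of large vertices is at least `ρ * N ^ m`, and the number never
-- exceeds `N ^ m`.
include hG in
theorem half_le_law_card_largeVerts {m : ℕ} (hm : n₀ ≤ m) {s ρ : ℝ} (hρ0 : 0 ≤ ρ)
    (hρ : ρ ≤ (law N p).real {ω | s ≤ markedSize x₀ G m x₀ ω}) (x : HierGroup N) :
    ρ / 2 ≤ (law N p).real {ω | ρ / 2 * (N : ℝ) ^ m ≤ (largeVerts x₀ G m s x ω).card} := by
  have hN : (0 : ℝ) < (N : ℝ) ^ m := by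
    have := NeZero.pos N
    positivity
  have h1 := integral_card_largeVerts p hG hm s (ball m x)
  have hcard : ∀ ω, (∑ v ∈ ball m x, {ω | s ≤ markedSize x₀ G m v ω}.indicator
      (fun _ => (1 : ℝ)) ω) = (largeVerts x₀ G m s x ω).card := by
    intro ω
    classical
    simp only [Set.indicator_apply, Set.mem_ofPred_eq, largeVerts, Finset.card_filter]
    push_cast
    exact Finset.sum_congr rfl fun v _ => by congr
  simp only [hcard, card_ball] at h1
  have hmeas : MeasurableSet
      {ω | ρ / 2 * (N : ℝ) ^ m ≤ (largeVerts x₀ G m s x ω).card} :=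
    measurableSet_of_dependsOn_finite (pairsIn_finite (ball m x).finite_toSet)
      fun ω ω' h => by rw [dependsOn_largeVerts hG hm s x h]
  have hint : Integrable (fun ω => ((largeVerts x₀ G m s x ω).card : ℝ)) (law N p) := by
    refine Integrable.of_bound (C := (N : ℝ) ^ m) (measurable_of_dependsOn_finite
      (pairsIn_finite (ball m x).finite_toSet)
      fun ω ω' h => by rw [dependsOn_largeVerts hG hm s x h]).aestronglyMeasurable
      (Filter.Eventually.of_forall fun ω => ?_)
    rw [Real.norm_of_nonneg (by positivity)]
    exact_mod_cast card_largeVerts_le m s x ω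
  have h2 : ∫ ω, ((largeVerts x₀ G m s x ω).card : ℝ) ∂(law N p) ≤
      ∫ ω, (ρ / 2 * (N : ℝ) ^ m + {ω | ρ / 2 * (N : ℝ) ^ m ≤
        (largeVerts x₀ G m s x ω).card}.indicator (fun _ => (N : ℝ) ^ m) ω) ∂(law N p) := by
    refine integral_mono hint ((integrable_const _).add
      ((integrable_const _).indicator hmeas)) fun ω => ?_
    simp only
    have h3 : ((largeVerts x₀ G m s x ω).card : ℝ) ≤ (N : ℝ) ^ m := by
      exact_mod_cast card_largeVerts_le m s x ω
    have h4 : 0 ≤ ρ / 2 * (N : ℝ) ^ m := by positivity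
    by_cases hω : ρ / 2 * (N : ℝ) ^ m ≤ (largeVerts x₀ G m s x ω).card
    · rw [Set.indicator_of_mem (by exact hω)]
      linarith
    · rw [Set.indicator_of_notMem (by exact hω)]
      push Not at hω
      linarith
  rw [integral_add (integrable_const _) ((integrable_const _).indicator hmeas), h1,
    integral_indicator_const _ hmeas] at h2
  simp only [integral_const, probReal_univ, smul_eq_mul, one_mul, Nat.cast_pow] at h2
  have h6 : (N : ℝ) ^ m * ρ ≤ (N : ℝ) ^ m * (ρ / 2 + (law N p).real
      {ω | ρ / 2 * (N : ℝ) ^ m ≤ (largeVerts x₀ G m s x ω).card}) := by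
    refine (mul_le_mul_of_nonneg_left hρ hN.le).trans (h2.trans_eq ?_)
    ring
  have := le_of_mul_le_mul_left h6 hN
  linarith

theorem clusterUnions_congr {m : ℕ} {x : HierGroup N} {V : Finset (HierGroup N)}
    (hV : V ⊆ ball m x) {ω ω' : Cfg N}
    (h : ∀ e ∈ pairsIn (ball m x : Set (HierGroup N)), ω e = ω' e) :
    clusterUnions m V ω = clusterUnions m V ω' := by
  ext A
  rw [mem_clusterUnions, mem_clusterUnions]
  refine and_congr_right fun hA => forall_congr' fun u => forall_congr' fun hu => ?_
  rw [dependsOn_cluster m u fun e he => h e (by rwa [ball_eq_of_mem (hV (hA hu))] at he)]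

include hG in
/-- If marked clusters in balls of radius `m` are large compared to the inverse weight of level
`m`, then a marked cluster in a ball of radius `m + 1` has positive density with probability
bounded below. -/
theorem le_law_markedSize_dense (hN : 2 ≤ N) {m : ℕ} (hm : n₀ ≤ m) {s ρ : ℝ} (hρ0 : 0 < ρ)
    (hs : 0 < s) (hρ : ρ ≤ (law N p).real {ω | s ≤ markedSize x₀ G m x₀ ω})
    (hκ : 72 ≤ ρ ^ 2 * (s * wt N p m)) :
    ρ ^ 3 / 48 ≤ (law N p).real {ω | ρ / 6 * (N : ℝ) ^ m ≤ markedSize x₀ G (m + 1) x₀ ω} := by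
  classical
  have hNm : (0 : ℝ) < (N : ℝ) ^ m := by
    have := NeZero.pos N
    positivity
  have hsN : s ≤ (N : ℝ) ^ m := by
    by_contra hc
    have : {ω | s ≤ markedSize x₀ G m x₀ ω} = ∅ := by
      refine Set.eq_empty_of_forall_notMem fun ω hω => hc ?_
      have h1 : s ≤ markedSize x₀ G m x₀ ω := hω
      refine h1.trans ?_
      exact_mod_cast markedSize_le m x₀ ω
    rw [this, measureReal_empty] at hρ
    linarith
  obtain ⟨y, hxy⟩ := exists_hdist_eq_succ hN m x₀
  set E : HierGroup N → Set (Cfg N) := fun x =>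
    {ω | ρ / 2 * (N : ℝ) ^ m ≤ (largeVerts x₀ G m s x ω).card} with hE
  have hEdep : ∀ x, DependsOn (fun ω => ω ∈ E x) (pairsIn (ball m x : Set (HierGroup N))) :=
    fun x ω ω' h => by
      simp only [hE, Set.mem_ofPred_eq]
      rw [dependsOn_largeVerts hG hm s x h]
  have hEm : ∀ x, MeasurableSet (E x) := fun x =>
    measurableSet_of_dependsOn_finite (pairsIn_finite (ball m x).finite_toSet) (hEdep x)
  have hElaw : ∀ x, ρ / 2 ≤ (law N p).real (E x) := fun x =>
    half_le_law_card_largeVerts p hG hm hρ0.le hρ x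
  have hdisj : Disjoint (ball m x₀ : Set (HierGroup N)) (ball m y : Set (HierGroup N)) :=
    ball_disjoint (by omega)
  have hset : ∀ v, MeasurableSet {ω | ρ / 6 * (N : ℝ) ^ m ≤ markedSize x₀ G (m + 1) v ω} :=
    fun v => measurable_markedSize hG (by omega) v
      (MeasurableSet.of_discrete (s := {k : ℕ | ρ / 6 * (N : ℝ) ^ m ≤ k}))
  have hmeasF : Measurable fun ω => ∑ v ∈ ball m x₀,
      {ω | ρ / 6 * (N : ℝ) ^ m ≤ markedSize x₀ G (m + 1) v ω}.indicator (fun _ => (1 : ℝ)) ω :=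
    Finset.measurable_sum _ fun v _ => measurable_const.indicator (hset v)
  have hboundF : ∀ ω, |∑ v ∈ ball m x₀,
      {ω | ρ / 6 * (N : ℝ) ^ m ≤ markedSize x₀ G (m + 1) v ω}.indicator (fun _ => (1 : ℝ)) ω|
        ≤ (N : ℝ) ^ m := by
    intro ω
    rw [abs_of_nonneg (Finset.sum_nonneg fun v _ => Set.indicator_nonneg (by simp) _)]
    refine (Finset.sum_le_sum (g := fun _ => (1 : ℝ)) fun v _ => ?_).trans_eq
      (by simp [card_ball])
    rw [Set.indicator_apply]
    split_ifs <;> simp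
  -- Lower bound for the expected number of vertices of the ball of `x₀` in a dense marked cluster
  -- at level `m + 1`. Both balls are good with probability at least `(ρ / 2) ^ 2` by independence,
  -- no cut occurs with conditional probability at least `1 / 2`, and then a third of the large
  -- vertices counts. Translation invariance turns this into a probability for `x₀`.
  have key := integral_le_of_piecewise
    (fun e : Sym2 (HierGroup N) => bernoulliMeasure true false (p (lev e)))
    (pairsIn (ball m x₀ : Set (HierGroup N)) ∪ pairsIn (ball m y : Set (HierGroup N)))
    (L := fun a => ((E x₀).indicator (fun _ => (1 : ℝ)) a * (E y).indicator (fun _ => (1 : ℝ)) a)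
      * (ρ / 12 * (N : ℝ) ^ m)) hmeasF ⟨_, hboundF⟩ ?_ ?_
  · change ∫ a, _ ∂(law N p) ≤ ∫ ω, _ ∂(law N p) at key
    rw [integral_mul_const, integral_card_largeVerts p hG (by omega), card_ball] at key
    have hprod := integral_mul_of_dependsOn
      (fun e : Sym2 (HierGroup N) => bernoulliMeasure true false (p (lev e)))
      (pairsIn_disjoint hdisj) (f := (E x₀).indicator (fun _ => (1 : ℝ)))
      (g := (E y).indicator (fun _ => (1 : ℝ))) (fun ω ω' h => by
        have := hEdep x₀ h
        simp only at this
        simp only [Set.indicator_apply, this]) (fun ω ω' h => by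
        have := hEdep y h
        simp only at this
        simp only [Set.indicator_apply, this])
      (measurable_const.indicator (hEm x₀)) (measurable_const.indicator (hEm y))
    change ∫ a, _ ∂(law N p) = (∫ a, _ ∂(law N p)) * ∫ a, _ ∂(law N p) at hprod
    rw [hprod, integral_indicator_const _ (hEm _), integral_indicator_const _ (hEm _)] at key
    simp only [smul_eq_mul, mul_one, Nat.cast_pow] at key
    have h1 := mul_le_mul (hElaw x₀) (hElaw y) (by positivity) measureReal_nonneg
    have h2 := (mul_le_mul_of_nonneg_right h1
      (show 0 ≤ ρ / 12 * (N : ℝ) ^ m by positivity)).trans key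
    have h3 : (N : ℝ) ^ m * (ρ ^ 3 / 48) ≤ (N : ℝ) ^ m *
        (law N p).real {ω | ρ / 6 * (N : ℝ) ^ m ≤ markedSize x₀ G (m + 1) x₀ ω} := by
      refine le_trans (le_of_eq ?_) h2
      ring
    exact le_of_mul_le_mul_left h3 hNm
  · refine Integrable.mul_const ?_ _
    refine Integrable.of_bound (C := 1) ((measurable_const.indicator (hEm _)).mul
      (measurable_const.indicator (hEm _))).aestronglyMeasurable
      (Filter.Eventually.of_forall fun ω => ?_)
    simp only [Set.indicator_apply]
    split_ifs <;> simp
  · intro a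
    by_cases ha : a ∈ E x₀ ∧ a ∈ E y
    swap
    · have h0 : (E x₀).indicator (fun _ => (1 : ℝ)) a *
          (E y).indicator (fun _ => (1 : ℝ)) a = 0 := by
        by_cases h : a ∈ E x₀
        · rw [Set.indicator_of_notMem (s := E y) fun hc => ha ⟨h, hc⟩, mul_zero]
        · rw [Set.indicator_of_notMem h, zero_mul]
      simp only [h0, zero_mul]
      exact integral_nonneg fun b => Finset.sum_nonneg fun v _ =>
        Set.indicator_nonneg (by simp) _
    obtain ⟨t, ht⟩ : ∃ t, t = pairsIn (ball m x₀ : Set (HierGroup N)) ∪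
      pairsIn (ball m y : Set (HierGroup N)) := ⟨_, rfl⟩
    rw [← ht]
    rw [Set.indicator_of_mem ha.1, Set.indicator_of_mem ha.2, one_mul, one_mul]
    obtain ⟨hax, hay⟩ := ha
    set V := largeVerts x₀ G m s x₀ a with hVdef
    set V' := largeVerts x₀ G m s y a with hVdef'
    have hVb : V ⊆ ball m x₀ := fun v hv => (mem_largeVerts.1 hv).1
    have hVb' : V' ⊆ ball m y := fun v hv => (mem_largeVerts.1 hv).1
    have hax : ρ / 2 * (N : ℝ) ^ m ≤ V.card := hax
    have hay : ρ / 2 * (N : ℝ) ^ m ≤ V'.card := hay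
    have hagree : ∀ b : Cfg N, ∀ i ∈ t, t.piecewise a b i = a i := fun b i hi => by simp [hi]
    have htx : pairsIn (ball m x₀ : Set (HierGroup N)) ⊆ t := ht ▸ Set.subset_union_left
    have hty : pairsIn (ball m y : Set (HierGroup N)) ⊆ t := ht ▸ Set.subset_union_right
    set C := {b : Cfg N | ∃ A ∈ clusterUnions m V a, ∃ B ∈ clusterUnions m V' a,
      V.card ≤ 3 * A.card ∧ V'.card ≤ 2 * B.card ∧ ∀ v ∈ A, ∀ u ∈ B, b s(v, u) = false} with hC
    have hCm : MeasurableSet C := by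
      refine measurableSet_of_dependsOn_finite
        (pairsIn_finite ((ball m x₀).finite_toSet.union (ball m y).finite_toSet)) fun ω ω' h => ?_
      refine propext (exists_congr fun A => and_congr_right fun hA => exists_congr fun B =>
        and_congr_right fun hB => and_congr_right fun _ => and_congr_right fun _ =>
        forall_congr' fun v => forall_congr' fun hv => forall_congr' fun u =>
        forall_congr' fun hu => ?_)
      rw [h _ (mem_pairsIn.2 ⟨Or.inl (hVb ((mem_clusterUnions.1 hA).1 hv)),
        Or.inr (hVb' ((mem_clusterUnions.1 hB).1 hu))⟩)]
    have hClaw : (law N p).real C ≤ 1 / 2 := by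
      refine (law_cut_le p hxy hVb hVb' hs
        (fun v hv => (mem_largeVerts.1 hv).2.trans (Nat.cast_le.2 (markedSize_le_card m v a)))
        (fun v hv => (mem_largeVerts.1 hv).2.trans
          (Nat.cast_le.2 (markedSize_le_card m v a)))).trans ?_
      -- The constant `72` makes the subtracted term at least `3 * N ^ m / s`, and `s ≤ N ^ m` then
      -- leaves at most `-1`.
      have h1 : 2 * ((N : ℝ) ^ m / s) - p (m + 1) * (V.card * V'.card / 6) ≤ -1 := by
        have h2 := mul_le_mul hax hay (by positivity) (by positivity)
        have h3 : (1 : ℝ) ≤ (N : ℝ) ^ m / s := by rwa [one_le_div hs]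
        have h4 : (p (m + 1) : ℝ) * (ρ / 2 * (N : ℝ) ^ m * (ρ / 2 * (N : ℝ) ^ m)) / 6
            = ρ ^ 2 * (s * wt N p m) * ((N : ℝ) ^ m / s) / 24 := by
          rw [wt]; field_simp; ring
        have h5 := mul_le_mul_of_nonneg_left h2 (p (m + 1)).2.1
        have h6 := mul_le_mul_of_nonneg_right hκ (show 0 ≤ (N : ℝ) ^ m / s by positivity)
        have h7 : (p (m + 1) : ℝ) * (V.card * V'.card / 6)
          = (p (m + 1) : ℝ) * (V.card * V'.card) / 6 := by ring
        linarith
      refine (Real.exp_le_exp.2 h1).trans ?_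
      have := Real.exp_one_gt_d9
      rw [Real.exp_neg, inv_eq_one_div]
      exact one_div_le_one_div_of_le (by norm_num) (by linarith)
    have hlow : ∀ b, Cᶜ.indicator (fun _ => ρ / 6 * (N : ℝ) ^ m) b ≤ ∑ v ∈ ball m x₀,
        {ω | ρ / 6 * (N : ℝ) ^ m ≤ markedSize x₀ G (m + 1) v ω}.indicator (fun _ => (1 : ℝ))
          (t.piecewise a b) := by
      intro b
      by_cases hb : b ∈ C
      · rw [Set.indicator_of_notMem (s := Cᶜ) fun hc => hc hb]
        exact Finset.sum_nonneg fun v _ => Set.indicator_nonneg (by simp) _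
      rw [Set.indicator_of_mem (by exact hb)]
      set ω := t.piecewise a b with hω
      have hVne : V.Nonempty := by
        rw [← Finset.card_pos]
        have : (0 : ℝ) < V.card := lt_of_lt_of_le (by positivity) hax
        exact_mod_cast this
      have hVV : ∀ v ∈ V, ∀ u ∈ V', v ≠ u ∧ hdist v u ≤ m + 1 := by
        intro v hv u hu
        refine ⟨fun h => Set.disjoint_left.1 hdisj (hVb hv) (h ▸ hVb' hu), ?_⟩
        have h1 := mem_ball.1 (hVb hv)
        have h2 := mem_ball.1 (hVb' hu)
        exact hdist_le_trans (hdist_le_comm (h1.trans (Nat.le_succ m)))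
          (hdist_le_trans hxy.le (h2.trans (Nat.le_succ m)))
      rcases exists_large_or_cut (Nat.le_succ m) (ω := ω) hVV hVne with
        ⟨v, hv, S, hSV, hSc, hcard⟩ | ⟨A, hA, B, hB, h1, h2, h3⟩
      · have hS : ρ / 6 * (N : ℝ) ^ m ≤ S.card := by
          have : (V.card : ℝ) ≤ 3 * S.card := by exact_mod_cast hcard
          linarith
        refine hS.trans ?_
        calc (S.card : ℝ) = ∑ u ∈ S, (1 : ℝ) := by simp
          _ ≤ ∑ u ∈ S, {ω | ρ / 6 * (N : ℝ) ^ m ≤ markedSize x₀ G (m + 1) u ω}.indicator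
              (fun _ => (1 : ℝ)) ω := by
            refine Finset.sum_le_sum fun u hu => ?_
            have hbu : ball m u = ball m x₀ := ball_eq_of_mem (hVb (hSV hu))
            have hZ : 0 < markedSize x₀ G m u ω := by
              rw [dependsOn_markedSize hG hm u fun e he => hagree b e (htx (by rwa [hbu] at he))]
              have h1 := (mem_largeVerts.1 (hSV hu)).2
              have : (0 : ℝ) < markedSize x₀ G m u a := hs.trans_le h1
              exact_mod_cast this
            rw [Set.indicator_of_mem]
            change ρ / 6 * (N : ℝ) ^ m ≤ markedSize x₀ G (m + 1) u ω
            rw [markedSize_eq_card hZ, cluster_eq_of_mem (hSc hu)]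
            exact hS.trans (Nat.cast_le.2 (Finset.card_le_card hSc))
          _ ≤ _ := Finset.sum_le_sum_of_subset_of_nonneg (hSV.trans hVb) fun _ _ _ =>
            Set.indicator_nonneg (by simp) _
      · exfalso
        rw [clusterUnions_congr hVb fun e he => hagree b e (htx he)] at hA
        rw [clusterUnions_congr hVb' fun e he => hagree b e (hty he)] at hB
        refine hb ⟨A, hA, B, hB, h1, h2, fun v hv u hu => ?_⟩
        have hv' := hVb ((mem_clusterUnions.1 hA).1 hv)
        have hu' := hVb' ((mem_clusterUnions.1 hB).1 hu)
        have hnot : s(v, u) ∉ t := by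
          rw [ht]
          rintro (h | h)
          · exact Set.disjoint_left.1 hdisj (mem_pairsIn.1 h).2 hu'
          · exact Set.disjoint_left.1 hdisj hv' (mem_pairsIn.1 h).1
        have := h3 v hv u hu
        simpa [hω, hnot] using this
    have hm' : Measurable fun b : Cfg N => t.piecewise a b :=
      (measurable_piecewise_prod t).comp (measurable_prodMk_left (x := a))
    calc ρ / 12 * (N : ℝ) ^ m ≤ (law N p).real Cᶜ * (ρ / 6 * (N : ℝ) ^ m) := by
          rw [probReal_compl_eq_one_sub hCm]
          have : 0 ≤ ρ / 6 * (N : ℝ) ^ m := by positivity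
          nlinarith
      _ = ∫ b, Cᶜ.indicator (fun _ => ρ / 6 * (N : ℝ) ^ m) b ∂(law N p) := by
          rw [integral_indicator_const _ hCm.compl, smul_eq_mul]
      _ ≤ _ := integral_mono ((integrable_const _).indicator hCm.compl)
          (Integrable.of_bound (hmeasF.comp hm').aestronglyMeasurable ((N : ℝ) ^ m)
            (Filter.Eventually.of_forall fun b => hboundF _)) hlow

end giant

/-! ### Multiscale cores and their survival. -/

section core

variable {N : ℕ} [NeZero N]

/-- Chebyshev's inequality for the number of occurring local events in a ball. -/
theorem law_sum_indicator_lt_le (p : ℕ → unitInterval) {A : HierGroup N → Set (Cfg N)} {n k : ℕ}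
    (hdep : ∀ y, DependsOn (fun ω => ω ∈ A y) (pairsIn (ball n y : Set (HierGroup N))))
    {q : ℝ} (hq0 : 0 < q) (hq : ∀ y, q ≤ (law N p).real (A y)) (x : HierGroup N) :
    (law N p).real {ω | ∑ y ∈ ball k x, (A y).indicator (fun _ => (1 : ℝ)) ω < q / 2 * (N : ℝ) ^ k}
      ≤ 4 * (N : ℝ) ^ n / (q ^ 2 * (N : ℝ) ^ k) := by
  classical
  have hNk : (0 : ℝ) < (N : ℝ) ^ k := by
    have := NeZero.pos N
    positivity
  have hAm : ∀ y, MeasurableSet (A y) := fun y =>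
    measurableSet_of_dependsOn_finite (pairsIn_finite (ball n y).finite_toSet) (hdep y)
  set X : HierGroup N → Cfg N → ℝ := fun y ω =>
    (A y).indicator (fun _ => (1 : ℝ)) ω - (law N p).real (A y) with hX
  have hXm : ∀ y, Measurable (X y) := fun y =>
    (measurable_const.indicator (hAm y)).sub measurable_const
  have hXb : ∀ y ω, |X y ω| ≤ 1 := by
    intro y ω
    have h1 : (law N p).real (A y) ≤ 1 := measureReal_le_one
    have h2 : 0 ≤ (law N p).real (A y) := measureReal_nonneg
    simp only [hX, Set.indicator_apply]
    rw [abs_le]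
    split_ifs <;> constructor <;> linarith
  have hX0 : ∀ y, ∫ ω, X y ω ∂(law N p) = 0 := by
    intro y
    simp only [hX]
    rw [integral_sub ((integrable_const _).indicator (hAm y)) (integrable_const _),
      integral_indicator_const _ (hAm y)]
    simp
  have hXdep : ∀ y, DependsOn (X y) (pairsIn (ball n y : Set (HierGroup N))) := by
    intro y ω ω' h
    have := hdep y h
    simp only at this
    simp only [hX, Set.indicator_apply, this]
  have hint : ∀ y z, Integrable (fun ω => X y ω * X z ω) (law N p) := fun y z =>
    Integrable.of_bound ((hXm y).mul (hXm z)).aestronglyMeasurable 1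
      (Filter.Eventually.of_forall fun ω => by
        rw [Real.norm_eq_abs, abs_mul]
        exact mul_le_one₀ (hXb y ω) (abs_nonneg _) (hXb z ω))
  -- Events at centres more than `n` apart depend on disjoint sets of pairs and are uncorrelated;
  -- only `N ^ n` centres lie within distance `n` of a given one.
  have hcov : ∀ y z, ∫ ω, X y ω * X z ω ∂(law N p) ≤ if z ∈ ball n y then 1 else 0 := by
    intro y z
    split_ifs with h
    · calc ∫ ω, X y ω * X z ω ∂(law N p) ≤ ∫ ω, (1 : ℝ) ∂(law N p) := by
            refine integral_mono (hint y z) (integrable_const _) fun ω => ?_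
            refine (le_abs_self _).trans ?_
            rw [abs_mul]
            exact mul_le_one₀ (hXb y ω) (abs_nonneg _) (hXb z ω)
        _ = 1 := by simp
    · have h1 : n < hdist y z := by rwa [mem_ball, not_le] at h
      have := integral_mul_of_dependsOn
        (fun e : Sym2 (HierGroup N) => bernoulliMeasure true false (p (lev e)))
        (pairsIn_disjoint (ball_disjoint h1)) (hXdep y) (hXdep z) (hXm y) (hXm z)
      change ∫ ω, X y ω * X z ω ∂(law N p)
        = (∫ ω, X y ω ∂(law N p)) * ∫ ω, X z ω ∂(law N p) at this
      rw [this, hX0, zero_mul]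
  have hsq : ∫ ω, (∑ y ∈ ball k x, X y ω) ^ 2 ∂(law N p) ≤ (N : ℝ) ^ k * (N : ℝ) ^ n := by
    simp only [pow_two, Finset.sum_mul_sum]
    rw [integral_finsetSum _ fun y _ => integrable_finsetSum _ fun z _ => hint y z]
    calc ∑ y ∈ ball k x, ∫ ω, ∑ z ∈ ball k x, X y ω * X z ω ∂(law N p)
        ≤ ∑ y ∈ ball k x, (N : ℝ) ^ n := by
          refine Finset.sum_le_sum fun y _ => ?_
          rw [integral_finsetSum _ fun z _ => hint y z]
          refine (Finset.sum_le_sum fun z _ => hcov y z).trans ?_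
          rw [← Finset.sum_filter, Finset.sum_const, nsmul_eq_mul, mul_one]
          have : ((ball k x).filter fun z => z ∈ ball n y).card ≤ N ^ n := by
            rw [← card_ball n y]
            exact Finset.card_le_card fun z hz => (Finset.mem_filter.1 hz).2
          exact_mod_cast this
      _ = _ := by rw [Finset.sum_const, card_ball, nsmul_eq_mul]; push_cast; ring
  set B := {ω | ∑ y ∈ ball k x, (A y).indicator (fun _ => (1 : ℝ)) ω < q / 2 * (N : ℝ) ^ k} with hB
  have hBm : MeasurableSet B := measurableSet_lt
    (Finset.measurable_sum _ fun y _ => measurable_const.indicator (hAm y)) measurable_const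
  have hle : ∫ ω, B.indicator (fun _ => (q / 2 * (N : ℝ) ^ k) ^ 2) ω ∂(law N p)
      ≤ ∫ ω, (∑ y ∈ ball k x, X y ω) ^ 2 ∂(law N p) := by
    refine integral_mono ((integrable_const _).indicator hBm) ?_ fun ω => ?_
    · simp only [pow_two, Finset.sum_mul_sum]
      exact integrable_finsetSum _ fun y _ => integrable_finsetSum _ fun z _ => hint y z
    · by_cases hω : ω ∈ B
      · rw [Set.indicator_of_mem hω]
        have h1 : ∑ y ∈ ball k x, (A y).indicator (fun _ => (1 : ℝ)) ω < q / 2 * (N : ℝ) ^ k := hω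
        have h2 : q * (N : ℝ) ^ k ≤ ∑ y ∈ ball k x, (law N p).real (A y) := by
          calc q * (N : ℝ) ^ k = ∑ y ∈ ball k x, q := by
                rw [Finset.sum_const, card_ball, nsmul_eq_mul]; push_cast; ring
            _ ≤ _ := Finset.sum_le_sum fun y _ => hq y
        simp only [hX, Finset.sum_sub_distrib]
        have h3 : 0 ≤ q / 2 * (N : ℝ) ^ k := by positivity
        nlinarith
      · rw [Set.indicator_of_notMem hω]
        positivity
  rw [integral_indicator_const _ hBm, smul_eq_mul] at hle
  have h1 := hle.trans hsq
  rw [le_div_iff₀ (by positivity)]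
  have h2 : (N : ℝ) ^ k * ((law N p).real B * (q ^ 2 * (N : ℝ) ^ k))
      ≤ (N : ℝ) ^ k * (4 * (N : ℝ) ^ n) := by nlinarith
  exact le_of_mul_le_mul_left h2 hNk

variable (base : HierGroup N → Cfg N → Finset (HierGroup N)) (l : ℕ → ℕ) (r : ℝ)

/-- Some pair between `S` and `T` is open. -/
def Linked (S T : Finset (HierGroup N)) (ω : Cfg N) : Prop := ∃ a ∈ S, ∃ b ∈ T, ω s(a, b) = true

open Classical in
/-- The multiscale cores. The core of `x` at scale `i + 2` consists of the points of the ball of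
radius `l (i + 2)` with a nonempty core at scale `i + 1`, provided that there are many of them,
that `x` is one of them, and that the cores at scale `i` of any two of them from different balls
of radius `l (i + 1)` are linked. -/
noncomputable def core : ℕ → HierGroup N → Cfg N → Finset (HierGroup N)
  | 0, x, ω => base x ω
  | 1, x, ω => base x ω
  | i + 2, x, ω =>
    if (core (i + 1) x ω).Nonempty ∧ r * (N : ℝ) ^ l (i + 2) ≤
        ((ball (l (i + 2)) x).filter fun y => (core (i + 1) y ω).Nonempty).card ∧
        ∀ y ∈ ball (l (i + 2)) x, ∀ z ∈ ball (l (i + 2)) x, l (i + 1) < hdist y z →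
          (core (i + 1) y ω).Nonempty → (core (i + 1) z ω).Nonempty →
            Linked (core i y ω) (core i z ω) ω
    then (ball (l (i + 2)) x).filter fun y => (core (i + 1) y ω).Nonempty
    else ∅

variable {base l r}

theorem mem_core {i : ℕ} {x y : HierGroup N} {ω : Cfg N}
    (h : (core base l r (i + 2) x ω).Nonempty) :
    y ∈ core base l r (i + 2) x ω ↔
      y ∈ ball (l (i + 2)) x ∧ (core base l r (i + 1) y ω).Nonempty := by
  rw [core] at h ⊢
  split_ifs at h ⊢
  · rw [Finset.mem_filter]
  · simp at h

theorem core_nonempty_of_succ : ∀ {i : ℕ} {x : HierGroup N} {ω : Cfg N},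
    (core base l r (i + 1) x ω).Nonempty → (core base l r i x ω).Nonempty
  | 0, _, _, h => h
  | i + 1, x, ω, h => by
    rw [core] at h
    split_ifs at h with hc
    · exact hc.1
    · simp at h

/-- Links join cores two scales down, not one. The points of one core at scale `i + 1` all share
that core, but they spread over many balls of radius `l i`, where their cores at scale `i` are
disjoint; this provides links in parallel. -/
theorem linked_core {i : ℕ} {x y z : HierGroup N} {ω : Cfg N}
    (h : (core base l r (i + 2) x ω).Nonempty) (hy : y ∈ ball (l (i + 2)) x)
    (hz : z ∈ ball (l (i + 2)) x) (hyz : l (i + 1) < hdist y z)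
    (hy' : (core base l r (i + 1) y ω).Nonempty) (hz' : (core base l r (i + 1) z ω).Nonempty) :
    Linked (core base l r i y ω) (core base l r i z ω) ω := by
  rw [core] at h
  split_ifs at h with hc
  · exact hc.2.2 y hy z hz hyz hy' hz'
  · simp at h

/-- Apart from `x` being one of the points, the conditions on a core concern only the ball, so a
core is shared by all its points. -/
theorem core_congr_ball {i : ℕ} {x y : HierGroup N} {ω : Cfg N}
    (h : (core base l r (i + 2) x ω).Nonempty) (hy : y ∈ ball (l (i + 2)) x)
    (hy' : (core base l r (i + 1) y ω).Nonempty) : (core base l r (i + 2) y ω).Nonempty := by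
  have hb := ball_eq_of_mem hy
  rw [core] at h ⊢
  split_ifs at h with hc
  · rw [hb, if_pos ⟨hy', hc.2⟩]
    exact ⟨y, Finset.mem_filter.2 ⟨hy, hy'⟩⟩
  · simp at h

theorem core_subset_ball (hl : l 1 = l 0) (hb : ∀ x ω, base x ω ⊆ ball (l 0) x) :
    ∀ (i : ℕ) (x : HierGroup N) (ω : Cfg N), core base l r i x ω ⊆ ball (l i) x
  | 0, x, ω => hb x ω
  | 1, x, ω => by rw [core, hl]; exact hb x ω
  | i + 2, x, ω => by
    rw [core]
    split_ifs
    · exact Finset.filter_subset _ _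
    · exact Finset.empty_subset _

theorem le_card_core (hl : l 1 = l 0)
    (hb : ∀ x ω, (base x ω).Nonempty → r * (N : ℝ) ^ l 0 ≤ (base x ω).card) :
    ∀ {i : ℕ} {x : HierGroup N} {ω : Cfg N}, (core base l r i x ω).Nonempty →
      r * (N : ℝ) ^ l i ≤ (core base l r i x ω).card
  | 0, x, ω, h => hb x ω h
  | 1, x, ω, h => by rw [core] at h ⊢; rw [hl]; exact hb x ω h
  | i + 2, x, ω, h => by
    rw [core] at h ⊢
    split_ifs at h ⊢ with hc
    · exact hc.2.1
    · simp at h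

theorem dependsOn_core (hl : l 1 = l 0) (hmono : Monotone l)
    (hb : ∀ x, DependsOn (base x) (pairsIn (ball (l 0) x : Set (HierGroup N))))
    (hbs : ∀ x ω, base x ω ⊆ ball (l 0) x) :
    ∀ (i : ℕ) (x : HierGroup N),
      DependsOn (core base l r i x) (pairsIn (ball (l i) x : Set (HierGroup N)))
  | 0, x => hb x
  | 1, x => by
    intro ω ω' h
    rw [core, core]
    exact hb x (by rwa [hl] at h)
  | i + 2, x => by
    intro ω ω' h
    have hlt : ∀ j ≤ i + 1, ∀ y ∈ ball (l (i + 2)) x,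
        ∀ e ∈ pairsIn (ball (l j) y : Set (HierGroup N)), ω e = ω' e := by
      intro j hj y hy e he
      refine h e (pairsIn_mono ?_ he)
      rw [← ball_eq_of_mem hy]
      exact ball_subset_ball (hmono (by omega)) y
    have h1 : ∀ y ∈ ball (l (i + 2)) x, core base l r (i + 1) y ω = core base l r (i + 1) y ω' :=
      fun y hy => dependsOn_core hl hmono hb hbs (i + 1) y (hlt _ le_rfl y hy)
    have h2 : ∀ y ∈ ball (l (i + 2)) x, core base l r i y ω = core base l r i y ω' :=
      fun y hy => dependsOn_core hl hmono hb hbs i y (hlt _ (by omega) y hy)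
    have h3 : ((ball (l (i + 2)) x).filter fun y => (core base l r (i + 1) y ω).Nonempty)
        = (ball (l (i + 2)) x).filter fun y => (core base l r (i + 1) y ω').Nonempty :=
      Finset.filter_congr fun y hy => by rw [h1 y hy]
    rw [core, core, h3, h1 x (self_mem_ball _ x)]
    congr 1
    refine propext (and_congr_right fun _ => and_congr_right fun _ => forall_congr' fun y =>
      forall_congr' fun hy => forall_congr' fun z => forall_congr' fun hz =>
      forall_congr' fun _ => ?_)
    rw [h1 y hy, h1 z hz, h2 y hy, h2 z hz]
    refine forall_congr' fun _ => forall_congr' fun _ => ?_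
    unfold Linked
    refine exists_congr fun a => and_congr_right fun ha => exists_congr fun b =>
      and_congr_right fun hb' => ?_
    have hsub : ∀ y ∈ ball (l (i + 2)) x, core base l r i y ω' ⊆ ball (l (i + 2)) x := by
      intro y hy
      rw [← ball_eq_of_mem hy]
      exact (core_subset_ball hl hbs i y ω').trans (ball_subset_ball (hmono (by omega)) y)
    rw [h _ (mem_pairsIn.2 ⟨hsub y hy ha, hsub z hz hb'⟩)]

variable (p : ℕ → unitInterval)

/-- Two large random sets in disjoint balls fail to be linked with small probability. -/
theorem law_not_linked_le {n : ℕ} {y z : HierGroup N} (hyz : n < hdist y z)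
    {S T : Cfg N → Finset (HierGroup N)} (hS : DependsOn S (pairsIn (ball n y : Set (HierGroup N))))
    (hT : DependsOn T (pairsIn (ball n z : Set (HierGroup N)))) (hSb : ∀ ω, S ω ⊆ ball n y)
    (hTb : ∀ ω, T ω ⊆ ball n z) {K : ℝ} (hK : 0 ≤ K) :
    (law N p).real {ω | K ≤ (S ω).card ∧ K ≤ (T ω).card ∧ ¬ Linked (S ω) (T ω) ω}
      ≤ Real.exp (-(p (hdist y z) * K ^ 2)) := by
  classical
  have hd := ball_disjoint hyz
  obtain ⟨s, hs⟩ : ∃ s, s = pairsIn (ball n y : Set (HierGroup N)) ∪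
    pairsIn (ball n z : Set (HierGroup N)) := ⟨_, rfl⟩
  set E := {ω | K ≤ (S ω).card ∧ K ≤ (T ω).card ∧ ¬ Linked (S ω) (T ω) ω} with hE
  have hEm : MeasurableSet E := by
    refine measurableSet_of_dependsOn_finite
      (pairsIn_finite ((ball n y).finite_toSet.union (ball n z).finite_toSet)) fun ω ω' h => ?_
    rw [hS fun e he => h e (pairsIn_mono Set.subset_union_left he),
      hT fun e he => h e (pairsIn_mono Set.subset_union_right he)]
    refine propext (and_congr_right fun _ => and_congr_right fun _ => not_congr ?_)
    refine exists_congr fun a => and_congr_right fun ha => exists_congr fun b =>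
      and_congr_right fun hb => ?_
    rw [h _ (mem_pairsIn.2 ⟨Or.inl (hSb _ ha), Or.inr (hTb _ hb)⟩)]
  have key := infinitePi_le_of_piecewise
    (fun e : Sym2 (HierGroup N) => bernoulliMeasure true false (p (lev e))) s hEm
    (c := ENNReal.ofReal (Real.exp (-(p (hdist y z) * K ^ 2)))) fun a => by
      change law N p _ ≤ _
      rw [← ofReal_measureReal]
      refine ENNReal.ofReal_le_ofReal ?_
      have hagree : ∀ b : Cfg N, ∀ i ∈ s, s.piecewise a b i = a i := fun b i hi => by simp [hi]
      have hSa : ∀ b : Cfg N, S (s.piecewise a b) = S a :=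
        fun b => hS fun e he => hagree b e (hs ▸ Or.inl he)
      have hTa : ∀ b : Cfg N, T (s.piecewise a b) = T a :=
        fun b => hT fun e he => hagree b e (hs ▸ Or.inr he)
      by_cases hKa : K ≤ (S a).card ∧ K ≤ (T a).card
      · have hsub : {b : Cfg N | s.piecewise a b ∈ E}
            ⊆ {b | ∀ v ∈ S a, ∀ u ∈ T a, b s(v, u) = false} := by
          rintro b ⟨_, _, h3⟩ v hv u hu
          have hnot : s(v, u) ∉ s := by
            rw [hs]
            rintro (h | h)
            · exact Set.disjoint_left.1 hd (mem_pairsIn.1 h).2 (hTb _ hu)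
            · exact Set.disjoint_left.1 hd (hSb _ hv) (mem_pairsIn.1 h).1
          by_contra hc
          refine h3 ⟨v, by rwa [hSa], u, by rwa [hTa], ?_⟩
          simpa [hnot] using hc
        refine (measureReal_mono hsub (measure_ne_top _ _)).trans ?_
        rw [law_closed_between p hyz (hSb a) (hTb a)]
        refine (one_sub_pow_le_exp (p _).2.2 _).trans ?_
        rw [Real.exp_le_exp, neg_le_neg_iff]
        refine mul_le_mul_of_nonneg_left ?_ (p _).2.1
        push_cast
        rw [pow_two]
        exact mul_le_mul hKa.1 hKa.2 hK (by positivity)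
      · have hemp : {b : Cfg N | s.piecewise a b ∈ E} = ∅ := by
          refine Set.eq_empty_of_forall_notMem ?_
          rintro b ⟨h1, h2, _⟩
          rw [hSa] at h1
          rw [hTa] at h2
          exact hKa ⟨h1, h2⟩
        rw [hemp, measureReal_empty]
        exact (Real.exp_pos _).le
  have := ENNReal.toReal_mono ENNReal.ofReal_ne_top key
  rwa [ENNReal.toReal_ofReal (Real.exp_pos _).le] at this

variable (hl : l 1 = l 0) (hmono : Monotone l)
  (hb : ∀ x, DependsOn (base x) (pairsIn (ball (l 0) x : Set (HierGroup N))))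
  (hbs : ∀ x ω, base x ω ⊆ ball (l 0) x)

include hl hmono hb hbs in
theorem measurableSet_core_nonempty (i : ℕ) (x : HierGroup N) :
    MeasurableSet {ω | (core base l r i x ω).Nonempty} :=
  measurableSet_of_dependsOn_finite (pairsIn_finite (ball (l i) x).finite_toSet)
    fun ω ω' h => by rw [dependsOn_core hl hmono hb hbs i x h]

include hl hmono hb hbs in
/-- The probability that a core dies at a given scale. -/
theorem law_core_succ_ge (hr : 0 ≤ r)
    (hbc : ∀ x ω, (base x ω).Nonempty → r * (N : ℝ) ^ l 0 ≤ (base x ω).card)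
    {i : ℕ} {q t : ℝ} (hq0 : 0 < q) (hrq : r ≤ q / 2)
    (hq : ∀ y, q ≤ (law N p).real {ω | (core base l r (i + 1) y ω).Nonempty})
    (ht : ∀ k, l (i + 1) < k → k ≤ l (i + 2) → t ≤ p k) (x : HierGroup N) :
    (law N p).real {ω | (core base l r (i + 1) x ω).Nonempty}
      - (4 * (N : ℝ) ^ l (i + 1) / (q ^ 2 * (N : ℝ) ^ l (i + 2))
        + ((N : ℝ) ^ l (i + 2)) ^ 2 * Real.exp (-(t * (r * (N : ℝ) ^ l i) ^ 2)))
      ≤ (law N p).real {ω | (core base l r (i + 2) x ω).Nonempty} := by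
  classical
  set A : HierGroup N → Set (Cfg N) := fun y => {ω | (core base l r (i + 1) y ω).Nonempty} with hA
  have hcheb := law_sum_indicator_lt_le p (A := A) (fun y ω ω' h => by
    simp only [hA, Set.mem_ofPred_eq]
    rw [dependsOn_core hl hmono hb hbs (i + 1) y h]) (k := l (i + 2)) hq0 hq x
  set B := {ω | ∑ y ∈ ball (l (i + 2)) x, (A y).indicator (fun _ => (1 : ℝ)) ω
    < q / 2 * (N : ℝ) ^ l (i + 2)} with hB
  set F := ((ball (l (i + 2)) x) ×ˢ (ball (l (i + 2)) x)).filter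
    fun u => l (i + 1) < hdist u.1 u.2 with hF
  set C : HierGroup N × HierGroup N → Set (Cfg N) := fun u =>
    {ω | r * (N : ℝ) ^ l i ≤ (core base l r i u.1 ω).card ∧
      r * (N : ℝ) ^ l i ≤ (core base l r i u.2 ω).card ∧
      ¬ Linked (core base l r i u.1 ω) (core base l r i u.2 ω) ω} with hC
  have hlink : (law N p).real (⋃ u ∈ F, C u)
      ≤ ((N : ℝ) ^ l (i + 2)) ^ 2 * Real.exp (-(t * (r * (N : ℝ) ^ l i) ^ 2)) := by
    refine (measureReal_biUnion_finset_le F _).trans ?_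
    calc ∑ u ∈ F, (law N p).real (C u)
        ≤ ∑ u ∈ F, Real.exp (-(t * (r * (N : ℝ) ^ l i) ^ 2)) := by
          refine Finset.sum_le_sum fun u hu => ?_
          obtain ⟨hu1, hu2⟩ := Finset.mem_filter.1 hu
          obtain ⟨hu3, hu4⟩ := Finset.mem_product.1 hu1
          have hk : hdist u.1 u.2 ≤ l (i + 2) :=
            hdist_le_trans (hdist_le_comm (mem_ball.1 hu3)) (mem_ball.1 hu4)
          refine (law_not_linked_le p ((hmono (Nat.le_succ i)).trans_lt hu2)
            (dependsOn_core hl hmono hb hbs i u.1) (dependsOn_core hl hmono hb hbs i u.2)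
            (core_subset_ball hl hbs i u.1) (core_subset_ball hl hbs i u.2)
            (by positivity)).trans ?_
          rw [Real.exp_le_exp, neg_le_neg_iff]
          exact mul_le_mul_of_nonneg_right (ht _ hu2 hk) (by positivity)
      _ = F.card * Real.exp (-(t * (r * (N : ℝ) ^ l i) ^ 2)) := by
          rw [Finset.sum_const, nsmul_eq_mul]
      _ ≤ _ := by
          refine mul_le_mul_of_nonneg_right ?_ (Real.exp_pos _).le
          have : F.card ≤ (N ^ l (i + 2)) * (N ^ l (i + 2)) := by
            refine (Finset.card_filter_le _ _).trans ?_
            rw [Finset.card_product, card_ball]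
          rw [pow_two]
          exact_mod_cast this
  -- The core survives unless too few points of the ball are alive or two large cores at scale `i`
  -- are not linked.
  have hsub : A x ⊆ {ω | (core base l r (i + 2) x ω).Nonempty} ∪ (B ∪ ⋃ u ∈ F, C u) := by
    intro ω hω
    by_contra hcon
    simp only [Set.mem_union, not_or] at hcon
    obtain ⟨h1, h2, h3⟩ := hcon
    refine h1 ?_
    change (core base l r (i + 2) x ω).Nonempty
    rw [core, if_pos]
    · exact ⟨x, Finset.mem_filter.2 ⟨self_mem_ball _ x, hω⟩⟩
    · refine ⟨hω, ?_, fun y hy z hz hyz hy' hz' => ?_⟩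
      · have h4 : q / 2 * (N : ℝ) ^ l (i + 2)
          ≤ ∑ y ∈ ball (l (i + 2)) x, (A y).indicator (fun _ => (1 : ℝ)) ω := not_lt.1 h2
        have h5 : ∑ y ∈ ball (l (i + 2)) x, (A y).indicator (fun _ => (1 : ℝ)) ω
            = (((ball (l (i + 2)) x).filter
              fun y => (core base l r (i + 1) y ω).Nonempty).card : ℝ) := by
          simp only [Set.indicator_apply, hA, Set.mem_ofPred_eq, Finset.sum_boole]
        rw [← h5]
        refine le_trans ?_ h4
        gcongr
      · by_contra hlk
        refine h3 (Set.mem_iUnion₂.2 ⟨(y, z), Finset.mem_filter.2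
          ⟨Finset.mem_product.2 ⟨hy, hz⟩, hyz⟩, ?_⟩)
        exact ⟨le_card_core hl hbc (core_nonempty_of_succ hy'),
          le_card_core hl hbc (core_nonempty_of_succ hz'), hlk⟩
  have h1 := measureReal_mono (μ := law N p) hsub (measure_ne_top _ _)
  have h2 := measureReal_union_le (μ := law N p) {ω | (core base l r (i + 2) x ω).Nonempty}
    (B ∪ ⋃ u ∈ F, C u)
  have h3 := measureReal_union_le (μ := law N p) B (⋃ u ∈ F, C u)
  linarith

include hl hmono hb hbs in
/-- With summable death probabilities, a core survives at all scales with positive probability. -/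
theorem le_law_core_nonempty (hr : 0 ≤ r)
    (hbc : ∀ x ω, (base x ω).Nonempty → r * (N : ℝ) ^ l 0 ≤ (base x ω).card)
    {q : ℝ} {t β : ℕ → ℝ} (hq0 : 0 < q) (hrq : r ≤ q / 2)
    (hbase : ∀ y, 2 * q ≤ (law N p).real {ω | (base y ω).Nonempty})
    (ht : ∀ i k, l (i + 1) < k → k ≤ l (i + 2) → t i ≤ p k)
    (hβ : ∀ i, 4 * (N : ℝ) ^ l (i + 1) / (q ^ 2 * (N : ℝ) ^ l (i + 2))
      + ((N : ℝ) ^ l (i + 2)) ^ 2 * Real.exp (-(t i * (r * (N : ℝ) ^ l i) ^ 2)) ≤ β i)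
    (hβsum : ∀ n, ∑ i ∈ Finset.range n, β i ≤ q) (x : HierGroup N) :
    q ≤ (law N p).real {ω | ∀ i, (core base l r i x ω).Nonempty} := by
  -- Of the initial `2 * q` at most `q` is lost in total, so the hypothesis of `law_core_succ_ge`
  -- stays available at every scale.
  have hind : ∀ i y, 2 * q - ∑ j ∈ Finset.range i, β j
      ≤ (law N p).real {ω | (core base l r (i + 1) y ω).Nonempty} := by
    intro i
    induction i with
    | zero => intro y; simpa [core] using hbase y
    | succ i ih =>
      intro y
      have h1 := law_core_succ_ge p hl hmono hb hbs hr hbc hq0 hrq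
        (fun y => le_trans (by linarith [hβsum i]) (ih y)) (ht i) y
      rw [Finset.sum_range_succ]
      linarith [ih y, hβ i]
  have hset : {ω | ∀ i, (core base l r i x ω).Nonempty}
      = ⋂ i, {ω | (core base l r (i + 1) x ω).Nonempty} := by
    ext ω
    simp only [Set.mem_ofPred_eq, Set.mem_iInter]
    exact ⟨fun h i => h (i + 1), fun h i => core_nonempty_of_succ (h i)⟩
  have hanti : Antitone fun i => {ω | (core base l r (i + 1) x ω).Nonempty} :=
    antitone_nat_of_succ_le fun i => Set.ofPred_subset_ofPred.2 fun ω h => core_nonempty_of_succ h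
  have hlim := tendsto_measure_iInter_atTop (μ := law N p)
    (s := fun i => {ω | (core base l r (i + 1) x ω).Nonempty})
    (fun i => (measurableSet_core_nonempty hl hmono hb hbs (i + 1) x).nullMeasurableSet) hanti
    ⟨0, measure_ne_top _ _⟩
  rw [← hset] at hlim
  refine ge_of_tendsto' ((ENNReal.tendsto_toReal (measure_ne_top _ _)).comp hlim) fun i => ?_
  change q ≤ (law N p).real {ω | (core base l r (i + 1) x ω).Nonempty}
  linarith [hind i x, hβsum i]

end core

/-! ### Resistance along the cores. -/

section energy

variable {N : ℕ}

open Classical in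
/-- The squared difference of `f` along a pair, if this pair is an edge of the random graph. -/
noncomputable def edgeEnergy (ω : Cfg N) (f : HierGroup N → ℝ) (a b : HierGroup N) : ℝ :=
  if (percGraph ω).Adj a b then (f a - f b) ^ 2 else 0

variable {ω : Cfg N} {f : HierGroup N → ℝ}

theorem edgeEnergy_nonneg (a b : HierGroup N) : 0 ≤ edgeEnergy ω f a b := by
  unfold edgeEnergy
  split_ifs
  · positivity
  · rfl

/-- The mean of `f` over `F`. -/
noncomputable def mean (f : HierGroup N → ℝ) (F : Finset (HierGroup N)) : ℝ :=
  (∑ u ∈ F, f u) / F.card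

/-- Cauchy–Schwarz over `F ×ˢ F'`: comparing means rather than points lets all the pairs act in
parallel. -/
theorem sq_mean_sub_mean_le {F F' : Finset (HierGroup N)} (hF : F.Nonempty) (hF' : F'.Nonempty) :
    (mean f F - mean f F') ^ 2
      ≤ (∑ u ∈ F, ∑ v ∈ F', (f u - f v) ^ 2) / (F.card * F'.card) := by
  have h1 : (0 : ℝ) < F.card := by exact_mod_cast hF.card_pos
  have h2 : (0 : ℝ) < F'.card := by exact_mod_cast hF'.card_pos
  have h3 : mean f F - mean f F' = (∑ u ∈ F, ∑ v ∈ F', (f u - f v)) / (F.card * F'.card) := by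
    simp only [mean, Finset.sum_sub_distrib, Finset.sum_const, nsmul_eq_mul]
    rw [← Finset.mul_sum]
    field_simp
  rw [h3, div_pow, div_le_div_iff₀ (by positivity) (by positivity)]
  have h4 : (∑ u ∈ F, ∑ v ∈ F', (f u - f v)) ^ 2
      ≤ (F.card * F'.card) * ∑ u ∈ F, ∑ v ∈ F', (f u - f v) ^ 2 := by
    rw [← Finset.sum_product', ← Finset.sum_product']
    refine (sq_sum_le_card_mul_sum_sq (s := F ×ˢ F') (f := fun q => f q.1 - f q.2)).trans_eq ?_
    rw [Finset.card_product]
    push_cast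
    rfl
  have h5 : (0 : ℝ) < F.card * F'.card := by positivity
  nlinarith

/-- Arithmetic for the passage between consecutive scales: `t` is the number of points of a small
ball, `D` the cost inside a core, and `a`, `b` are the numbers of points averaged over. -/
theorem mul_card_add_le {t K D E a b : ℝ} (htpos : 0 < t) (htK : t ≤ K) (hD1 : 1 ≤ D)
    (hE0 : 0 ≤ E) (ha : K ≤ a) (hb : K ≤ b) :
    3 * (b * (D * (t * E)) + t ^ 2 * E + a * (D * (t * E))) ≤ 9 * D * E * (t / K) * (a * b) := by
  have hKpos : 0 < K := htpos.trans_le htK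
  have hDE : 0 ≤ D * E * t := by positivity
  have hapos : 0 < a := hKpos.trans_le ha
  have hbpos : 0 < b := hKpos.trans_le hb
  have k1 : b * (D * (t * E)) ≤ D * E * t / K * (a * b) := by
    have : b * (D * (t * E)) = D * E * t / K * (K * b) := by field_simp
    rw [this]
    gcongr
  have k2 : a * (D * (t * E)) ≤ D * E * t / K * (a * b) := by
    have : a * (D * (t * E)) = D * E * t / K * (a * K) := by field_simp
    rw [this]
    gcongr
  have k3 : t ^ 2 * E ≤ D * E * t / K * (a * b) := by
    calc t ^ 2 * E ≤ t * K * (D * E) := by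
          rw [pow_two, mul_assoc, mul_assoc]
          refine mul_le_mul_of_nonneg_left ?_ htpos.le
          exact mul_le_mul htK (le_mul_of_one_le_left hE0 hD1) hE0 hKpos.le
      _ = D * E * t / K * (K * K) := by field_simp
      _ ≤ _ := by gcongr
  have e2 : 9 * D * E * (t / K) * (a * b) = 9 * (D * E * t / K * (a * b)) := by ring
  rw [e2]
  linarith

/-- Twice the Dirichlet energy of `f` inside `B`. -/
noncomputable def energy (ω : Cfg N) (f : HierGroup N → ℝ) (B : Finset (HierGroup N)) : ℝ :=
  ∑ a ∈ B, ∑ b ∈ B, edgeEnergy ω f a b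

theorem energy_nonneg (B : Finset (HierGroup N)) : 0 ≤ energy ω f B :=
  Finset.sum_nonneg fun _ _ => Finset.sum_nonneg fun _ _ => edgeEnergy_nonneg _ _

theorem energy_mono {A B : Finset (HierGroup N)} (h : A ⊆ B) : energy ω f A ≤ energy ω f B := by
  refine (Finset.sum_le_sum fun a _ => Finset.sum_le_sum_of_subset_of_nonneg h
    fun _ _ _ => edgeEnergy_nonneg _ _).trans ?_
  exact Finset.sum_le_sum_of_subset_of_nonneg h fun _ _ _ =>
    Finset.sum_nonneg fun _ _ => edgeEnergy_nonneg _ _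

theorem sq_sub_le_sum_edgeEnergy {A B : Finset (HierGroup N)} {a b : HierGroup N}
    (hab : (percGraph ω).Adj a b) (ha : a ∈ A) (hb : b ∈ B) :
    (f a - f b) ^ 2 ≤ ∑ a ∈ A, ∑ b ∈ B, edgeEnergy ω f a b := by
  have h1 : (f a - f b) ^ 2 = edgeEnergy ω f a b := by rw [edgeEnergy, if_pos hab]
  rw [h1]
  exact (Finset.single_le_sum (f := fun b => edgeEnergy ω f a b)
    (fun _ _ => edgeEnergy_nonneg _ _) hb).trans
    (Finset.single_le_sum (f := fun a => ∑ b ∈ B, edgeEnergy ω f a b)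
      (fun _ _ => Finset.sum_nonneg fun _ _ => edgeEnergy_nonneg _ _) ha)

/-- The difference of `f` at two points near linked sets. -/
theorem sq_sub_le_of_linked {S T A B : Finset (HierGroup N)} {y z : HierGroup N} {D e₁ e₂ : ℝ}
    (hSA : S ⊆ A) (hTB : T ⊆ B) (hAB : Disjoint A B)
    (hS : ∀ a ∈ S, (f y - f a) ^ 2 ≤ D * e₁) (hT : ∀ b ∈ T, (f z - f b) ^ 2 ≤ D * e₂)
    (hlink : Linked S T ω) :
    (f y - f z) ^ 2 ≤ 3 * (D * e₁ + (∑ a ∈ A, ∑ b ∈ B, edgeEnergy ω f a b) + D * e₂) := by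
  obtain ⟨a, ha, b, hb, hab⟩ := hlink
  have hadj : (percGraph ω).Adj a b :=
    ⟨fun h => Finset.disjoint_left.1 hAB (hSA ha) (h ▸ hTB hb), hab⟩
  have h1 := hS a ha
  have h2 := hT b hb
  have h3 := sq_sub_le_sum_edgeEnergy (f := f) hadj (hSA ha) (hTB hb)
  nlinarith [sq_nonneg ((f y - f a) - (f a - f b)), sq_nonneg ((f a - f b) - (f b - f z)),
    sq_nonneg ((f y - f a) - (f b - f z))]

variable [NeZero N]

/-- A simple path in the ball has at most `N ^ n` steps, and on each of them `f` changes by at most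
the root of the energy. -/
theorem sq_sub_le_of_mem_cluster {n : ℕ} {x y : HierGroup N} (hy : y ∈ cluster n x ω) :
    (f x - f y) ^ 2 ≤ ((N : ℝ) ^ n) ^ 2 * energy ω f (ball n x) := by
  classical
  obtain ⟨w, hw⟩ := (mem_cluster.1 hy).exists_isPath
  have hwalk : ∀ {u v : HierGroup N} (w : (graphUpTo n ω).Walk u v), u ∈ ball n x →
      (∀ z ∈ w.support, z ∈ ball n x) ∧ |f u - f v| ≤ w.length * √(energy ω f (ball n x)) := by
    intro u v w
    induction w with
    | nil => intro hu; simp [hu]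
    | @cons a b c hab w ih =>
      intro ha
      have hb : b ∈ ball n x := mem_ball.2 (hdist_le_trans (mem_ball.1 ha) hab.2)
      obtain ⟨h1, h2⟩ := ih hb
      refine ⟨fun z hz => ?_, ?_⟩
      · rw [SimpleGraph.Walk.support_cons, List.mem_cons] at hz
        rcases hz with rfl | hz
        · exact ha
        · exact h1 z hz
      · rw [SimpleGraph.Walk.length_cons]
        have h3 : |f a - f b| ≤ √(energy ω f (ball n x)) := by
          rw [← Real.sqrt_sq_eq_abs]
          exact Real.sqrt_le_sqrt (sq_sub_le_sum_edgeEnergy hab.1 ha hb)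
        have h4 := abs_sub_le (f a) (f b) (f c)
        push_cast
        linarith
  obtain ⟨h1, h2⟩ := hwalk w (self_mem_ball n x)
  have hlen : w.length ≤ N ^ n := by
    have h3 : w.support.toFinset.card ≤ (ball n x).card :=
      Finset.card_le_card fun z hz => h1 z (List.mem_toFinset.1 hz)
    rw [List.toFinset_card_of_nodup hw.support_nodup, SimpleGraph.Walk.length_support,
      card_ball] at h3
    omega
  have h3 : |f x - f y| ≤ (N : ℝ) ^ n * √(energy ω f (ball n x)) := by
    refine h2.trans (mul_le_mul_of_nonneg_right ?_ (Real.sqrt_nonneg _))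
    exact_mod_cast hlen
  rw [← sq_abs]
  refine (pow_le_pow_left₀ (abs_nonneg _) h3 2).trans_eq ?_
  rw [mul_pow, Real.sq_sqrt (energy_nonneg _)]

theorem sum_sum_ball {n k : ℕ} (hnk : n ≤ k) (x : HierGroup N) (g : HierGroup N → ℝ) :
    ∑ u ∈ ball k x, ∑ a ∈ ball n u, g a = (N : ℝ) ^ n * ∑ a ∈ ball k x, g a := by
  rw [Finset.sum_comm' (t' := ball k x) (s' := fun a => ball n a)]
  · simp only [Finset.sum_const, card_ball, nsmul_eq_mul, Finset.mul_sum]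
    push_cast
    rfl
  · intro u a
    simp only [mem_ball]
    constructor
    · rintro ⟨h1, h2⟩
      exact ⟨hdist_le_comm h2, hdist_le_trans h1 (h2.trans hnk)⟩
    · rintro ⟨h1, h2⟩
      exact ⟨hdist_le_trans h2 (h1.trans hnk), hdist_le_comm h1⟩

/-- Each point lies in the `n`-balls of exactly `N ^ n` centres, so the small balls overlap only to
that extent. -/
theorem sum_energy_ball_le {n k : ℕ} (hnk : n ≤ k) (x : HierGroup N) :
    ∑ u ∈ ball k x, energy ω f (ball n u) ≤ (N : ℝ) ^ n * energy ω f (ball k x) := by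
  unfold energy
  rw [← sum_sum_ball hnk x fun a => ∑ b ∈ ball k x, edgeEnergy ω f a b]
  refine Finset.sum_le_sum fun u hu => Finset.sum_le_sum fun a _ =>
    Finset.sum_le_sum_of_subset_of_nonneg ?_ fun _ _ _ => edgeEnergy_nonneg _ _
  rw [← ball_eq_of_mem hu]
  exact ball_subset_ball hnk u

theorem sum_sum_edgeEnergy_ball {n k : ℕ} (hnk : n ≤ k) (x : HierGroup N) :
    ∑ u ∈ ball k x, ∑ v ∈ ball k x, ∑ a ∈ ball n u, ∑ b ∈ ball n v, edgeEnergy ω f a b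
      = ((N : ℝ) ^ n) ^ 2 * energy ω f (ball k x) := by
  have h1 : ∀ u, ∑ v ∈ ball k x, ∑ a ∈ ball n u, ∑ b ∈ ball n v, edgeEnergy ω f a b
      = ∑ a ∈ ball n u, (N : ℝ) ^ n * ∑ b ∈ ball k x, edgeEnergy ω f a b := by
    intro u
    rw [Finset.sum_comm]
    exact Finset.sum_congr rfl fun a _ => sum_sum_ball hnk x _
  simp only [h1]
  rw [sum_sum_ball hnk x, ← Finset.mul_sum, energy]
  ring

variable {base : HierGroup N → Cfg N → Finset (HierGroup N)} {l : ℕ → ℕ} {r : ℝ}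

variable (hl : l 1 = l 0) (hmono : Monotone l) (hbs : ∀ x ω, base x ω ⊆ cluster (l 0) x ω)
  (hbc : ∀ x ω, (base x ω).Nonempty → r * (N : ℝ) ^ l 0 ≤ (base x ω).card)
  (hgap : ∀ i, 2 * (N : ℝ) ^ l (i + 1) ≤ r * (N : ℝ) ^ l (i + 2))

/-- The part of the core of `x` at scale `i + 2` outside the ball of the previous scale. -/
noncomputable def farCore (base : HierGroup N → Cfg N → Finset (HierGroup N)) (l : ℕ → ℕ) (r : ℝ)
    (i : ℕ) (x : HierGroup N) (ω : Cfg N) : Finset (HierGroup N) :=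
  core base l r (i + 2) x ω \ ball (l (i + 1)) x

include hl hbc hgap in
theorem le_card_farCore {i : ℕ} {x : HierGroup N} (h : (core base l r (i + 2) x ω).Nonempty) :
    r / 2 * (N : ℝ) ^ l (i + 2) ≤ (farCore base l r i x ω).card := by
  have h1 := le_card_core hl hbc h
  have h2 : (core base l r (i + 2) x ω).card
      ≤ (farCore base l r i x ω).card + (ball (l (i + 1)) x).card :=
    Finset.card_le_card_sdiff_add_card
  rw [card_ball] at h2
  have h3 : ((core base l r (i + 2) x ω).card : ℝ)
      ≤ (farCore base l r i x ω).card + (N : ℝ) ^ l (i + 1) := by exact_mod_cast h2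
  linarith [hgap i]

include hgap in
theorem pos_of_gap : 0 < r := by
  have hN : 0 < N := NeZero.pos N
  have h := hgap 0
  have h1 : (0 : ℝ) < (N : ℝ) ^ l (0 + 1) := by positivity
  have h2 : (0 : ℝ) < (N : ℝ) ^ l (0 + 2) := by positivity
  by_contra hc
  nlinarith

include hl hbc hgap in
theorem farCore_nonempty {i : ℕ} {x : HierGroup N} (h : (core base l r (i + 2) x ω).Nonempty) :
    (farCore base l r i x ω).Nonempty := by
  have hN : 0 < N := NeZero.pos N
  have hr := pos_of_gap hgap
  have h1 := le_card_farCore hl hbc hgap h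
  rw [← Finset.card_pos]
  have : (0 : ℝ) < (farCore base l r i x ω).card := lt_of_lt_of_le (by positivity) h1
  exact_mod_cast this

include hl hmono hbs hbc hgap in
/-- Points of a core are close in the resistance metric. -/
theorem sq_sub_le_of_mem_core : ∀ {i : ℕ} {x y : HierGroup N}, y ∈ core base l r i x ω →
    (f x - f y) ^ 2 ≤ ((N : ℝ) ^ l 0) ^ 2 * 6 ^ i * energy ω f (ball (l i) x)
  | 0, x, y, h => by
    rw [pow_zero, mul_one]
    exact sq_sub_le_of_mem_cluster (hbs x ω h)
  | 1, x, y, h => by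
    have h1 := sq_sub_le_of_mem_cluster (f := f) (hbs x ω h)
    have h2 : 0 ≤ ((N : ℝ) ^ l 0) ^ 2 * energy ω f (ball (l 0) x) :=
      mul_nonneg (by positivity) (energy_nonneg _)
    rw [hl]
    linarith
  | i + 2, x, y, h => by
    have hb : ∀ x ω, base x ω ⊆ ball (l 0) x := fun x ω =>
      (hbs x ω).trans (cluster_subset_ball _ _ _)
    have hne : (core base l r (i + 2) x ω).Nonempty := ⟨y, h⟩
    set E := energy ω f (ball (l (i + 2)) x) with hE
    have hE0 : 0 ≤ E := energy_nonneg _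
    set D := ((N : ℝ) ^ l 0) ^ 2 * 6 ^ i with hD
    have hD1 : 1 ≤ D := by
      have hN : (1 : ℝ) ≤ N := by exact_mod_cast NeZero.pos N
      exact one_le_mul_of_one_le_of_one_le (one_le_pow₀ (one_le_pow₀ hN))
        (one_le_pow₀ (by norm_num))
    -- From `u` to a point of its core at scale `i`, across the link, and within the core of `v` to
    -- `v`: three squared differences of at most `D * E`, and a factor `3` for squaring the sum.
    have hfar : ∀ u v, u ∈ core base l r (i + 2) x ω → v ∈ core base l r (i + 2) x ω →
        l (i + 1) < hdist u v → (f u - f v) ^ 2 ≤ 9 * D * E := by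
      intro u v hu hv huv
      obtain ⟨hu1, hu2⟩ := (mem_core hne).1 hu
      obtain ⟨hv1, hv2⟩ := (mem_core hne).1 hv
      have hsub : ∀ u ∈ ball (l (i + 2)) x, ball (l i) u ⊆ ball (l (i + 2)) x := by
        intro u hu
        rw [← ball_eq_of_mem hu]
        exact ball_subset_ball (hmono (by omega)) u
      have hdisj : Disjoint (ball (l i) u) (ball (l i) v) :=
        Finset.disjoint_coe.1 (ball_disjoint ((hmono (Nat.le_succ i)).trans_lt huv))
      have h1 := sq_sub_le_of_linked (f := f) (D := D) (core_subset_ball hl hb i u ω)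
        (core_subset_ball hl hb i v ω) hdisj
        (fun a ha => sq_sub_le_of_mem_core ha) (fun a ha => sq_sub_le_of_mem_core ha)
        (linked_core hne hu1 hv1 huv hu2 hv2)
      have h2 : energy ω f (ball (l i) u) ≤ E := energy_mono (hsub u hu1)
      have h3 : energy ω f (ball (l i) v) ≤ E := energy_mono (hsub v hv1)
      have h4 : ∑ a ∈ ball (l i) u, ∑ b ∈ ball (l i) v, edgeEnergy ω f a b ≤ E := by
        refine (Finset.sum_le_sum fun a _ => Finset.sum_le_sum_of_subset_of_nonneg (hsub v hv1)
          fun _ _ _ => edgeEnergy_nonneg _ _).trans ?_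
        exact Finset.sum_le_sum_of_subset_of_nonneg (hsub u hu1) fun _ _ _ =>
          Finset.sum_nonneg fun _ _ => edgeEnergy_nonneg _ _
      have h5 : D * energy ω f (ball (l i) u) ≤ D * E := by gcongr
      have h6 : D * energy ω f (ball (l i) v) ≤ D * E := by gcongr
      have h7 : E ≤ D * E := le_mul_of_one_le_left hE0 hD1
      linarith
    have hx : x ∈ core base l r (i + 2) x ω :=
      (mem_core hne).2 ⟨self_mem_ball _ x, core_nonempty_of_succ hne⟩
    have hDE : 0 ≤ D * E := by positivity
    have hgoal : ((N : ℝ) ^ l 0) ^ 2 * 6 ^ (i + 2) * E = 36 * (D * E) := by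
      rw [hD]; ring
    rw [hgoal]
    by_cases hxy : l (i + 1) < hdist x y
    · linarith [hfar x y hx h hxy]
    -- Two points in a common ball of the previous scale are compared through a point of the far
    -- core, with `(s + t) ^ 2 ≤ 2 * (s ^ 2 + t ^ 2)`. This gives `36 = 6 ^ 2` for two scales.
    · obtain ⟨z, hz⟩ := farCore_nonempty hl hbc hgap hne
      obtain ⟨hz1, hz2⟩ := Finset.mem_sdiff.1 hz
      rw [mem_ball, not_le] at hz2
      have h1 := hfar x z hx hz1 hz2
      have h2 := hfar y z h hz1 (by
        rwa [hdist_eq_of_le_of_lt (not_lt.1 hxy) hz2])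
      nlinarith [sq_nonneg ((f x - f z) + (f y - f z))]

-- Points of the two far cores are more than `l (i + 2)` apart, so every pair is joined through
-- linked cores at scale `i + 1`. Averaged over all pairs, the energies of the small balls overlap
-- little, which gains the ratio `N ^ l (i + 1) / N ^ l (i + 2)`.
include hl hmono hbs hbc hgap in
theorem sq_mean_farCore_sub_le {i : ℕ} {x : HierGroup N}
    (h : ∀ j, (core base l r j x ω).Nonempty) :
    (mean f (farCore base l r i x ω) - mean f (farCore base l r (i + 1) x ω)) ^ 2
      ≤ 108 * ((N : ℝ) ^ l 0) ^ 2 / r * (6 ^ i * (N : ℝ) ^ l (i + 1) / (N : ℝ) ^ l (i + 2))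
        * energy ω f (ball (l (i + 3)) x) := by
  have hN : 0 < N := NeZero.pos N
  have hr := pos_of_gap hgap
  have hb : ∀ x ω, base x ω ⊆ ball (l 0) x := fun x ω =>
    (hbs x ω).trans (cluster_subset_ball _ _ _)
  set F := farCore base l r i x ω with hF
  set F' := farCore base l r (i + 1) x ω with hF'
  set E := energy ω f (ball (l (i + 3)) x) with hE
  have hE0 : 0 ≤ E := energy_nonneg _
  set D := ((N : ℝ) ^ l 0) ^ 2 * 6 ^ (i + 1) with hD
  have hD1 : 1 ≤ D := by
    have hN : (1 : ℝ) ≤ N := by exact_mod_cast hN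
    exact one_le_mul_of_one_le_of_one_le (one_le_pow₀ (one_le_pow₀ hN))
      (one_le_pow₀ (by norm_num))
  have hFc : r / 2 * (N : ℝ) ^ l (i + 2) ≤ F.card := le_card_farCore hl hbc hgap (h _)
  have hFc' : r / 2 * (N : ℝ) ^ l (i + 2) ≤ F'.card := by
    refine le_trans ?_ (le_card_farCore hl hbc hgap (h (i + 3)))
    have : (1 : ℝ) ≤ N := by exact_mod_cast hN
    gcongr
    exact hmono (by omega)
  have hFB : F ⊆ ball (l (i + 3)) x := Finset.sdiff_subset.trans
    ((core_subset_ball hl hb _ x ω).trans (ball_subset_ball (hmono (by omega)) x))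
  have hFB' : F' ⊆ ball (l (i + 3)) x := Finset.sdiff_subset.trans (core_subset_ball hl hb _ x ω)
  set n := l (i + 1) with hn
  have hnk : n ≤ l (i + 3) := hmono (by omega)
  have hpair : ∀ u ∈ F, ∀ v ∈ F', (f u - f v) ^ 2 ≤ 3 * (D * energy ω f (ball n u)
      + (∑ a ∈ ball n u, ∑ b ∈ ball n v, edgeEnergy ω f a b) + D * energy ω f (ball n v)) := by
    intro u hu v hv
    obtain ⟨hu1, -⟩ := Finset.mem_sdiff.1 hu
    obtain ⟨hv1, hv2⟩ := Finset.mem_sdiff.1 hv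
    have hu2 := (mem_core (h (i + 2))).1 hu1
    have hv3 := (mem_core (h (i + 3))).1 hv1
    have huv : l (i + 2) < hdist u v := by
      rw [mem_ball, not_le] at hv2
      rwa [hdist_eq_of_le_of_lt (mem_ball.1 hu2.1) hv2]
    refine sq_sub_le_of_linked (core_subset_ball hl hb (i + 1) u ω)
      (core_subset_ball hl hb (i + 1) v ω)
      (Finset.disjoint_coe.1 (ball_disjoint ((hmono (Nat.le_succ (i + 1))).trans_lt huv)))
      (fun a ha => sq_sub_le_of_mem_core hl hmono hbs hbc hgap ha)
      (fun a ha => sq_sub_le_of_mem_core hl hmono hbs hbc hgap ha)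
      (linked_core (h (i + 3)) (hFB hu) hv3.1 huv (core_congr_ball (h (i + 2)) hu2.1 hu2.2) hv3.2)
  have hsumE : ∀ F ⊆ ball (l (i + 3)) x, ∑ u ∈ F, energy ω f (ball n u) ≤ (N : ℝ) ^ n * E :=
    fun F hF => (Finset.sum_le_sum_of_subset_of_nonneg hF fun _ _ _ => energy_nonneg _).trans
      (sum_energy_ball_le hnk x)
  have hcross : ∑ u ∈ F, ∑ v ∈ F', ∑ a ∈ ball n u, ∑ b ∈ ball n v, edgeEnergy ω f a b
      ≤ ((N : ℝ) ^ n) ^ 2 * E := by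
    rw [← sum_sum_edgeEnergy_ball hnk x]
    have h0 : ∀ u v, 0 ≤ ∑ a ∈ ball n u, ∑ b ∈ ball n v, edgeEnergy ω f a b := fun u v =>
      Finset.sum_nonneg fun _ _ => Finset.sum_nonneg fun _ _ => edgeEnergy_nonneg _ _
    refine (Finset.sum_le_sum fun u _ => Finset.sum_le_sum_of_subset_of_nonneg hFB'
      fun v _ _ => h0 u v).trans ?_
    exact Finset.sum_le_sum_of_subset_of_nonneg hFB fun u _ _ =>
      Finset.sum_nonneg fun v _ => h0 u v
  have htot : ∑ u ∈ F, ∑ v ∈ F', (f u - f v) ^ 2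
      ≤ 3 * (F'.card * (D * ((N : ℝ) ^ n * E)) + ((N : ℝ) ^ n) ^ 2 * E
        + F.card * (D * ((N : ℝ) ^ n * E))) := by
    have h1 := mul_le_mul_of_nonneg_left (mul_le_mul_of_nonneg_left (hsumE F hFB)
      (zero_le_one.trans hD1)) (Nat.cast_nonneg (α := ℝ) F'.card)
    have h2 := mul_le_mul_of_nonneg_left (mul_le_mul_of_nonneg_left (hsumE F' hFB')
      (zero_le_one.trans hD1)) (Nat.cast_nonneg (α := ℝ) F.card)
    have h3 : ∑ u ∈ F, ∑ v ∈ F', 3 * (D * energy ω f (ball n u)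
        + (∑ a ∈ ball n u, ∑ b ∈ ball n v, edgeEnergy ω f a b) + D * energy ω f (ball n v))
        = 3 * (F'.card * (D * ∑ u ∈ F, energy ω f (ball n u))
          + (∑ u ∈ F, ∑ v ∈ F', ∑ a ∈ ball n u, ∑ b ∈ ball n v, edgeEnergy ω f a b)
          + F.card * (D * ∑ v ∈ F', energy ω f (ball n v))) := by
      simp only [← Finset.mul_sum, Finset.sum_add_distrib, Finset.sum_const, nsmul_eq_mul]
      ring
    refine (Finset.sum_le_sum fun u hu => Finset.sum_le_sum fun v hv => hpair u hu v hv).trans ?_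
    rw [h3]
    linarith
  set K := r / 2 * (N : ℝ) ^ l (i + 2) with hK
  have hKpos : 0 < K := by positivity
  have hNK : (N : ℝ) ^ n ≤ K := by linarith [hgap i]
  have hx1 : 0 < (F.card : ℝ) := hKpos.trans_le hFc
  have hx2 : 0 < (F'.card : ℝ) := hKpos.trans_le hFc'
  refine (sq_mean_sub_mean_le (farCore_nonempty hl hbc hgap (h _))
    (farCore_nonempty hl hbc hgap (h _))).trans ?_
  have hrhs : 108 * ((N : ℝ) ^ l 0) ^ 2 / r * (6 ^ i * (N : ℝ) ^ n / (N : ℝ) ^ l (i + 2)) * E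
      = 9 * D * E * ((N : ℝ) ^ n / K) := by
    rw [hD, hK]
    field_simp
    ring
  have ht : 0 < (N : ℝ) ^ n := by positivity
  rw [hrhs, div_le_iff₀ (mul_pos hx1 hx2)]
  exact htot.trans (mul_card_add_le ht hNK hD1 hE0 hFc hFc')

include hl hmono hbs hbc hgap in
/-- A point whose cores at all scales are nonempty has finite resistance to infinity. -/
theorem finiteResistance_of_core_nonempty (hlim : ∀ n, ∃ i, n ≤ l i)
    (hsum : Summable fun i => √(6 ^ i * (N : ℝ) ^ l (i + 1) / (N : ℝ) ^ l (i + 2)))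
    {x : HierGroup N} (h : ∀ j, (core base l r j x ω).Nonempty) :
    FiniteResistance (percGraph ω) x := by
  have hN : 0 < N := NeZero.pos N
  have hr := pos_of_gap hgap
  have hb : ∀ x ω, base x ω ⊆ ball (l 0) x := fun x ω =>
    (hbs x ω).trans (cluster_subset_ball _ _ _)
  set C := 108 * ((N : ℝ) ^ l 0) ^ 2 / r with hC
  have hC0 : 0 ≤ C := by positivity
  set D := ((N : ℝ) ^ l 0) ^ 2 * 6 ^ 2 with hD
  have hD0 : 0 ≤ D := by positivity
  set τ := ∑' i, √(6 ^ i * (N : ℝ) ^ l (i + 1) / (N : ℝ) ^ l (i + 2)) with hτ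
  refine ⟨(√D + √C * τ) ^ 2, fun f hf => ?_⟩
  obtain ⟨R, hR⟩ : ∃ R, ∀ y, R < hdist x y → f y = 0 := by
    refine ⟨hf.toFinset.sup fun y => hdist x y, fun y hy => ?_⟩
    by_contra hc
    exact absurd (Finset.le_sup (f := fun y => hdist x y) (hf.mem_toFinset.2 hc)) (not_le.2 hy)
  obtain ⟨k, hk⟩ := hlim R
  -- The means over the far cores form a chain from `f x` to `0`, because the far core at scale `k`
  -- lies outside the support. Roots of resistances obey the triangle inequality, so it is their sum
  -- that must be finite.
  set m : ℕ → ℝ := fun i => mean f (farCore base l r i x ω) with hm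
  refine ⟨ball (l (k + 2)) x, ?_⟩
  change f x ^ 2 ≤ (√D + √C * τ) ^ 2 * energy ω f (ball (l (k + 2)) x)
  set E := energy ω f (ball (l (k + 2)) x) with hE
  have hE0 : 0 ≤ E := energy_nonneg _
  have hmk : m k = 0 := by
    simp only [hm, mean]
    rw [Finset.sum_eq_zero, zero_div]
    intro u hu
    refine hR u (hk.trans_lt ?_)
    have := (Finset.mem_sdiff.1 hu).2
    rw [mem_ball, not_le] at this
    exact (hmono (Nat.le_succ k)).trans_lt this
  have hstart : |f x - m 0| ≤ √D * √E := by
    have hF : (0 : ℝ) < (farCore base l r 0 x ω).card := by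
      exact_mod_cast (farCore_nonempty hl hbc hgap (h _)).card_pos
    have h1 : f x - m 0 = (∑ u ∈ farCore base l r 0 x ω, (f x - f u))
        / (farCore base l r 0 x ω).card := by
      simp only [hm, mean, Finset.sum_sub_distrib, Finset.sum_const, nsmul_eq_mul]
      field_simp
    rw [h1, abs_div, abs_of_pos hF, div_le_iff₀ hF]
    refine (Finset.abs_sum_le_sum_abs _ _).trans ?_
    calc ∑ u ∈ farCore base l r 0 x ω, |f x - f u|
        ≤ ∑ u ∈ farCore base l r 0 x ω, √D * √E := by
          refine Finset.sum_le_sum fun u hu => ?_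
          rw [← Real.sqrt_mul hD0, ← Real.sqrt_sq_eq_abs]
          refine Real.sqrt_le_sqrt ((sq_sub_le_of_mem_core hl hmono hbs hbc hgap
            (Finset.mem_sdiff.1 hu).1).trans ?_)
          refine mul_le_mul_of_nonneg_left (energy_mono ?_) hD0
          exact ball_subset_ball (hmono (by omega)) x
      _ = _ := by rw [Finset.sum_const, nsmul_eq_mul, mul_comm]
  have hstep : ∀ i < k, |m i - m (i + 1)|
      ≤ √C * √(6 ^ i * (N : ℝ) ^ l (i + 1) / (N : ℝ) ^ l (i + 2)) * √E := by
    intro i hi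
    rw [← Real.sqrt_mul hC0, ← Real.sqrt_mul (by positivity), ← Real.sqrt_sq_eq_abs]
    refine Real.sqrt_le_sqrt ((sq_mean_farCore_sub_le hl hmono hbs hbc hgap h).trans ?_)
    refine mul_le_mul_of_nonneg_left (energy_mono ?_) (by positivity)
    exact ball_subset_ball (hmono (by omega)) x
  have htel : ∀ j ≤ k, |m 0 - m j| ≤ ∑ i ∈ Finset.range j,
      √C * √(6 ^ i * (N : ℝ) ^ l (i + 1) / (N : ℝ) ^ l (i + 2)) * √E := by
    intro j
    induction j with
    | zero => simp
    | succ j ih =>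
      intro hj
      rw [Finset.sum_range_succ]
      have h1 := abs_sub_le (m 0) (m j) (m (j + 1))
      linarith [ih (by omega), hstep j (by omega)]
  have hfin : |f x| ≤ (√D + √C * τ) * √E := by
    have h1 := htel k le_rfl
    rw [hmk, ← Finset.sum_mul, ← Finset.mul_sum] at h1
    have h2 : ∑ i ∈ Finset.range k, √(6 ^ i * (N : ℝ) ^ l (i + 1) / (N : ℝ) ^ l (i + 2)) ≤ τ :=
      hsum.sum_le_tsum _ fun _ _ => Real.sqrt_nonneg _
    have h3 : √C * (∑ i ∈ Finset.range k, √(6 ^ i * (N : ℝ) ^ l (i + 1) / (N : ℝ) ^ l (i + 2))) * √E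
        ≤ √C * τ * √E := by gcongr
    have h4 := abs_sub_le (f x) (m 0) 0
    simp only [sub_zero] at h4 h1
    linarith
  calc f x ^ 2 = |f x| ^ 2 := (sq_abs _).symm
    _ ≤ ((√D + √C * τ) * √E) ^ 2 := pow_le_pow_left₀ (abs_nonneg _) hfin 2
    _ = _ := by rw [mul_pow, Real.sq_sqrt hE0]

end energy

/-! ### Choice of the scales. -/

section scales

/-- Slowly growing scales: from the second step on, the radius grows by the factor `1 + 1 / K`. -/
def scale (K L : ℕ) : ℕ → ℕ
  | 0 => L
  | 1 => L
  | i + 2 => scale K L (i + 1) + scale K L (i + 1) / K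

theorem scale_le_succ (K L : ℕ) : ∀ i, scale K L i ≤ scale K L (i + 1)
  | 0 => le_rfl
  | _ + 1 => Nat.le_add_right _ _

theorem monotone_scale (K L : ℕ) : Monotone (scale K L) :=
  monotone_nat_of_le_succ (scale_le_succ K L)

/-- Linear growth is preserved: the increment, a `K`-th part, is at least `a * (K + i)`, and `a * K`
suffices. -/
theorem le_scale_succ {K L a : ℕ} (hK : 0 < K) (hL : K * (K * a) ≤ L) (i : ℕ) :
    K * (a * (K + i)) ≤ scale K L (i + 1) := by
  induction i with
  | zero => simpa [scale, mul_comm a K] using hL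
  | succ i ih =>
    have h1 : a * (K + i) ≤ scale K L (i + 1) / K := (Nat.le_div_iff_mul_le hK).2 (by linarith)
    have h2 : a * K ≤ a * (K + i) := Nat.mul_le_mul_left a (Nat.le_add_right _ _)
    calc K * (a * (K + (i + 1))) = K * (a * (K + i)) + a * K := by ring
      _ ≤ scale K L (i + 1) + scale K L (i + 1) / K := by omega

theorem le_scale_div {K L a : ℕ} (hK : 0 < K) (hL : K * (K * a) ≤ L) (i : ℕ) :
    a * (i + 1) ≤ scale K L (i + 1) / K := by
  rw [Nat.le_div_iff_mul_le hK]
  refine le_trans ?_ (le_scale_succ hK hL i)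
  rw [mul_comm]
  exact Nat.mul_le_mul_left K (Nat.mul_le_mul_left a (by omega))

theorem le_scale {K L a : ℕ} (hK : 2 ≤ K) (hL : K * (K * a) ≤ L) : ∀ i,
    a * (i + 1) ≤ scale K L i
  | 0 => by
    refine le_trans ?_ hL
    rw [zero_add, mul_one]
    exact (Nat.le_mul_of_pos_left a (by omega)).trans (Nat.le_mul_of_pos_left _ (by omega))
  | i + 1 => by
    refine le_trans ?_ (le_scale_succ (by omega) hL i)
    refine le_trans ?_ (Nat.le_mul_of_pos_left _ (by omega))
    exact Nat.mul_le_mul_left a (by omega)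

/-- From `(1 + 1 / K) ^ 2 ≤ 1 + 3 / K`. Two steps matter because links at scale `i + 2` use cores at
scale `i`. -/
theorem scale_add_two_le {K L : ℕ} (hK : 0 < K) (i : ℕ) :
    (scale K L (i + 2) : ℝ) ≤ (1 + 3 / K) * scale K L i := by
  have hK1 : (1 : ℝ) ≤ K := by exact_mod_cast hK
  have hstep : ∀ i, (scale K L (i + 1) : ℝ) ≤ (1 + 1 / K) * scale K L i := by
    intro i
    cases i with
    | zero =>
      have : (0 : ℝ) ≤ 1 / K * L := by positivity
      simp only [scale]
      linarith
    | succ i =>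
      simp only [scale]
      have : ((scale K L (i + 1) / K : ℕ) : ℝ) ≤ scale K L (i + 1) / K := Nat.cast_div_le
      push_cast
      calc _ ≤ (scale K L (i + 1) : ℝ) + scale K L (i + 1) / K := by linarith
        _ = _ := by ring
  have h1 := hstep (i + 1)
  have h2 := mul_le_mul_of_nonneg_left (hstep i) (show (0 : ℝ) ≤ 1 + 1 / K by positivity)
  refine h1.trans (h2.trans ?_)
  rw [← mul_assoc]
  refine mul_le_mul_of_nonneg_right ?_ (Nat.cast_nonneg _)
  have h3 : (1 : ℝ) / K ≤ 1 := by rw [div_le_one (by linarith)]; exact hK1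
  have h4 : (0 : ℝ) ≤ 1 / K := by positivity
  have h5 : (3 : ℝ) / K = 3 * (1 / K) := by ring
  rw [h5]
  nlinarith

/-- Of the exponent `9`, a part `8` absorbs the number of pairs in the union bound and `1` yields
decay in the scale. -/
theorem exists_rpow_mul_exp_le {C θ : ℝ} (hC : 0 < C) (hθ : 0 < θ) :
    ∃ Y : ℝ, ∀ y, Y ≤ y → y ^ (9 : ℕ) * Real.exp (-(C * y ^ θ)) ≤ 1 := by
  have h1 := (tendsto_rpow_mul_exp_neg_mul_atTop_nhds_zero (9 / θ) C hC).comp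
    (tendsto_rpow_atTop hθ)
  have h2 := (h1.eventually (gt_mem_nhds zero_lt_one)).and (Filter.eventually_ge_atTop 0)
  obtain ⟨Y, hY⟩ := Filter.eventually_atTop.1 h2
  refine ⟨Y, fun y hy => ?_⟩
  obtain ⟨h3, h4⟩ := hY y hy
  refine le_trans (le_of_eq ?_) h3.le
  simp only [Function.comp]
  rw [← Real.rpow_mul h4, mul_div_cancel₀ _ hθ.ne', neg_mul]
  norm_cast

/-- Scales along which cores survive with positive probability, and along which the resistance to
infinity of surviving cores is finite. -/
theorem exists_scales {N : ℕ} (hN : 2 ≤ N) {δ c₀ q : ℝ} (hδ0 : 0 < δ) (hδ1 : δ < 1) (hc : 0 < c₀)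
    (hq : 0 < q) : ∃ L₀ : ℕ, ∀ L, L₀ ≤ L → ∃ l : ℕ → ℕ, l 0 = L ∧ l 1 = l 0 ∧ Monotone l ∧
      (∀ n, ∃ i, n ≤ l i) ∧ (∀ i, 2 * (N : ℝ) ^ l (i + 1) ≤ q / 2 * (N : ℝ) ^ l (i + 2)) ∧
      (Summable fun i => √(6 ^ i * (N : ℝ) ^ l (i + 1) / (N : ℝ) ^ l (i + 2))) ∧
      ∃ β : ℕ → ℝ, (∀ i, 4 * (N : ℝ) ^ l (i + 1) / (q ^ 2 * (N : ℝ) ^ l (i + 2))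
        + ((N : ℝ) ^ l (i + 2)) ^ 2 * Real.exp (-(c₀ / (N : ℝ) ^ ((1 + δ) * (l (i + 2) : ℝ))
          * (q / 2 * (N : ℝ) ^ l i) ^ 2)) ≤ β i) ∧ ∀ n, ∑ i ∈ Finset.range n, β i ≤ q := by
  have hN2 : (2 : ℝ) ≤ N := by exact_mod_cast hN
  have hN0 : (0 : ℝ) < N := by linarith
  have hN1 : (1 : ℝ) ≤ N := by linarith
  -- Large enough for `(1 + δ) * (1 + 3 / K) ≤ 2 - θ`, so that the pairs between two cores outweigh
  -- the inverse connection probability by the power `θ`.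
  obtain ⟨K, hK⟩ := exists_nat_ge (12 / (1 - δ) + 3)
  have hδ : 0 < 1 - δ := by linarith
  have h12 : 0 < 12 / (1 - δ) := by positivity
  have hK3 : 3 ≤ K := by
    have : (3 : ℝ) ≤ K := by linarith
    exact_mod_cast this
  have hK0 : (0 : ℝ) < K := by linarith
  have hKδ : 12 ≤ K * (1 - δ) := by
    have : 12 / (1 - δ) ≤ K := by linarith
    rwa [div_le_iff₀ hδ] at this
  set θ := (1 - δ) / 2 with hθ
  have hθ0 : 0 < θ := by positivity
  obtain ⟨Y, hY⟩ := exists_rpow_mul_exp_le (C := c₀ * (q / 2) ^ 2) (by positivity) hθ0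
  have hx : Filter.Tendsto (fun a : ℕ => (2 : ℝ) ^ a) Filter.atTop Filter.atTop :=
    tendsto_pow_atTop_atTop_of_one_lt (by norm_num)
  -- The terms bounding `2 ^ a` from below serve the resistance series (`8`, for `6 * x ≤ 3 / 4`),
  -- the gap condition (`4 / q`) and the sum of the `β i`.
  obtain ⟨a, ha⟩ := ((hx.eventually_ge_atTop Y).and
    (hx.eventually_ge_atTop (8 + 4 / q + 2 * (4 / q ^ 2 + 1) / q))).exists
  obtain ⟨haY, haq⟩ := ha
  have hq1 : 0 < 4 / q := by positivity
  have hq2 : 0 < 2 * (4 / q ^ 2 + 1) / q := by positivity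
  set x : ℝ := 1 / 2 ^ a with hxdef
  have hx0 : 0 < x := by positivity
  have hx8 : x ≤ 1 / 8 := one_div_le_one_div_of_le (by norm_num) (by linarith)
  have hxq : 2 * (4 / q ^ 2 + 1) * x ≤ q := by
    have : 2 * (4 / q ^ 2 + 1) / q ≤ 2 ^ a := by linarith
    rw [div_le_iff₀ hq] at this
    rw [hxdef, mul_one_div, div_le_iff₀ (by positivity)]
    linarith
  refine ⟨K * (K * a), fun L hL => ?_⟩
  have hdiv : ∀ i, (N : ℝ) ^ scale K L (i + 1) / (N : ℝ) ^ scale K L (i + 2) ≤ x ^ (i + 1) := by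
    intro i
    have h1 := le_scale_div (by omega) hL i
    change (N : ℝ) ^ scale K L (i + 1) / (N : ℝ) ^ (scale K L (i + 1) + scale K L (i + 1) / K) ≤ _
    rw [pow_add, div_mul_cancel_left₀ (by positivity), hxdef, one_div, inv_pow, ← pow_mul]
    refine inv_anti₀ (by positivity) ?_
    exact (pow_le_pow_right₀ (by norm_num) h1).trans (pow_le_pow_left₀ (by norm_num) hN2 _)
  have hinv : ∀ i, 1 / (N : ℝ) ^ scale K L i ≤ x ^ (i + 1) := by
    intro i
    rw [hxdef, one_div, one_div, inv_pow, ← pow_mul]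
    refine inv_anti₀ (by positivity) ?_
    exact (pow_le_pow_right₀ (by norm_num) (le_scale (by omega) hL i)).trans
      (pow_le_pow_left₀ (by norm_num) hN2 _)
  have hxpow : ∀ i, x ^ (i + 1) ≤ x := fun i => by
    simpa using pow_le_pow_of_le_one hx0.le (by linarith) (Nat.le_add_left 1 i)
  refine ⟨scale K L, rfl, rfl, monotone_scale K L, fun n => ⟨n, ?_⟩, fun i => ?_, ?_,
    fun i => (4 / q ^ 2 + 1) * x ^ (i + 1), fun i => ?_, fun n => ?_⟩
  · have ha0 : 0 < a := by
      rcases Nat.eq_zero_or_pos a with rfl | h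
      · norm_num at haq
        linarith
      · exact h
    have := le_scale (by omega) hL n
    nlinarith
  · have h1 := (hdiv i).trans (hxpow i)
    rw [div_le_iff₀ (by positivity)] at h1
    have h2 : 4 / q * x ≤ 1 := by
      rw [hxdef, mul_one_div, div_le_one (by positivity)]
      linarith
    have h3 : 2 * x ≤ q / 2 := by
      rw [div_mul_eq_mul_div, div_le_one hq] at h2
      linarith
    calc 2 * (N : ℝ) ^ scale K L (i + 1) ≤ 2 * (x * (N : ℝ) ^ scale K L (i + 2)) := by gcongr
      _ = (2 * x) * (N : ℝ) ^ scale K L (i + 2) := by ring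
      _ ≤ _ := by gcongr
  · refine Summable.of_nonneg_of_le (fun _ => Real.sqrt_nonneg _) (fun i => ?_)
      (summable_geometric_of_lt_one (Real.sqrt_nonneg (3 / 4)) (by
        rw [Real.sqrt_lt' one_pos]; norm_num))
    refine Real.sqrt_le_iff.2 ⟨by positivity, ?_⟩
    rw [← pow_mul, mul_comm i 2, pow_mul, Real.sq_sqrt (by norm_num), mul_div_assoc]
    calc 6 ^ i * ((N : ℝ) ^ scale K L (i + 1) / (N : ℝ) ^ scale K L (i + 2))
        ≤ 6 ^ i * x ^ (i + 1) := by gcongr; exact hdiv i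
      _ = (6 * x) ^ i * x := by rw [mul_pow]; ring
      _ ≤ (3 / 4) ^ i * 1 := by
          gcongr <;> linarith
      _ = _ := mul_one _
  · have h1 : 4 * (N : ℝ) ^ scale K L (i + 1) / (q ^ 2 * (N : ℝ) ^ scale K L (i + 2))
        ≤ 4 / q ^ 2 * x ^ (i + 1) := by
      rw [mul_div_mul_comm]
      gcongr
      exact hdiv i
    set y := (N : ℝ) ^ scale K L i with hy
    have hy0 : 0 < y := by positivity
    have hyY : Y ≤ y := by
      refine haY.trans ?_
      have h2 := le_scale (by omega) hL i
      calc (2 : ℝ) ^ a ≤ 2 ^ scale K L i := by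
            refine pow_le_pow_right₀ (by norm_num) (le_trans ?_ h2)
            exact Nat.le_mul_of_pos_right a (by omega)
        _ ≤ _ := pow_le_pow_left₀ (by norm_num) hN2 _
    have hl2 := scale_add_two_le (L := L) (show 0 < K by omega) i
    have h3K : (3 : ℝ) / K ≤ (1 - δ) / 4 := by
      rw [div_le_div_iff₀ hK0 (by norm_num)]
      linarith
    have hs0 : (0 : ℝ) ≤ scale K L i := Nat.cast_nonneg _
    have hA : ((N : ℝ) ^ scale K L (i + 2)) ^ 2 ≤ y ^ 8 := by
      rw [hy, ← pow_mul, ← pow_mul]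
      refine pow_le_pow_right₀ hN1 ?_
      have : (scale K L (i + 2) : ℝ) ≤ 4 * scale K L i := by
        refine hl2.trans (mul_le_mul_of_nonneg_right ?_ hs0)
        linarith
      have : scale K L (i + 2) ≤ 4 * scale K L i := by exact_mod_cast this
      omega
    have hB : c₀ * (q / 2) ^ 2 * y ^ θ ≤ c₀ / (N : ℝ) ^ ((1 + δ) * (scale K L (i + 2) : ℝ))
        * (q / 2 * y) ^ 2 := by
      have h4 : y ^ θ * (N : ℝ) ^ ((1 + δ) * (scale K L (i + 2) : ℝ)) ≤ y ^ 2 := by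
        have e1 : y ^ θ = (N : ℝ) ^ ((scale K L i : ℝ) * θ) := by
          rw [hy, ← Real.rpow_natCast, ← Real.rpow_mul hN0.le]
        have e2 : y ^ 2 = (N : ℝ) ^ ((scale K L i : ℝ) * 2) := by
          rw [hy, ← pow_mul, ← Real.rpow_natCast]
          push_cast
          rfl
        rw [e1, e2, ← Real.rpow_add hN0]
        refine Real.rpow_le_rpow_of_exponent_le hN1 ?_
        have h5 := mul_le_mul_of_nonneg_left hl2 (show 0 ≤ 1 + δ by linarith)
        have h6 : (1 + δ) * (1 + 3 / K) ≤ 2 - θ := by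
          have : (1 + δ) * (3 / K) ≤ 2 * ((1 - δ) / 4) := by
            refine mul_le_mul (by linarith) h3K (by positivity) (by norm_num)
          rw [hθ]
          linarith
        have h7 := mul_le_mul_of_nonneg_right h6 hs0
        linarith
      have hpos : 0 < (N : ℝ) ^ ((1 + δ) * (scale K L (i + 2) : ℝ)) := Real.rpow_pos_of_pos hN0 _
      rw [div_mul_eq_mul_div, le_div_iff₀ hpos]
      calc _ = c₀ * (q / 2) ^ 2 * (y ^ θ * (N : ℝ) ^ ((1 + δ) * (scale K L (i + 2) : ℝ))) := by ring
        _ ≤ c₀ * (q / 2) ^ 2 * y ^ 2 := by gcongr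
        _ = _ := by ring
    have h2 : ((N : ℝ) ^ scale K L (i + 2)) ^ 2 * Real.exp
        (-(c₀ / (N : ℝ) ^ ((1 + δ) * (scale K L (i + 2) : ℝ)) * (q / 2 * y) ^ 2))
        ≤ x ^ (i + 1) := by
      refine le_trans ?_ (hinv i)
      rw [← hy, le_div_iff₀ hy0]
      calc _ ≤ y ^ 8 * Real.exp (-(c₀ * (q / 2) ^ 2 * y ^ θ)) * y := by
            gcongr
        _ = y ^ 9 * Real.exp (-(c₀ * (q / 2) ^ 2 * y ^ θ)) := by ring
        _ ≤ 1 := hY y hyY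
    calc _ ≤ 4 / q ^ 2 * x ^ (i + 1) + x ^ (i + 1) := add_le_add h1 h2
      _ = _ := by ring
  · rw [← Finset.mul_sum]
    have h1 : ∑ i ∈ Finset.range n, x ^ (i + 1) ≤ 2 * x := by
      simp only [pow_succ, ← Finset.sum_mul]
      refine mul_le_mul_of_nonneg_right ?_ hx0.le
      have h2 : ∑ i ∈ Finset.range n, x ^ i ≤ ∑' i, x ^ i :=
        (summable_geometric_of_lt_one hx0.le (by linarith)).sum_le_tsum _
          fun i _ => by positivity
      rw [tsum_geometric_of_lt_one hx0.le (by linarith)] at h2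
      refine h2.trans ?_
      rw [inv_le_comm₀ (by linarith) (by norm_num)]
      linarith
    calc (4 / q ^ 2 + 1) * ∑ i ∈ Finset.range n, x ^ (i + 1) ≤ (4 / q ^ 2 + 1) * (2 * x) := by
          gcongr
      _ ≤ q := by linarith

end scales

/-! ### Local finiteness. -/

section degree

variable {N : ℕ} {p : ℕ → unitInterval}

theorem law_open (p : ℕ → unitInterval) (e : Sym2 (HierGroup N)) :
    (law N p).real {ω | ω e = true} = p (lev e) := by
  have hm : MeasurableSet {ω : Cfg N | ω e = false} :=
    (MeasurableSet.of_discrete (s := ({false} : Set Bool))).preimage (measurable_pi_apply e)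
  have h1 : {ω : Cfg N | ω e = true} = {ω | ω e = false}ᶜ := by
    ext ω
    simp
  have h2 := law_all_closed p {e}
  simp only [Finset.mem_singleton, forall_eq, Finset.prod_singleton] at h2
  rw [h1, probReal_compl_eq_one_sub hm, h2]
  ring

theorem shift_zero (ω : Cfg N) : shift 0 ω = ω := by
  funext e
  induction e with
  | _ x y => simp

variable [NeZero N]

/-- Borel–Cantelli, as the expected degree is finite. The summand `1` in the bound accounts for the
degenerate pair `y = x`. -/
theorem ae_finite_neighborSet (hp : Summable (wt N p)) :
    ∀ᵐ ω ∂(law N p), ∀ x, ((percGraph ω).neighborSet x).Finite := by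
  have : Countable (HierGroup N) := inferInstance
  rw [ae_all_iff]
  intro x
  have hsum : ∑' y, law N p {ω | ω s(x, y) = true} ≠ ⊤ := by
    refine ne_top_of_le_ne_top (b := ENNReal.ofReal (1 + N * tailWt N p 0)) ENNReal.ofReal_ne_top ?_
    refine ENNReal.summable.tsum_le_of_sum_le fun F => ?_
    have hprob : ∀ y, law N p {ω | ω s(x, y) = true} = ENNReal.ofReal (p (hdist x y)) := fun y => by
      rw [← ofReal_measureReal, law_open, lev_mk]
    simp only [hprob]
    rw [← ENNReal.ofReal_sum_of_nonneg fun y _ => (p _).2.1]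
    refine ENNReal.ofReal_le_ofReal ?_
    set m := F.sup fun y => hdist x y with hm
    have hF : F ⊆ ball m x := fun y hy =>
      mem_ball.2 (Finset.le_sup (f := fun y => hdist x y) hy)
    have h1 : ∑ y ∈ F, (p (hdist x y) : ℝ) ≤ ∑ y ∈ ball m x, (p (hdist x y) : ℝ) :=
      Finset.sum_le_sum_of_subset_of_nonneg hF fun y _ _ => (p _).2.1
    have h2 := Finset.sum_sdiff (f := fun y => (p (hdist x y) : ℝ))
      (ball_subset_ball (Nat.zero_le m) x)
    have h3 : ∑ y ∈ ball 0 x, (p (hdist x y) : ℝ) ≤ 1 := by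
      calc ∑ y ∈ ball 0 x, (p (hdist x y) : ℝ) ≤ ∑ y ∈ ball 0 x, (1 : ℝ) :=
            Finset.sum_le_sum fun y _ => (p _).2.2
        _ = 1 := by simp [card_ball]
    have h4 := sum_connection_le (p := p) x (Nat.zero_le m)
    have h5 := mul_le_mul_of_nonneg_left (sum_wt_le_tailWt hp 0 m) (Nat.cast_nonneg (α := ℝ) N)
    linarith
  filter_upwards [ae_finite_setOfPred_mem hsum] with ω hω
  exact hω.subset fun y hy => hy.2

end degree

/-! ### The contradiction argument. -/

section main

variable {N : ℕ} [NeZero N] {p : ℕ → unitInterval}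

theorem exists_subset_pairsIn_ball (x : HierGroup N) (F : Finset (Sym2 (HierGroup N))) :
    ∃ n, (F : Set (Sym2 (HierGroup N))) ⊆ pairsIn (ball n x : Set (HierGroup N)) := by
  have h : ∀ e : Sym2 (HierGroup N), ∃ n, e ∈ pairsIn (ball n x : Set (HierGroup N)) := by
    intro e
    induction e with
    | _ y z => exact ⟨max (hdist x y) (hdist x z), mem_pairsIn.2
        ⟨mem_ball.2 (le_max_left _ _), mem_ball.2 (le_max_right _ _)⟩⟩
  choose n hn using h
  refine ⟨F.sup n, fun e he => pairsIn_mono ?_ (hn e)⟩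
  exact ball_subset_ball (Finset.le_sup (f := n) he) x

theorem mem_of_markedSize_pos {x₀ : HierGroup N} {G : Set (Cfg N)} {n : ℕ} {ω : Cfg N}
    (h : 0 < markedSize x₀ G n x₀ ω) : ω ∈ G := by
  unfold markedSize at h
  rw [sub_self, shift_zero] at h
  by_contra hc
  simp [hc] at h

/-- If the mark nearly decides whether the cluster is infinite, then marked clusters in large balls
are large compared to the inverse tail weight. -/
theorem le_law_markedSize_tail (hp : Summable (wt N p)) {x₀ : HierGroup N} {G Bad : Set (Cfg N)}
    {n₀ : ℕ} (hG : DependsOn (fun ω => ω ∈ G) (pairsIn (ball n₀ x₀ : Set (HierGroup N)))) {n : ℕ}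
    (hn : n₀ ≤ n) (hhalf : ∀ k, n < k → (p k : ℝ) ≤ 1 / 2) (hτ : 0 < tailWt N p n) {ρ M : ℝ}
    (hlawG : 3 * ρ ≤ (law N p).real G)
    (hBad : ∀ s, MeasurableSet s → s ⊆ G →
      (∀ ω ∈ s, ω ∈ Bad → False) → (law N p).real s ≤ Real.exp (-(2 * N * M)) * ρ)
    (hinf : ∀ ω ∈ Bad, ((percGraph ω).connectedComponentMk x₀).supp.Infinite) :
    2 * ρ ≤ (law N p).real {ω | M / tailWt N p n ≤ markedSize x₀ G n x₀ ω} := by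
  -- Marked but small clusters. With conditional probability at least `exp (-2 N M)` they have no
  -- exit and are finite, hence outside `Bad`; `hBad` bounds that event and so the probability of
  -- `E`.
  set E := {ω | ω ∈ G ∧ (cluster n x₀ ω).card * tailWt N p n ≤ M} with hE
  have hEdep : DependsOn (fun ω => ω ∈ E) (pairsIn (ball n x₀ : Set (HierGroup N))) := by
    intro ω ω' h
    have h1 := hG fun e he => h e (pairsIn_mono (ball_subset_ball hn x₀) he)
    simp only at h1
    simp only [hE, Set.mem_ofPred_eq, h1]
    rw [dependsOn_cluster n x₀ h]
  have hEm : MeasurableSet E :=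
    measurableSet_of_dependsOn_finite (pairsIn_finite (ball n x₀).finite_toSet) hEdep
  have h1 := mul_le_law_noExit hp hhalf x₀ hEdep fun ω hω => hω.2
  have h2 := hBad (E ∩ {ω | NoExit n x₀ ω}) (hEm.inter (measurableSet_noExit n x₀))
    (fun ω hω => hω.1.1) fun ω hω hb => hinf ω hb hω.2.supp_finite
  have h3 : (law N p).real E ≤ ρ := le_of_mul_le_mul_left (h1.trans h2) (Real.exp_pos _)
  have hsub : G ⊆ E ∪ {ω | M / tailWt N p n ≤ markedSize x₀ G n x₀ ω} := by
    intro ω hω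
    by_cases hc : (cluster n x₀ ω).card * tailWt N p n ≤ M
    · exact Or.inl ⟨hω, hc⟩
    · right
      change M / tailWt N p n ≤ markedSize x₀ G n x₀ ω
      unfold markedSize
      rw [sub_self, shift_zero, if_pos hω, div_le_iff₀ hτ]
      exact (not_le.1 hc).le
  have h4 := measureReal_mono (μ := law N p) hsub (measure_ne_top _ _)
  have h5 := measureReal_union_le (μ := law N p) E
    {ω | M / tailWt N p n ≤ markedSize x₀ G n x₀ ω}
  linarith

/-- If marked clusters are dense in balls of some large radius with positive probability, then with
positive probability the mark holds and the resistance to infinity is finite. -/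
theorem exists_law_finiteResistance {x₀ : HierGroup N} {G : Set (Cfg N)} {n₀ : ℕ}
    (hG : DependsOn (fun ω => ω ∈ G) (pairsIn (ball n₀ x₀ : Set (HierGroup N))))
    {δ c₀ q : ℝ} (hc : 0 < c₀) (hδ0 : 0 < δ)
    (hlow : ∀ k : ℕ, 1 ≤ k → c₀ / (N : ℝ) ^ ((1 + δ) * (k : ℝ)) ≤ p k) (hq : 0 < q)
    {l : ℕ → ℕ} (hl0 : n₀ ≤ l 0) (hl : l 1 = l 0) (hmono : Monotone l) (hlim : ∀ n, ∃ i, n ≤ l i)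
    (hgap : ∀ i, 2 * (N : ℝ) ^ l (i + 1) ≤ q / 2 * (N : ℝ) ^ l (i + 2))
    (hsum : Summable fun i => √(6 ^ i * (N : ℝ) ^ l (i + 1) / (N : ℝ) ^ l (i + 2))) {β : ℕ → ℝ}
    (hβ : ∀ i, 4 * (N : ℝ) ^ l (i + 1) / (q ^ 2 * (N : ℝ) ^ l (i + 2))
        + ((N : ℝ) ^ l (i + 2)) ^ 2 * Real.exp (-(c₀ / (N : ℝ) ^ ((1 + δ) * (l (i + 2) : ℝ))
          * (q / 2 * (N : ℝ) ^ l i) ^ 2)) ≤ β i) (hβsum : ∀ n, ∑ i ∈ Finset.range n, β i ≤ q)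
    (hdense : 2 * q ≤ (law N p).real
      {ω | q / 2 * (N : ℝ) ^ l 0 ≤ markedSize x₀ G (l 0) x₀ ω}) :
    ∃ T : Set (Cfg N), MeasurableSet T ∧ q ≤ (law N p).real T ∧ T ⊆ G ∧
      ∀ ω ∈ T, FiniteResistance (percGraph ω) x₀ := by
  classical
  have hN : 0 < N := NeZero.pos N
  have hN1 : (1 : ℝ) ≤ N := by exact_mod_cast hN
  -- A base core is a whole cluster, kept only if it is marked and dense; so survival at `x₀`
  -- entails the mark.
  set base : HierGroup N → Cfg N → Finset (HierGroup N) := fun x ω =>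
    if q / 2 * (N : ℝ) ^ l 0 ≤ markedSize x₀ G (l 0) x ω then cluster (l 0) x ω else ∅ with hbase
  have hne : ∀ x ω, (base x ω).Nonempty ↔ q / 2 * (N : ℝ) ^ l 0 ≤ markedSize x₀ G (l 0) x ω := by
    intro x ω
    simp only [hbase]
    split_ifs with h
    · exact iff_of_true ⟨x, self_mem_cluster _ x ω⟩ h
    · simp [h]
  have hbs : ∀ x ω, base x ω ⊆ cluster (l 0) x ω := by
    intro x ω
    simp only [hbase]
    split_ifs
    · rfl
    · exact Finset.empty_subset _
  have hbb : ∀ x ω, base x ω ⊆ ball (l 0) x := fun x ω =>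
    (hbs x ω).trans (cluster_subset_ball _ _ _)
  have hbc : ∀ x ω, (base x ω).Nonempty → q / 2 * (N : ℝ) ^ l 0 ≤ (base x ω).card := by
    intro x ω h
    have h1 := (hne x ω).1 h
    simp only [hbase]
    rw [if_pos h1]
    exact h1.trans (Nat.cast_le.2 (markedSize_le_card _ _ _))
  have hbd : ∀ x, DependsOn (base x) (pairsIn (ball (l 0) x : Set (HierGroup N))) := by
    intro x ω ω' h
    simp only [hbase]
    rw [dependsOn_markedSize hG hl0 x h, dependsOn_cluster (l 0) x h]
  refine ⟨{ω | ∀ i, (core base l (q / 2) i x₀ ω).Nonempty}, ?_, ?_, ?_, ?_⟩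
  · rw [Set.ofPred_forall]
    exact MeasurableSet.iInter fun i => measurableSet_core_nonempty hl hmono hbd hbb i x₀
  · refine le_law_core_nonempty p hl hmono hbd hbb (by positivity) hbc hq le_rfl (fun y => ?_)
      (t := fun i => c₀ / (N : ℝ) ^ ((1 + δ) * (l (i + 2) : ℝ))) (fun i k hk hk' => ?_) hβ hβsum x₀
    · simp only [hne]
      rwa [law_markedSize_eq p hG hl0]
    · refine le_trans ?_ (hlow k (by omega))
      refine div_le_div_of_nonneg_left hc.le (Real.rpow_pos_of_pos (by linarith) _) ?_
      refine Real.rpow_le_rpow_of_exponent_le hN1 ?_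
      have : (k : ℝ) ≤ l (i + 2) := by exact_mod_cast hk'
      exact mul_le_mul_of_nonneg_left this (by linarith)
  · intro ω hω
    have h1 := (hne x₀ ω).1 (hω 0)
    refine mem_of_markedSize_pos (x₀ := x₀) (n := l 0) ?_
    have : (0 : ℝ) < markedSize x₀ G (l 0) x₀ ω := lt_of_lt_of_le (by positivity) h1
    exact_mod_cast this
  · intro ω hω
    exact finiteResistance_of_core_nonempty hl hmono hbs hbc hgap hlim hsum hω

/-- Almost surely, a vertex of an infinite cluster has finite resistance to infinity. -/
theorem ae_finiteResistance (hN : 2 ≤ N) (hp : Summable (wt N p)) {δ c₀ : ℝ} (hδ0 : 0 < δ)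
    (hδ1 : δ < 1) (hc : 0 < c₀)
    (hlow : ∀ k : ℕ, 1 ≤ k → c₀ / (N : ℝ) ^ ((1 + δ) * (k : ℝ)) ≤ p k) (x₀ : HierGroup N) :
    ∀ᵐ ω ∂(law N p), ((percGraph ω).connectedComponentMk x₀).supp.Infinite →
      FiniteResistance (percGraph ω) x₀ := by
  have hN0 : (0 : ℝ) < N := by exact_mod_cast NeZero.pos N
  have hN1 : (1 : ℝ) ≤ N := by exact_mod_cast NeZero.pos N
  set Bad : Set (Cfg N) := {ω | ((percGraph ω).connectedComponentMk x₀).supp.Infinite ∧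
    ¬ FiniteResistance (percGraph ω) x₀} with hBad
  suffices hzero : law N p Bad = 0 by
    filter_upwards [measure_eq_zero_iff_ae_notMem.1 hzero] with ω hω hinf
    by_contra hc
    exact hω ⟨hinf, hc⟩
  by_contra hne
  have hwpos : ∀ n, 0 < wt N p n := fun n => by
    have h1 := hlow (n + 1) (by omega)
    have h2 : 0 < c₀ / (N : ℝ) ^ ((1 + δ) * ((n + 1 : ℕ) : ℝ)) :=
      div_pos hc (Real.rpow_pos_of_pos hN0 _)
    exact mul_pos (by positivity) (h2.trans_le h1)
  -- Measurability of `Bad` is not needed: its hull meets every measurable set in the same measure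
  -- as `Bad` does.
  set H := toMeasurable (law N p) Bad with hH
  have hHm : MeasurableSet H := measurableSet_toMeasurable _ _
  set ρ := (law N p).real H with hρ
  have hρ0 : 0 < ρ := by
    rw [hρ, measureReal_def, measure_toMeasurable]
    exact ENNReal.toReal_pos hne (measure_ne_top _ _)
  have hρ1 : ρ ≤ 1 := measureReal_le_one
  -- Now `6 * ρ₁ = 2 * (ρ / 4)`, the probability supplied by `le_law_markedSize_tail`.
  set ρ₁ := ρ / 12 with hρ₁
  have hρ₁0 : 0 < ρ₁ := by positivity
  have hρ₁1 : ρ₁ ≤ 1 := by linarith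
  -- Makes `(ρ₁ / 2) ^ 2 * (s * wt N p m)` equal to `72` for `s = ρ₁ * K / (2 * wt N p m)`.
  set K := 576 / ρ₁ ^ 3 with hK
  have hK1 : 1 ≤ K := by
    rw [hK, one_le_div (by positivity)]
    have := pow_le_one₀ hρ₁0.le hρ₁1 (n := 3)
    linarith
  set M := 4 * K / ρ₁ with hM
  have hM0 : 0 ≤ M := by positivity
  -- Half of the probability `(ρ₁ / 2) ^ 3 / 48` of a dense cluster; the extra `N` converts density
  -- relative to `N ^ m` into density relative to `N ^ (m + 1)`.
  set q := (ρ₁ / 2) ^ 3 / (96 * N) with hq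
  have hq0 : 0 < q := by positivity
  have hexp := Real.exp_pos (-(2 * N * M))
  -- The constants so far depend only on `ρ` and `N`, not on the radius of the mark, so the accuracy
  -- of the approximation may be adapted to them.
  obtain ⟨ε, hε0, hε1, hε2⟩ : ∃ ε, 0 < ε ∧ ε ≤ Real.exp (-(2 * N * M)) * (ρ / 4) ∧ ε ≤ q :=
    ⟨min (Real.exp (-(2 * N * M)) * (ρ / 4)) q, lt_min (by positivity) hq0, min_le_left _ _,
      min_le_right _ _⟩
  obtain ⟨F, G, hGm, hGF, hGε⟩ := exists_dependsOn_approx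
    (fun e : Sym2 (HierGroup N) => bernoulliMeasure true false (p (lev e))) hHm hε0
  change law N p (symmDiff H G) < _ at hGε
  have hsymm : (law N p).real (symmDiff H G) < ε := by
    have := (ENNReal.toReal_lt_toReal (measure_ne_top _ _) ENNReal.ofReal_ne_top).2 hGε
    rwa [ENNReal.toReal_ofReal hε0.le] at this
  obtain ⟨n₀, hn₀⟩ := exists_subset_pairsIn_ball x₀ F
  have hG : DependsOn (fun ω => ω ∈ G) (pairsIn (ball n₀ x₀ : Set (HierGroup N))) :=
    fun ω ω' h => hGF fun e he => h e (hn₀ he)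
  -- `G` is nearly contained in `H`, and `H` meets a measurable set that misses `Bad` only in
  -- measure zero.
  have havoid : ∀ s, MeasurableSet s → s ⊆ G → (∀ ω ∈ s, ω ∈ Bad → False) →
      (law N p).real s < ε := by
    intro s hs hsG hsB
    have h1 : law N p (H ∩ s) = 0 := by
      rw [hH, Measure.measure_toMeasurable_inter hs (measure_ne_top _ _)]
      have : Bad ∩ s = ∅ := Set.eq_empty_of_forall_notMem fun ω hω => hsB ω hω.2 hω.1
      rw [this, measure_empty]
    have h2 : s ⊆ (H ∩ s) ∪ symmDiff H G := by
      intro ω hω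
      by_cases hωH : ω ∈ H
      · exact Or.inl ⟨hωH, hω⟩
      · exact Or.inr (Or.inr ⟨hsG hω, hωH⟩)
    have h3 := measureReal_mono (μ := law N p) h2 (measure_ne_top _ _)
    have h4 := measureReal_union_le (μ := law N p) (H ∩ s) (symmDiff H G)
    have h5 : (law N p).real (H ∩ s) = 0 := by rw [measureReal_def, h1]; rfl
    linarith
  have hlawG : 3 * (ρ / 4) ≤ (law N p).real G := by
    have h2 : H ⊆ G ∪ symmDiff H G := by
      intro ω hω
      by_cases hωG : ω ∈ G
      · exact Or.inl hωG
      · exact Or.inr (Or.inl ⟨hω, hωG⟩)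
    have h3 := measureReal_mono (μ := law N p) h2 (measure_ne_top _ _)
    have h4 := measureReal_union_le (μ := law N p) G (symmDiff H G)
    have h5 : Real.exp (-(2 * N * M)) ≤ 1 := by
      rw [Real.exp_le_one_iff]
      have : 0 ≤ 2 * N * M := by positivity
      linarith
    have h6 : Real.exp (-(2 * N * M)) * (ρ / 4) ≤ ρ / 4 :=
      mul_le_of_le_one_left (by positivity) h5
    linarith
  obtain ⟨n₁, hn₁⟩ : ∃ n₁, ∀ n, n₁ ≤ n → wt N p n < 1 / 2 :=
    Filter.eventually_atTop.1 (hp.tendsto_atTop_zero.eventually (gt_mem_nhds (by norm_num)))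
  obtain ⟨L₀, hL₀⟩ := exists_scales hN hδ0 hδ1 hc hq0
  set n := max n₀ (max n₁ L₀) with hn
  have hn0 : n₀ ≤ n := le_max_left _ _
  have hn1 : n₁ ≤ n := (le_max_left _ _).trans (le_max_right _ _)
  have hnL : L₀ ≤ n := (le_max_right _ _).trans (le_max_right _ _)
  have hhalf : ∀ k, n < k → (p k : ℝ) ≤ 1 / 2 := by
    intro k hk
    obtain ⟨j, rfl⟩ : ∃ j, k = j + 1 := ⟨k - 1, by omega⟩
    refine le_trans ?_ (hn₁ j (by omega)).le
    exact le_mul_of_one_le_left (p _).2.1 (one_le_pow₀ hN1)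
  have hτ : 0 < tailWt N p n := by
    have h1 := sum_wt_le_tailWt hp n (n + 1)
    rw [Nat.Ico_succ_singleton, Finset.sum_singleton] at h1
    exact (hwpos n).trans_le h1
  have hstart := le_law_markedSize_tail hp hG hn0 hhalf hτ hlawG
    (fun s hs hsG hsB => (havoid s hs hsG hsB).le.trans hε1) fun ω hω => hω.1
  obtain ⟨m, hm, hlevel⟩ := exists_level_markedSize_large p hG hN hp hwpos hρ₁0 hρ₁1 hK1 hn0 (by
    have e1 : 4 * K / (ρ₁ * tailWt N p n) = M / tailWt N p n := by
      rw [hM, div_div]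
    rw [e1]
    linarith)
  have hwm := hwpos m
  have hdense := le_law_markedSize_dense p hG hN (hn0.trans hm) (half_pos hρ₁0)
    (s := ρ₁ * K / (2 * wt N p m)) (by positivity) hlevel (by
      rw [hK]
      apply le_of_eq
      field_simp
      norm_num)
  obtain ⟨l, hl0, hl1, hmono, hlim, hgap, hsum, β, hβ, hβsum⟩ := hL₀ (m + 1) (by omega)
  obtain ⟨T, hTm, hTlaw, hTG, hTR⟩ := exists_law_finiteResistance hG hc hδ0 hlow hq0
    (by omega) hl1 hmono hlim hgap hsum hβ hβsum (by
      rw [hl0]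
      have h2q : 2 * q ≤ (ρ₁ / 2) ^ 3 / 48 := by
        have : 2 * q = (ρ₁ / 2) ^ 3 / 48 / N := by rw [hq]; field_simp; norm_num
        rw [this]
        exact div_le_self (by positivity) hN1
      refine h2q.trans (hdense.trans (measureReal_mono ?_ (measure_ne_top _ _)))
      refine Set.ofPred_subset_ofPred.2 fun ω hω => le_trans ?_ hω
      have h3 : q / 2 * (N : ℝ) ^ (m + 1) = (ρ₁ / 2) ^ 3 / 192 * (N : ℝ) ^ m := by
        rw [hq, pow_succ]; field_simp; ring
      rw [h3]
      refine mul_le_mul_of_nonneg_right ?_ (by positivity)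
      have h4 : (ρ₁ / 2) ^ 3 ≤ (ρ₁ / 2) ^ 1 :=
        pow_le_pow_of_le_one (by positivity) (by linarith) (by norm_num)
      rw [pow_one] at h4
      linarith)
  -- `T` is a part of `G` missing `Bad`, yet its probability is at least `q ≥ ε`.
  have := havoid T hTm hTG fun ω hω hb => hb.2 (hTR ω hω)
  linarith

end main

/-! ### Bounds for the connection probabilities. -/

section connProb

variable {N : ℕ} {δ : ℝ} {c : ℕ → ℝ}

/-- The minimum with `1` makes the lower bound survive the clamp, as the denominator is at least
`1`. -/
theorem min_le_connProb (hN : 1 ≤ N) (hδ : 0 < δ) {c₀ : ℝ} (hc : ∀ k, 1 ≤ k → c₀ ≤ c k) {k : ℕ}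
    (hk : 1 ≤ k) : min c₀ 1 / (N : ℝ) ^ ((1 + δ) * (k : ℝ)) ≤ connProb N δ c k := by
  have hN1 : (1 : ℝ) ≤ N := by exact_mod_cast hN
  have hpos : 1 ≤ (N : ℝ) ^ ((1 + δ) * (k : ℝ)) :=
    Real.one_le_rpow hN1 (by positivity)
  rw [connProb, Set.coe_projIcc]
  refine le_max_of_le_right (le_min ?_ ?_)
  · rw [div_le_one (by linarith)]
    exact (min_le_right _ _).trans hpos
  · exact div_le_div_of_nonneg_right ((min_le_left _ _).trans (hc k hk)) (by linarith)

theorem summable_wt_connProb (hN : 1 ≤ N) (hc : ∀ k, 1 ≤ k → 0 ≤ c k)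
    (hdeg : Summable fun k : ℕ => c k / (N : ℝ) ^ (δ * (k : ℝ))) :
    Summable (wt N (connProb N δ c)) := by
  have hN0 : (0 : ℝ) < N := by exact_mod_cast hN
  refine Summable.of_nonneg_of_le (wt_nonneg _) (fun n => ?_)
    (((summable_nat_add_iff 1).2 hdeg).mul_left (1 / (N : ℝ)))
  have h1 : (connProb N δ c (n + 1) : ℝ)
      ≤ c (n + 1) / (N : ℝ) ^ ((1 + δ) * ((n + 1 : ℕ) : ℝ)) := by
    rw [connProb, Set.coe_projIcc]
    refine max_le (div_nonneg (hc _ (by omega)) (Real.rpow_nonneg hN0.le _)) (min_le_right _ _)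
  have h2 : (N : ℝ) ^ ((1 + δ) * ((n + 1 : ℕ) : ℝ))
      = (N : ℝ) ^ n * N * (N : ℝ) ^ (δ * ((n + 1 : ℕ) : ℝ)) := by
    rw [add_mul, one_mul, Real.rpow_add hN0, Real.rpow_natCast, pow_succ]
  have h3 : 0 < (N : ℝ) ^ (δ * ((n + 1 : ℕ) : ℝ)) := Real.rpow_pos_of_pos hN0 _
  calc wt N (connProb N δ c) n
      ≤ (N : ℝ) ^ n * (c (n + 1) / (N : ℝ) ^ ((1 + δ) * ((n + 1 : ℕ) : ℝ))) := by
        unfold wt; gcongr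
    _ = 1 / N * (c (n + 1) / (N : ℝ) ^ (δ * ((n + 1 : ℕ) : ℝ))) := by
        rw [h2]; field_simp

end connProb

end HierPerc

theorem theoremT (N : ℕ) (hN : 2 ≤ N) (δ : ℝ) (hδ0 : 0 < δ) (hδ1 : δ < 1) (c : ℕ → ℝ)
    (hinf : ∃ c₀ : ℝ, 0 < c₀ ∧ ∀ k : ℕ, 1 ≤ k → c₀ ≤ c k)
    (hdeg : Summable fun k : ℕ => c k / (N : ℝ) ^ (δ * (k : ℝ))) :
    ∀ᵐ ω ∂(HierPerc.percLaw N δ c),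
      ∀ C : (HierPerc.percGraph ω).ConnectedComponent, C.supp.Infinite →
        HierPerc.SRWTransient C.toSimpleGraph := by
  have : NeZero N := ⟨by omega⟩
  obtain ⟨c₀, hc₀, hc⟩ := hinf
  have hp := HierPerc.summable_wt_connProb (δ := δ) (show 1 ≤ N by omega)
    (fun k hk => hc₀.le.trans (hc k hk)) hdeg
  rw [HierPerc.percLaw_eq_law]
  -- There are countably many vertices, so the exceptional null sets can be united.
  have hres : ∀ᵐ ω ∂(HierPerc.law N (HierPerc.connProb N δ c)), ∀ x,
      ((HierPerc.percGraph ω).connectedComponentMk x).supp.Infinite →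
        HierPerc.FiniteResistance (HierPerc.percGraph ω) x :=
    ae_all_iff.2 fun x => HierPerc.ae_finiteResistance hN hp hδ0 hδ1
      (lt_min hc₀ one_pos) (fun k hk => HierPerc.min_le_connProb (by omega) hδ0 hc hk) x
  filter_upwards [hres, HierPerc.ae_finite_neighborSet hp] with ω hω hfin C hC x
  have hx : (HierPerc.percGraph ω).connectedComponentMk x.1 = C := x.2
  refine HierPerc.srwLaw_pos_of_finiteResistance (fun y => ?_)
    (HierPerc.FiniteResistance.toSimpleGraph (hω x.1 (by rwa [hx])))
  exact ((hfin y.1).preimage Subtype.val_injective.injOn).subset fun z hz => hz
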